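/- Let $Z$ be a smooth, irreducible complex algebraic variety (separated and of finite type over $\mathbb{C}$; for instance quasi-projective), let $n\ge 0$, let $T=\operatorname{Spec}\mathbb{C}[x_1^{\pm1},\dots,x_n^{\pm1}]$, and let $\pi_Z:Z\times T\to Z$ be the projection. For a smooth variety $Y$ let $D_Y$ be the sheaf of rings of differential operators on $Y$. Put $K=\mathbb{C}(\nu_1,\dots,\nu_n)$. Let $R^{\mathrm{pol}}$ be the $\mathbb{C}$-algebra generated by $\nu_j,\sigma_j^{\pm1}$ ($1\le j\le n$) with relations $$[\sigma_i,\nu_j]=\delta_{ij}\sigma_j,\qquad [\sigma_i^{-1},\nu_j]=-\delta_{ij}\sigma_j^{-1},\qquad [\sigma_i,\sigma_j]=[\nu_i,\nu_j]=0,$$ so that $\nu_i\mapsto -x_i\partial_{x_i}$, $\sigma_i^{\pm1}\mapsto x_i^{\pm1}$ identifies $R^{\mathrm{pol}}$ with $\Gamma(T,D_T)$. Let $R=K\otimes_{\mathbb{C}[\nu]}R^{\mathrm{pol}}$, a ring in which $\sigma_i\,a(\nu)=a(\nu+e_i)\,\sigma_i$ for $a\in K$, where $e_i$ is the $i$-th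 unit vector, and let $\mathbb{D}=D_Z\otimes_{\mathbb{C}}R$, a sheaf of rings on $Z$ (elements of $D_Z$ commute with elements of $R$). Let $M$ be a left $D_{Z\times T}$-module. * Let $\mathfrak{M}^{\mathrm{pol}}(M)$ be the sheaf of abelian groups $\pi_{Z*}M$ on $Z$, on which $D_Z\otimes_{\mathbb{C}}R^{\mathrm{pol}}$ acts through $D_Z\otimes_{\mathbb{C}}R^{\mathrm{pol}}\cong D_Z\otimes_{\mathbb{C}}\Gamma(T,D_T)\to\pi_{Z*}D_{Z\times T}$. The partial Mellin transform of $M$ is the $\mathbb{D}$-module $$\mathfrak{M}(M)=K\otimes_{\mathbb{C}[\nu]}\mathfrak{M}^{\mathrm{pol}}(M),$$ on which $\sigma_i(a(\nu)\otimes m)=a(\nu+e_i)\otimes x_i m$. * For $k\ge 0$ let $$\Omega^k(M)=\bigoplus_{1\le i_1<\dots<i_k\le n}\bigl(K\otimes_{\mathbb{C}}\pi_{Z*}M\bigr)\,dx_{i_1}\wedge\dots\wedge dx_{i_k},$$ a sheaf on $Z$, and let $\nabla_\omega=d_x+\omega\wedge:\Omega^k(M)\to\Omega^{k+1}(M)$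 with $\omega=\sum_{j=1}^n\nu_j\,\frac{dx_j}{x_j}$; explicitly, $\nabla_\omega(\varphi\,dx_I)=\sum_{j=1}^n\bigl(\partial_{x_j}\varphi+\nu_jx_j^{-1}\varphi\bigr)\,dx_j\wedge dx_I$. The ring $\mathbb{D}$ acts on each $\Omega^k(M)$: $D_Z$ and $K$ act on the coefficients, and $\sigma_i$ acts on the coefficients by $\xi(\nu)\mapsto x_i\,\xi(\nu+e_i)$. This action commutes with $\nabla_\omega$, so $(\Omega^\bullet(M),\nabla_\omega)$ is a complex of $\mathbb{D}$-modules, and its cohomology sheaves are $\mathbb{D}$-modules. Then: 1. $\mathfrak{M}(M)\cong H^n(\Omega^\bullet(M),\nabla_\omega)$ as $\mathbb{D}$-modules; 2. $H^j(\Omega^\bullet(M),\nabla_\omega)=0$ for every $j\ne n$. -/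

import Mathlib

open CategoryTheory AlgebraicGeometry Opposite TopologicalSpace Limits
open scoped TensorProduct

noncomputable section

namespace PartialMellin

/-! ### Differential operators on a commutative algebra -/

section DiffOp

variable {k A B : Type*} [CommRing k] [CommRing A] [Algebra k A] [CommRing B] [Algebra k B]

/-- Grothendieck's differential operators: `IsDiffOp m P` says that the `k`-linear endomorphism
`P` of the `k`-algebra `A` is a differential operator of order `< m`, i.e. `P = 0` if `m = 0`, and
all commutators `[P, a]` with `a : A` are of order `< m - 1` otherwise. -/
def IsDiffOp : ℕ → Module.End k A → Prop
  | 0, P => P = 0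
  | m + 1, P => ∀ a : A, IsDiffOp m (P * LinearMap.mulLeft k a - LinearMap.mulLeft k a * P)

namespace IsDiffOp

theorem zero (m : ℕ) : IsDiffOp m (0 : Module.End k A) := by
  induction m with
  | zero => rfl
  | succ m ih => intro a; simpa using ih

theorem succ {m : ℕ} {P : Module.End k A} (h : IsDiffOp m P) : IsDiffOp (m + 1) P := by
  induction m generalizing P with
  | zero => cases h; exact zero 1
  | succ m ih => intro a; exact ih (h a)

theorem mono {m l : ℕ} (hml : m ≤ l) {P : Module.End k A} (h : IsDiffOp m P) : IsDiffOp l P := by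
  induction l, hml using Nat.le_induction with
  | base => exact h
  | succ l _ ih => exact ih.succ

theorem add {m : ℕ} {P Q : Module.End k A} (hP : IsDiffOp m P) (hQ : IsDiffOp m Q) :
    IsDiffOp m (P + Q) := by
  induction m generalizing P Q with
  | zero => cases hP; cases hQ; exact add_zero _
  | succ m ih =>
    intro a
    have := ih (hP a) (hQ a)
    convert this using 1
    simp only [mul_add, add_mul]; abel

theorem neg {m : ℕ} {P : Module.End k A} (hP : IsDiffOp m P) : IsDiffOp m (-P) := by
  induction m generalizing P with
  | zero => cases hP; exact neg_zero
  | succ m ih =>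
    intro a
    have := ih (hP a)
    convert this using 1
    ext x; simp; abel

theorem sub {m : ℕ} {P Q : Module.End k A} (hP : IsDiffOp m P) (hQ : IsDiffOp m Q) :
    IsDiffOp m (P - Q) := by
  rw [sub_eq_add_neg]; exact hP.add hQ.neg

theorem mulLeft_comm (a b : A) :
    LinearMap.mulLeft k a * LinearMap.mulLeft k b = LinearMap.mulLeft k b * LinearMap.mulLeft k a := by
  ext x; simp [mul_left_comm]

theorem of_mulLeft (a : A) : IsDiffOp 1 (LinearMap.mulLeft k a) := by
  intro b; rw [mulLeft_comm, sub_self]; exact zero 0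

theorem mul {m l : ℕ} {P Q : Module.End k A} (hP : IsDiffOp m P) (hQ : IsDiffOp l Q) :
    IsDiffOp (m + l) (P * Q) := by
  induction hs : m + l generalizing m l P Q with
  | zero =>
    obtain ⟨rfl, rfl⟩ : m = 0 ∧ l = 0 := by omega
    cases hP; exact zero_mul _
  | succ s ih =>
    rcases m with _ | m
    · cases hP; rw [zero_mul]; exact zero _
    rcases l with _ | l
    · cases hQ; rw [mul_zero]; exact zero _
    intro a
    have h1 := ih hP (hQ a) (by omega)
    have h2 := ih (hP a) hQ (by omega)
    convert h1.add h2 using 1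
    simp only [mul_sub, sub_mul, mul_assoc]; abel

theorem mulLeft_mul {m : ℕ} {P : Module.End k A} (hP : IsDiffOp m P) (b : A) :
    IsDiffOp m (LinearMap.mulLeft k b * P) := by
  induction m generalizing P with
  | zero => cases hP; exact mul_zero _
  | succ m ih =>
    intro a
    convert ih (hP a) using 1
    rw [mul_sub, ← mul_assoc (LinearMap.mulLeft k a), mulLeft_comm a b]
    simp only [mul_assoc]

theorem mul_mulLeft {m : ℕ} {P : Module.End k A} (hP : IsDiffOp m P) (b : A) :
    IsDiffOp m (P * LinearMap.mulLeft k b) := by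
  induction m generalizing P with
  | zero => cases hP; exact zero_mul _
  | succ m ih =>
    intro a
    convert ih (hP a) using 1
    rw [sub_mul, mul_assoc P, mul_assoc P, mulLeft_comm b a]
    simp only [mul_assoc]

theorem smul {m : ℕ} {P : Module.End k A} (hP : IsDiffOp m P) (c : k) : IsDiffOp m (c • P) := by
  have : c • P = LinearMap.mulLeft k (algebraMap k A c) * P := by
    ext x; simp [Algebra.smul_def]
  rw [this]; exact hP.mulLeft_mul _

/-- A derivation is a differential operator of order at most one. -/
theorem of_leibniz (P : Module.End k A) (h : ∀ a b, P (a * b) = a * P b + P a * b) :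
    IsDiffOp 2 P := by
  intro a
  convert of_mulLeft (k := k) (P a) using 1
  ext b
  simp [h]

end IsDiffOp

variable (k A) in
/-- The `k`-algebra of differential operators of the commutative `k`-algebra `A`. -/
def diffOp : Subalgebra k (Module.End k A) where
  carrier := {P | ∃ m, IsDiffOp m P}
  mul_mem' := fun ⟨_, hP⟩ ⟨_, hQ⟩ => ⟨_, hP.mul hQ⟩
  add_mem' := fun ⟨m, hP⟩ ⟨l, hQ⟩ =>
    ⟨max m l, (hP.mono (le_max_left _ _)).add (hQ.mono (le_max_right _ _))⟩
  algebraMap_mem' c := ⟨1, by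
    have h : algebraMap k (Module.End k A) c = LinearMap.mulLeft k (algebraMap k A c) := by
      ext x; simp [Algebra.smul_def]
    rw [h]; exact IsDiffOp.of_mulLeft _⟩

theorem mem_diffOp {P : Module.End k A} : P ∈ diffOp k A ↔ ∃ m, IsDiffOp m P := Iff.rfl

variable (k) in
/-- Multiplication by an element, as a differential operator. -/
def diffOp.mulOp (a : A) : diffOp k A := ⟨LinearMap.mulLeft k a, 1, IsDiffOp.of_mulLeft a⟩

section Localization

variable [Algebra A B]

theorem IsDiffOp.eq_zero_of_localization (S : Submonoid A) [IsLocalization S B]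
    {m : ℕ} {Q : Module.End k B} (hQ : IsDiffOp m Q)
    (h : ∀ a : A, Q (algebraMap A B a) = 0) : Q = 0 := by
  induction m generalizing Q with
  | zero => exact hQ
  | succ m ih =>
    have hc : ∀ a : A, Q * LinearMap.mulLeft k (algebraMap A B a) -
        LinearMap.mulLeft k (algebraMap A B a) * Q = 0 := fun a => by
      refine ih (hQ _) fun c => ?_
      simp [← map_mul, h]
    ext b
    obtain ⟨⟨a, s⟩, hs⟩ := IsLocalization.surj S b
    have h1 := LinearMap.congr_fun (hc s) b
    simp only [LinearMap.sub_apply, Module.End.mul_apply, LinearMap.mulLeft_apply,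
      LinearMap.zero_apply] at h1
    rw [mul_comm, hs, h, zero_sub, neg_eq_zero] at h1
    exact (IsLocalization.map_units B s).mul_right_eq_zero.mp h1

theorem IsDiffOp.exists_localization [IsScalarTower k A B] (S : Submonoid A) [IsLocalization S B] 
    {m : ℕ} {P : Module.End k A} (hP : IsDiffOp m P) :
    ∃ Q : Module.End k B, IsDiffOp m Q ∧ ∀ a : A, Q (algebraMap A B a) = algebraMap A B (P a) := by
  induction m generalizing P with
  | zero => cases hP; exact ⟨0, rfl, fun a => by simp⟩
  | succ m ih =>
    choose R hR hR' using fun a : A => ih (hP a)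
    simp only [LinearMap.sub_apply, Module.End.mul_apply, LinearMap.mulLeft_apply, map_sub,
      map_mul] at hR'
    -- uniqueness
    have uniq : ∀ {l : ℕ} {Q Q' : Module.End k B}, IsDiffOp l Q → IsDiffOp l Q' →
        (∀ a : A, Q (algebraMap A B a) = Q' (algebraMap A B a)) → Q = Q' := by
      intro l Q Q' h h' e
      rw [← sub_eq_zero]
      exact (h.sub h').eq_zero_of_localization S fun a => by simp [e]
    have comm : ∀ a c : A, ∀ b : B, R a (algebraMap A B c * b) - algebraMap A B c * R a b =
        R c (algebraMap A B a * b) - algebraMap A B a * R c b := by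
      intro a c b
      have := uniq (l := m + 1)
        (Q := R a * LinearMap.mulLeft k (algebraMap A B c) -
          LinearMap.mulLeft k (algebraMap A B c) * R a)
        (Q' := R c * LinearMap.mulLeft k (algebraMap A B a) -
          LinearMap.mulLeft k (algebraMap A B a) * R c)
        (((hR a).mul_mulLeft _).sub ((hR a).mulLeft_mul _)).succ
        (((hR c).mul_mulLeft _).sub ((hR c).mulLeft_mul _)).succ
        (fun x => by
          simp only [LinearMap.sub_apply, Module.End.mul_apply, LinearMap.mulLeft_apply,
            ← map_mul, hR']
          rw [mul_left_comm c a x]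
          simp only [map_mul]
          ring)
      simpa using LinearMap.congr_fun this b
    have wd : ∀ x y : A, algebraMap A B x = algebraMap A B y →
        algebraMap A B (P x) = algebraMap A B (P y) := by
      intro x y hxy
      obtain ⟨u, hu⟩ := (IsLocalization.eq_iff_exists S B).mp hxy
      have h1 := hR' u x
      have h2 := hR' u y
      rw [hu] at h1
      rw [hxy, h2, sub_right_inj] at h1
      exact (IsLocalization.map_units B u).mul_left_cancel h1.symm
    have ex : ∀ b : B, ∃ c : B, ∀ (s : S) (a : A), algebraMap A B s * b = algebraMap A B a →
        algebraMap A B s * c = algebraMap A B (P a) - R s b := by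
      intro b
      obtain ⟨⟨a₀, s₀⟩, h₀⟩ := IsLocalization.surj S b
      dsimp only at h₀
      obtain ⟨u, hu⟩ := IsLocalization.map_units B s₀
      rw [mul_comm] at h₀
      refine ⟨↑u⁻¹ * (algebraMap A B (P a₀) - R s₀ b), fun s a h => ?_⟩
      refine (IsLocalization.map_units B s₀).mul_left_cancel ?_
      have e1 : algebraMap A B (s₀ : A) * (↑u⁻¹ * (algebraMap A B (P a₀) - R s₀ b)) =
          algebraMap A B (P a₀) - R s₀ b := by rw [← hu, ← mul_assoc, Units.mul_inv, one_mul]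
      rw [mul_left_comm, e1]
      have e2 := wd (s * a₀) (s₀ * a) (by rw [map_mul, map_mul, ← h, ← h₀]; ring)
      have e3 := hR' s a₀
      have e4 := hR' s₀ a
      have e5 := comm s s₀ b
      rw [h, h₀] at e5
      linear_combination e2 - e4 + e3 - e5
    choose Q hQ using ex
    have cd : ∀ b : B, ∃ (s : S) (a : A), algebraMap A B s * b = algebraMap A B a := fun b => by
      obtain ⟨⟨a, s⟩, h⟩ := IsLocalization.surj S b
      exact ⟨s, a, by rw [mul_comm]; exact h⟩
    have sm : ∀ (c : k) (a : A), algebraMap A B (c • a) = c • algebraMap A B a := fun c a =>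
      map_smul (IsScalarTower.toAlgHom k A B) c a
    let Q' : Module.End k B :=
      { toFun := Q
        map_add' := fun b b' => by
          obtain ⟨s, a, h⟩ := cd b
          obtain ⟨s', a', h'⟩ := cd b'
          have h1 : algebraMap A B (s * s' : S) * b = algebraMap A B (s' * a) := by
            rw [Submonoid.coe_mul, map_mul, map_mul, ← h]; ring
          have h2 : algebraMap A B (s * s' : S) * b' = algebraMap A B (s * a') := by
            rw [Submonoid.coe_mul, map_mul, map_mul, ← h']; ring
          have h3 : algebraMap A B (s * s' : S) * (b + b') =
            algebraMap A B (s' * a + s * a') := by rw [mul_add, h1, h2, map_add]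
          refine (IsLocalization.map_units B (s * s')).mul_left_cancel ?_
          rw [hQ _ _ _ h3, mul_add, hQ _ _ _ h1, hQ _ _ _ h2, map_add, map_add, map_add]
          ring
        map_smul' := fun c b => by
          obtain ⟨s, a, h⟩ := cd b
          have h3 : algebraMap A B s * (c • b) = algebraMap A B (c • a) := by
            rw [mul_smul_comm, h, sm]
          refine (IsLocalization.map_units B s).mul_left_cancel ?_
          rw [hQ _ _ _ h3, RingHom.id_apply, mul_smul_comm, hQ _ _ _ h, map_smul P, map_smul (R s),
            sm, smul_sub] }
    have R1 : R 1 = 0 := (hR 1).eq_zero_of_localization S fun a => by rw [hR']; simp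
    have hQA : ∀ a : A, Q' (algebraMap A B a) = algebraMap A B (P a) := fun a => by
      have := hQ (algebraMap A B a) 1 a (by simp)
      rw [OneMemClass.coe_one, R1, map_one, one_mul, LinearMap.zero_apply, sub_zero] at this
      exact this
    have hQR : ∀ a : A, Q' * LinearMap.mulLeft k (algebraMap A B a) -
        LinearMap.mulLeft k (algebraMap A B a) * Q' = R a := fun a => by
      ext b
      obtain ⟨s, c, h⟩ := cd b
      have h' : algebraMap A B s * (algebraMap A B a * b) = algebraMap A B (a * c) := by
        rw [map_mul, ← h]; ring
      have e1 := hQ _ _ _ h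
      have e2 := hQ _ _ _ h'
      have e3 := comm a s b
      have e4 := hR' a c
      rw [h] at e3
      refine (IsLocalization.map_units B s).mul_left_cancel ?_
      change algebraMap A B s * (Q (algebraMap A B a * b) - algebraMap A B a * Q b) = _
      linear_combination e2 - algebraMap A B a * e1 - e4 + e3
    refine ⟨Q', fun b => ?_, hQA⟩
    obtain ⟨s, a, h⟩ := cd b
    obtain ⟨u, hu⟩ := IsLocalization.map_units B s
    have hb : b = ↑u⁻¹ * algebraMap A B a := by rw [← h, ← hu, ← mul_assoc, Units.inv_mul, one_mul]
    have : Q' * LinearMap.mulLeft k b - LinearMap.mulLeft k b * Q' =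
        LinearMap.mulLeft k (↑u⁻¹ : B) * (R a - R s * LinearMap.mulLeft k b) := by
      rw [← hQR, ← hQR]
      ext x
      simp only [LinearMap.sub_apply, Module.End.mul_apply, LinearMap.mulLeft_apply]
      have h2 : algebraMap A B s * (b * x) = algebraMap A B a * x := by rw [← h]; ring
      have h3 : (↑u⁻¹ : B) * algebraMap A B s = 1 := by rw [← hu, Units.inv_mul]
      rw [h2, ← h]
      linear_combination (b * Q' x - Q' (b * x)) * h3
    rw [this]
    exact ((hR a).sub ((hR s).mul_mulLeft _)).mulLeft_mul _

theorem diffOp.localization_ext (S : Submonoid A) [IsLocalization S B]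
    {Q Q' : diffOp k B}
    (h : ∀ a : A, Q.1 (algebraMap A B a) = Q'.1 (algebraMap A B a)) : Q = Q' := by
  obtain ⟨m, hm⟩ := (Q - Q').2
  have := hm.eq_zero_of_localization S fun a => by simp [h]
  exact sub_eq_zero.mp (Subtype.ext this)

theorem diffOp.existsUnique_localization [IsScalarTower k A B] (S : Submonoid A) [IsLocalization S B] 
    (P : diffOp k A) :
    ∃! Q : diffOp k B, ∀ a : A, Q.1 (algebraMap A B a) = algebraMap A B (P.1 a) := by
  obtain ⟨m, hm⟩ := P.2
  obtain ⟨Q, hQ, h⟩ := hm.exists_localization (B := B) S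
  exact ⟨⟨Q, m, hQ⟩, h, fun Q' h' => localization_ext S fun a => by rw [h', h]⟩

/-- The extension of differential operators to a localization: the unique differential operator
of the localization that restricts to the given one. -/
def diffOp.localizeFun [IsScalarTower k A B] (S : Submonoid A) [IsLocalization S B] 
    (P : diffOp k A) : diffOp k B :=
  (existsUnique_localization (B := B) S P).choose

theorem diffOp.localizeFun_apply [IsScalarTower k A B] (S : Submonoid A) [IsLocalization S B] 
    (P : diffOp k A) (a : A) :
    (diffOp.localizeFun (B := B) S P).1 (algebraMap A B a) = algebraMap A B (P.1 a) :=
  (existsUnique_localization (B := B) S P).choose_spec.1 a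

/-- The extension of differential operators to a localization, as a homomorphism of algebras. -/
def diffOp.localize [IsScalarTower k A B] (S : Submonoid A) [IsLocalization S B] :
     diffOp k A →ₐ[k] diffOp k B :=
  AlgHom.ofLinearMap
    { toFun := diffOp.localizeFun S
      map_add' := fun P P' => localization_ext S fun a => by simp [localizeFun_apply]
      map_smul' := fun c P => localization_ext S fun a => by
        have sm : ∀ (c : k) (a : A), algebraMap A B (c • a) = c • algebraMap A B a := fun c a =>
          map_smul (IsScalarTower.toAlgHom k A B) c a
        simp [localizeFun_apply, sm] }
    (localization_ext S fun a => by simp [localizeFun_apply])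
    (fun P P' => localization_ext S fun a => by simp [localizeFun_apply])

theorem diffOp.localize_apply [IsScalarTower k A B] (S : Submonoid A) [IsLocalization S B] 
    (P : diffOp k A) (a : A) :
    (diffOp.localize (B := B) S P).1 (algebraMap A B a) = algebraMap A B (P.1 a) :=
  localizeFun_apply S P a

end Localization

section Tensor

theorem IsDiffOp.rTensor {m : ℕ} {P : Module.End k A} (hP : IsDiffOp m P) :
    IsDiffOp m (LinearMap.rTensor B P : Module.End k (A ⊗[k] B)) := by
  induction m generalizing P with
  | zero => cases hP; exact LinearMap.rTensor_zero B
  | succ m ih =>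
    intro x
    induction x with
    | zero => simpa using zero m
    | add x y hx hy =>
      convert hx.add hy using 1
      rw [show LinearMap.mulLeft k (x + y) = LinearMap.mulLeft k x + LinearMap.mulLeft k y from
        map_add (LinearMap.mul k (A ⊗[k] B)) x y]
      simp only [mul_add, add_mul]; abel
    | tmul a b =>
      convert (ih (hP a)).mulLeft_mul (1 ⊗ₜ b : A ⊗[k] B) using 1
      ext c d
      simp [mul_sub, Algebra.TensorProduct.tmul_mul_tmul]

theorem IsDiffOp.lTensor {m : ℕ} {P : Module.End k B} (hP : IsDiffOp m P) :
    IsDiffOp m (LinearMap.lTensor A P : Module.End k (A ⊗[k] B)) := by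
  induction m generalizing P with
  | zero => cases hP; exact LinearMap.lTensor_zero A
  | succ m ih =>
    intro x
    induction x with
    | zero => simpa using zero m
    | add x y hx hy =>
      convert hx.add hy using 1
      rw [show LinearMap.mulLeft k (x + y) = LinearMap.mulLeft k x + LinearMap.mulLeft k y from
        map_add (LinearMap.mul k (A ⊗[k] B)) x y]
      simp only [mul_add, add_mul]; abel
    | tmul a b =>
      convert (ih (hP b)).mulLeft_mul (a ⊗ₜ 1 : A ⊗[k] B) using 1
      ext c d
      simp [mul_sub, Algebra.TensorProduct.tmul_mul_tmul]

variable (k A B) in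
/-- The external product `P ⊠ Q` of differential operators, acting on `A ⊗ B` by
`a ⊗ b ↦ P a ⊗ Q b`. -/
def diffOp.box : diffOp k A ⊗[k] diffOp k B →ₐ[k] diffOp k (A ⊗[k] B) :=
  AlgHom.codRestrict
    ((Module.endTensorEndAlgHom (R := k) (S := k) (A := k) (M := A) (N := B)).comp
      (Algebra.TensorProduct.map (diffOp k A).val (diffOp k B).val)) (diffOp k (A ⊗[k] B)) (by
    intro x
    induction x with
    | zero => rw [map_zero]; exact zero_mem _
    | add x y hx hy => rw [map_add]; exact add_mem hx hy
    | tmul P Q =>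
      have : Module.endTensorEndAlgHom (R := k) (S := k) (A := k) (M := A) (N := B)
          (P.1 ⊗ₜ[k] Q.1) =
          (LinearMap.rTensor B P.1 : Module.End k (A ⊗[k] B)) * LinearMap.lTensor A Q.1 := by
        ext c d; simp [Module.endTensorEndAlgHom_apply]
      simp only [AlgHom.coe_comp, Function.comp_apply, Algebra.TensorProduct.map_tmul,
        Subalgebra.coe_val, this]
      obtain ⟨m, hm⟩ := P.2
      obtain ⟨l, hl⟩ := Q.2
      exact ⟨_, hm.rTensor.mul hl.lTensor⟩)

theorem diffOp.box_apply (P : diffOp k A) (Q : diffOp k B) (a : A) (b : B) :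
    (diffOp.box k A B (P ⊗ₜ Q)).1 (a ⊗ₜ b) = P.1 a ⊗ₜ Q.1 b := by
  simp [diffOp.box, Module.endTensorEndAlgHom_apply]

end Tensor

end DiffOp

/-! ### The torus, the parameters and the rings `R^pol` and `R` -/

section Torus

/-- The group `ℤⁿ`, written multiplicatively; `m` stands for the monomial `x^m` and for the shift
`ν ↦ ν + m`. -/
abbrev Lattice (n : ℕ) : Type := Fin n → Multiplicative ℤ

/-- The `i`-th unit vector `e_i`. -/
def unitVec {n : ℕ} (i : Fin n) : Lattice n := Pi.mulSingle i (Multiplicative.ofAdd 1)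

/-- The coordinate ring `ℂ[x_1^{±1}, …, x_n^{±1}]` of the torus. -/
abbrev Laurent (n : ℕ) : Type := MonoidAlgebra ℂ (Lattice n)

/-- The monomial `x^m`. -/
def Laurent.monomial {n : ℕ} (m : Lattice n) : Laurent n := MonoidAlgebra.single m 1

/-- The partial derivative `∂/∂x_i` of Laurent polynomials, `x^m ↦ m_i x^{m - e_i}`. -/
def Laurent.pderiv {n : ℕ} (i : Fin n) : Module.End ℂ (Laurent n) :=
  (Finsupp.linearCombination ℂ fun m : Lattice n =>
    ((m i).toAdd : ℂ) • Laurent.monomial (m * (unitVec i)⁻¹)) ∘ₗ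
      (MonoidAlgebra.coeffLinearEquiv ℂ).toLinearMap

theorem Laurent.pderiv_single {n : ℕ} (i : Fin n) (m : Lattice n) (c : ℂ) :
    Laurent.pderiv i (MonoidAlgebra.single m c) =
      MonoidAlgebra.single (m * (unitVec i)⁻¹) (((m i).toAdd : ℂ) * c) := by
  simp [Laurent.pderiv, Laurent.monomial, mul_comm]

theorem Laurent.end_ext {n : ℕ} {P Q : Module.End ℂ (Laurent n)}
    (h : ∀ m : Lattice n, P (MonoidAlgebra.single m 1) = Q (MonoidAlgebra.single m 1)) : P = Q := by
  refine MonoidAlgebra.lhom_ext' fun m => ?_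
  refine LinearMap.ext_ring ?_
  exact h m

theorem Laurent.pderiv_mul {n : ℕ} (i : Fin n) (a b : Laurent n) :
    Laurent.pderiv i (a * b) = a * Laurent.pderiv i b + Laurent.pderiv i a * b := by
  induction a using MonoidAlgebra.induction_linear with
  | zero => simp
  | add a a' h h' => rw [add_mul, map_add, h, h', map_add]; ring
  | single m c =>
    induction b using MonoidAlgebra.induction_linear with
    | zero => simp
    | add b b' h h' => rw [mul_add, map_add, h, h', map_add]; ring
    | single l d =>
      simp only [MonoidAlgebra.single_mul_single, Laurent.pderiv_single, Pi.mul_apply, toAdd_mul,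
        Int.cast_add]
      rw [← mul_assoc m l, mul_right_comm m (unitVec i)⁻¹ l, ← MonoidAlgebra.single_add]
      congr 1; ring

/-- The ring `Γ(T, D_T)` of differential operators of the torus. -/
def TorusOp (n : ℕ) : Type := diffOp ℂ (Laurent n)

instance (n : ℕ) : Ring (TorusOp n) := inferInstanceAs (Ring (diffOp ℂ (Laurent n)))

instance (n : ℕ) : Algebra ℂ (TorusOp n) := inferInstanceAs (Algebra ℂ (diffOp ℂ (Laurent n)))

/-- Multiplication by the monomial `x^m`. -/
def TorusOp.x {n : ℕ} (m : Lattice n) : TorusOp n := diffOp.mulOp ℂ (Laurent.monomial m)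

/-- The partial derivative `∂/∂x_i`. -/
def TorusOp.pd {n : ℕ} (i : Fin n) : TorusOp n :=
  ⟨Laurent.pderiv i, 2, IsDiffOp.of_leibniz _ (Laurent.pderiv_mul i)⟩

theorem TorusOp.ext {n : ℕ} {P Q : TorusOp n}
    (h : ∀ m : Lattice n, P.1 (MonoidAlgebra.single m 1) = Q.1 (MonoidAlgebra.single m 1)) :
    P = Q :=
  Subtype.ext (Laurent.end_ext h)

theorem TorusOp.x_single {n : ℕ} (m l : Lattice n) (c : ℂ) :
    (TorusOp.x m).1 (MonoidAlgebra.single l c) = MonoidAlgebra.single (m * l) c := by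
  simp [TorusOp.x, diffOp.mulOp, Laurent.monomial, MonoidAlgebra.single_mul_single]

theorem TorusOp.pd_single {n : ℕ} (i : Fin n) (l : Lattice n) (c : ℂ) :
    (TorusOp.pd i).1 (MonoidAlgebra.single l c) =
      MonoidAlgebra.single (l * (unitVec i)⁻¹) (((l i).toAdd : ℂ) * c) :=
  Laurent.pderiv_single i l c

theorem TorusOp.x_one {n : ℕ} : TorusOp.x (1 : Lattice n) = 1 :=
  TorusOp.ext fun m => by rw [TorusOp.x_single, one_mul]; rfl

theorem TorusOp.x_mul {n : ℕ} (m l : Lattice n) :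
    TorusOp.x (m * l) = TorusOp.x m * TorusOp.x l :=
  TorusOp.ext fun k => by
    change _ = (TorusOp.x m).1 ((TorusOp.x l).1 _)
    simp only [TorusOp.x_single, mul_assoc]

theorem unitVec_apply {n : ℕ} (i j : Fin n) :
    ((unitVec i j).toAdd : ℤ) = if i = j then 1 else 0 := by
  by_cases h : i = j
  · subst h; simp [unitVec]
  · simp [unitVec, h]

theorem TorusOp.pd_comm {n : ℕ} (i j : Fin n) :
    TorusOp.pd i * TorusOp.pd j = TorusOp.pd j * TorusOp.pd i :=
  TorusOp.ext fun k => by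
    change (TorusOp.pd i).1 ((TorusOp.pd j).1 _) = (TorusOp.pd j).1 ((TorusOp.pd i).1 _)
    simp only [TorusOp.pd_single, mul_right_comm k (unitVec j)⁻¹, Pi.mul_apply, Pi.inv_apply,
      toAdd_mul, toAdd_inv, unitVec_apply]
    congr 1
    by_cases h : i = j
    · subst h; ring
    · simp [h, Ne.symm h]; ring

/-- `∂_i ∘ x^m = x^m ∘ ∂_i + m_i x^{m - e_i}`. -/
theorem TorusOp.pd_x {n : ℕ} (i : Fin n) (m : Lattice n) :
    TorusOp.pd i * TorusOp.x m =
      TorusOp.x m * TorusOp.pd i + ((m i).toAdd : ℂ) • TorusOp.x (m * (unitVec i)⁻¹) :=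
  TorusOp.ext fun k => by
    change (TorusOp.pd i).1 ((TorusOp.x m).1 _) =
      (TorusOp.x m).1 ((TorusOp.pd i).1 _) + ((m i).toAdd : ℂ) • (TorusOp.x _).1 _
    simp only [TorusOp.pd_single, TorusOp.x_single, Pi.mul_apply, toAdd_mul, Int.cast_add,
      MonoidAlgebra.smul_single, smul_eq_mul]
    rw [mul_right_comm m _ k, ← mul_assoc m k, ← MonoidAlgebra.single_add]
    congr 1; ring

/-- The polynomial ring `ℂ[ν_1, …, ν_n]`. -/
abbrev ParamRing (n : ℕ) : Type := MvPolynomial (Fin n) ℂ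

/-- The field `K = ℂ(ν_1, …, ν_n)`. -/
abbrev ParamField (n : ℕ) : Type := FractionRing (ParamRing n)

/-- The shift `p(ν) ↦ p(ν + m)` of polynomials. -/
def shiftPolyHom {n : ℕ} (m : Lattice n) : ParamRing n →ₐ[ℂ] ParamRing n :=
  MvPolynomial.aeval fun j => MvPolynomial.X j + MvPolynomial.C ((m j).toAdd : ℂ)

theorem shiftPolyHom_mul {n : ℕ} (m l : Lattice n) :
    shiftPolyHom (m * l) = (shiftPolyHom m).comp (shiftPolyHom l) := by
  ext j
  simp [shiftPolyHom]
  ring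

theorem shiftPolyHom_one {n : ℕ} : shiftPolyHom (1 : Lattice n) = AlgHom.id ℂ _ := by
  ext j; simp [shiftPolyHom]

/-- The shifts `p(ν) ↦ p(ν + m)` of polynomials, as an action of `ℤⁿ`. -/
def shiftPoly (n : ℕ) : Lattice n →* (ParamRing n ≃ₐ[ℂ] ParamRing n) where
  toFun m := AlgEquiv.ofAlgHom (shiftPolyHom m) (shiftPolyHom m⁻¹)
    (by rw [← shiftPolyHom_mul, mul_inv_cancel, shiftPolyHom_one])
    (by rw [← shiftPolyHom_mul, inv_mul_cancel, shiftPolyHom_one])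
  map_one' := AlgEquiv.ext fun p => by simp [shiftPolyHom_one]
  map_mul' m l := AlgEquiv.ext fun p => by simp [shiftPolyHom_mul]

theorem shiftPoly_X {n : ℕ} (m : Lattice n) (j : Fin n) :
    shiftPoly n m (MvPolynomial.X j) = MvPolynomial.X j + MvPolynomial.C ((m j).toAdd : ℂ) := by
  change shiftPolyHom m (MvPolynomial.X j) = _
  rw [shiftPolyHom, MvPolynomial.aeval_X]

/-- The shifts `a(ν) ↦ a(ν + m)` of rational functions, as an action of `ℤⁿ`. -/
def shiftField (n : ℕ) : Lattice n →* (ParamField n ≃ₐ[ℂ] ParamField n) :=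
  (IsFractionRing.fieldEquivOfAlgEquivHom (A := ℂ) (B := ParamRing n) ℂ (ParamField n)).comp
    (shiftPoly n)

theorem shiftField_algebraMap {n : ℕ} (m : Lattice n) (p : ParamRing n) :
    shiftField n m (algebraMap _ (ParamField n) p) =
      algebraMap _ (ParamField n) (shiftPoly n m p) := by
  simp [shiftField]

/-- `ℤⁿ` acts on `K` by `(m • a)(ν) = a(ν + m)`. -/
instance paramFieldAction (n : ℕ) : MulSemiringAction (Lattice n) (ParamField n) where
  smul m a := shiftField n m a
  one_smul a := by change shiftField n 1 a = a; simp
  mul_smul m l a := by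
    change shiftField n (m * l) a = shiftField n m (shiftField n l a); simp
  smul_zero m := map_zero (shiftField n m)
  smul_add m := map_add (shiftField n m)
  smul_one m := map_one (shiftField n m)
  smul_mul m := map_mul (shiftField n m)

theorem paramField_smul_def {n : ℕ} (m : Lattice n) (a : ParamField n) :
    m • a = shiftField n m a := rfl

instance (n : ℕ) : SMulCommClass (Lattice n) ℂ (ParamField n) where
  smul_comm m c a := (shiftField n m).toLinearMap.map_smul c a

/-- The generators `ν_j, σ_j, σ_j⁻¹` of `R^pol`. -/
inductive RGen (n : ℕ) : Type
  | nu (j : Fin n)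
  | sig (j : Fin n)
  | sigInv (j : Fin n)

/-- The defining relations of `R^pol`. -/
inductive RRel (n : ℕ) : FreeAlgebra ℂ (RGen n) → FreeAlgebra ℂ (RGen n) → Prop
  | sig_sigInv (i : Fin n) : RRel n
      (FreeAlgebra.ι ℂ (RGen.sig i) * FreeAlgebra.ι ℂ (RGen.sigInv i)) 1
  | sigInv_sig (i : Fin n) : RRel n
      (FreeAlgebra.ι ℂ (RGen.sigInv i) * FreeAlgebra.ι ℂ (RGen.sig i)) 1
  | sig_nu (i j : Fin n) : RRel n
      (FreeAlgebra.ι ℂ (RGen.sig i) * FreeAlgebra.ι ℂ (RGen.nu j) -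
        FreeAlgebra.ι ℂ (RGen.nu j) * FreeAlgebra.ι ℂ (RGen.sig i))
      (if i = j then FreeAlgebra.ι ℂ (RGen.sig j) else 0)
  | sigInv_nu (i j : Fin n) : RRel n
      (FreeAlgebra.ι ℂ (RGen.sigInv i) * FreeAlgebra.ι ℂ (RGen.nu j) -
        FreeAlgebra.ι ℂ (RGen.nu j) * FreeAlgebra.ι ℂ (RGen.sigInv i))
      (if i = j then - FreeAlgebra.ι ℂ (RGen.sigInv j) else 0)
  | sig_sig (i j : Fin n) : RRel n
      (FreeAlgebra.ι ℂ (RGen.sig i) * FreeAlgebra.ι ℂ (RGen.sig j))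
      (FreeAlgebra.ι ℂ (RGen.sig j) * FreeAlgebra.ι ℂ (RGen.sig i))
  | nu_nu (i j : Fin n) : RRel n
      (FreeAlgebra.ι ℂ (RGen.nu i) * FreeAlgebra.ι ℂ (RGen.nu j))
      (FreeAlgebra.ι ℂ (RGen.nu j) * FreeAlgebra.ι ℂ (RGen.nu i))

/-- The ring `R^pol` generated by `ν_j, σ_j^{±1}` with the relations `[σ_i, ν_j] = δ_ij σ_j`,
`[σ_i⁻¹, ν_j] = -δ_ij σ_j⁻¹`, `[σ_i, σ_j] = 0 = [ν_i, ν_j]`. -/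
abbrev Rpol (n : ℕ) : Type := RingQuot (RRel n)

namespace Rpol

variable {n : ℕ}

/-- The images of the generators in `R^pol`. -/
def gen (g : RGen n) : Rpol n := RingQuot.mkAlgHom ℂ (RRel n) (FreeAlgebra.ι ℂ g)

theorem rel {a b : FreeAlgebra ℂ (RGen n)} (h : RRel n a b) :
    RingQuot.mkAlgHom ℂ (RRel n) a = RingQuot.mkAlgHom ℂ (RRel n) b :=
  RingQuot.mkAlgHom_rel ℂ h

/-- The algebra homomorphism out of `R^pol` given by images of the generators. -/
def lift {A : Type*} [Ring A] [Algebra ℂ A] (f : RGen n → A)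
    (h₁ : ∀ i, f (.sig i) * f (.sigInv i) = 1) (h₂ : ∀ i, f (.sigInv i) * f (.sig i) = 1)
    (h₃ : ∀ i j, f (.sig i) * f (.nu j) - f (.nu j) * f (.sig i) = if i = j then f (.sig j) else 0)
    (h₄ : ∀ i j, f (.sigInv i) * f (.nu j) - f (.nu j) * f (.sigInv i) =
      if i = j then - f (.sigInv j) else 0)
    (h₅ : ∀ i j, f (.sig i) * f (.sig j) = f (.sig j) * f (.sig i))
    (h₆ : ∀ i j, f (.nu i) * f (.nu j) = f (.nu j) * f (.nu i)) : Rpol n →ₐ[ℂ] A :=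
  RingQuot.liftAlgHom ℂ ⟨FreeAlgebra.lift ℂ f, by
    intro a b h
    induction h with
    | sig_sigInv i => simpa using h₁ i
    | sigInv_sig i => simpa using h₂ i
    | sig_nu i j =>
      have := h₃ i j
      split_ifs with hij <;> simpa [hij] using this
    | sigInv_nu i j =>
      have := h₄ i j
      split_ifs with hij <;> simpa [hij] using this
    | sig_sig i j => simpa using h₅ i j
    | nu_nu i j => simpa using h₆ i j⟩

theorem lift_gen {A : Type*} [Ring A] [Algebra ℂ A] (f : RGen n → A) (h₁ h₂ h₃ h₄ h₅ h₆)
    (g : RGen n) : lift f h₁ h₂ h₃ h₄ h₅ h₆ (gen g) = f g := by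
  simp [lift, gen]

theorem nu_comm (i j : Fin n) : gen (.nu i) * gen (.nu j) = gen (.nu j) * gen (.nu i) := by
  simpa [gen] using rel (RRel.nu_nu i j)

/-- The shift operator `σ_i` as a unit. -/
def sigUnit (i : Fin n) : (Rpol n)ˣ where
  val := gen (.sig i)
  inv := gen (.sigInv i)
  val_inv := by simpa [gen] using rel (RRel.sig_sigInv i)
  inv_val := by simpa [gen] using rel (RRel.sigInv_sig i)

theorem sigUnit_comm (i j : Fin n) : Commute (sigUnit i) (sigUnit j) :=
  Units.ext (by simpa [gen, sigUnit] using rel (RRel.sig_sig i j))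

theorem sigUnit_pairwise : Pairwise fun i j : Fin n => ∀ a b : Multiplicative ℤ,
    Commute (zpowersHom (Rpol n)ˣ (sigUnit i) a) (zpowersHom (Rpol n)ˣ (sigUnit j) b) :=
  fun i j _ a b => by simpa [zpowersHom_apply] using (sigUnit_comm i j).zpow_zpow _ _

/-- The element `σ^m = σ_1^{m_1} ⋯ σ_n^{m_n}` of `R^pol`. -/
def sigma (n : ℕ) : Lattice n →* (Rpol n)ˣ :=
  MonoidHom.noncommPiCoprod (fun i => zpowersHom (Rpol n)ˣ (sigUnit i)) sigUnit_pairwise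

theorem sigma_unitVec (i : Fin n) : sigma n (unitVec i) = sigUnit i := by
  rw [sigma, unitVec, MonoidHom.noncommPiCoprod_mulSingle]; simp [zpowersHom_apply]

end Rpol

open scoped IsMulCommutative in
/-- Evaluation of polynomials at commuting elements of a possibly noncommutative algebra. -/
def commEval {n : ℕ} {A : Type*} [Ring A] [Algebra ℂ A] (a : Fin n → A)
    (h : ∀ i j, a i * a j = a j * a i) : ParamRing n →ₐ[ℂ] A :=
  haveI : IsMulCommutative (Algebra.adjoin ℂ (Set.range a)) :=
    Algebra.isMulCommutative_adjoin ℂ (by rintro _ ⟨i, rfl⟩ _ ⟨j, rfl⟩; exact h i j)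
  (Algebra.adjoin ℂ (Set.range a)).val.comp
    (MvPolynomial.aeval fun i =>
      (⟨a i, Algebra.subset_adjoin ⟨i, rfl⟩⟩ : Algebra.adjoin ℂ (Set.range a)))

theorem commEval_X {n : ℕ} {A : Type*} [Ring A] [Algebra ℂ A] (a : Fin n → A)
    (h : ∀ i j, a i * a j = a j * a i) (i : Fin n) : commEval a h (MvPolynomial.X i) = a i := by
  simp [commEval]

/-- The inclusion `ℂ[ν] → R^pol`. -/
def Rpol.nu (n : ℕ) : ParamRing n →ₐ[ℂ] Rpol n := commEval (fun j => gen (.nu j)) nu_comm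

theorem Rpol.nu_X {n : ℕ} (j : Fin n) : Rpol.nu n (MvPolynomial.X j) = gen (.nu j) :=
  commEval_X _ _ j

theorem Rpol.sigma_mul_nu {n : ℕ} (m : Lattice n) (p : ParamRing n) :
    (sigma n m : Rpol n) * nu n p = nu n (shiftPoly n m p) * sigma n m := by
  let S : Subgroup (Lattice n) :=
    { carrier := {m | ∀ p, (sigma n m : Rpol n) * nu n p = nu n (shiftPoly n m p) * sigma n m}
      one_mem' := fun p => by simp
      mul_mem' := fun {a b} ha hb p => by
        rw [map_mul, Units.val_mul, mul_assoc, hb, ← mul_assoc, ha, mul_assoc, map_mul]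
        rfl
      inv_mem' := fun {a} ha p => by
        have h := ha (shiftPoly n a⁻¹ p)
        rw [← AlgEquiv.mul_apply, ← map_mul, mul_inv_cancel, map_one, AlgEquiv.one_apply] at h
        rw [map_inv, Units.inv_mul_eq_iff_eq_mul, ← mul_assoc, h, mul_assoc, Units.mul_inv,
          mul_one] }
  suffices h : ∀ m, m ∈ S from h m p
  have hu : ∀ i, unitVec i ∈ S := by
    intro i p
    induction p using MvPolynomial.induction_on with
    | C c =>
      rw [← MvPolynomial.algebraMap_eq, AlgEquiv.commutes, AlgHom.commutes, Algebra.commutes]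
    | add p q hp hq => rw [map_add, mul_add, hp, hq, map_add, map_add, add_mul]
    | mul_X p j hp =>
      rw [map_mul, ← mul_assoc, hp, map_mul, map_mul, mul_assoc, mul_assoc]
      congr 1
      rw [shiftPoly_X, map_add, nu_X, sigma_unitVec, unitVec_apply, ← MvPolynomial.algebraMap_eq,
        AlgHom.commutes]
      have := rel (RRel.sig_nu i j)
      rw [map_sub, map_mul, map_mul] at this
      rw [add_mul, ← sub_eq_iff_eq_add']
      refine this.trans ?_
      split_ifs with hij
      · subst hij; simp [sigUnit, gen]
      · simp
  intro m
  rw [← Finset.univ_prod_mulSingle m]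
  refine S.prod_mem fun i _ => ?_
  have : Pi.mulSingle i (m i) = (unitVec i : Lattice n) ^ (m i).toAdd := by
    rw [unitVec, ← Pi.mulSingle_zpow, ← ofAdd_zsmul]; simp
  rw [this]
  exact S.zpow_mem (hu i) _

/-- The assignment `ν_i ↦ - x_i ∂_i`, `σ_i^{±1} ↦ x_i^{±1}` on generators. -/
def mellinGen {n : ℕ} {A : Type*} [Ring A] (x : Lattice n → A) (d : Fin n → A) : RGen n → A
  | .nu i => - (x (unitVec i) * d i)
  | .sig i => x (unitVec i)
  | .sigInv i => x (unitVec i)⁻¹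

/-- The homomorphism `ν_i ↦ - x_i ∂_i`, `σ_i^{±1} ↦ x_i^{±1}` from `R^pol` to an algebra in which
elements `x^m` and `∂_i` are given that satisfy the relations of the Weyl algebra of the torus. -/
def mellinLift {n : ℕ} {A : Type*} [Ring A] [Algebra ℂ A] (x : Lattice n → A) (d : Fin n → A)
    (x_one : x 1 = 1) (x_mul : ∀ m l, x (m * l) = x m * x l) (d_comm : ∀ i j, d i * d j = d j * d i)
    (d_x : ∀ i m, d i * x m = x m * d i + ((m i).toAdd : ℂ) • x (m * (unitVec i)⁻¹)) :
    Rpol n →ₐ[ℂ] A :=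
  Rpol.lift (mellinGen x d)
    (fun i => by simp only [mellinGen, ← x_mul, mul_inv_cancel, x_one])
    (fun i => by simp only [mellinGen, ← x_mul, inv_mul_cancel, x_one])
    (fun i j => by
      have h := d_x j (unitVec i)
      simp only [mellinGen, mul_neg, neg_mul, mul_assoc, h, mul_add]
      simp only [← mul_assoc, ← x_mul, mul_smul_comm, unitVec_apply,
        mul_comm (unitVec j) (unitVec i)]
      split_ifs with hij
      · subst hij; simp
      · simp)
    (fun i j => by
      have h := d_x j (unitVec i)⁻¹
      simp only [mellinGen, mul_neg, neg_mul, mul_assoc, h, mul_add]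
      simp only [← mul_assoc, ← x_mul, mul_smul_comm, Pi.inv_apply, toAdd_inv,
        unitVec_apply, mul_comm (unitVec j) (unitVec i)⁻¹]
      split_ifs with hij
      · subst hij
        simp
      · simp)
    (fun i j => by simp only [mellinGen, ← x_mul, mul_comm (unitVec j) (unitVec i)])
    (fun i j => by
      by_cases hij : i = j
      · subst hij; rfl
      have h := d_x i (unitVec j)
      have h' := d_x j (unitVec i)
      simp only [unitVec_apply, hij, Ne.symm hij, if_false, Int.cast_zero, zero_smul,
        add_zero] at h h'
      simp only [mellinGen]
      rw [neg_mul_neg, neg_mul_neg, mul_assoc, ← mul_assoc (d i), h, mul_assoc _ (d j),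
        ← mul_assoc (d j), h', mul_assoc _ (d i), mul_assoc _ (d j), d_comm i j, ← mul_assoc,
        ← mul_assoc (x (unitVec j)), ← x_mul, ← x_mul, mul_comm (unitVec i)])

/-- The ring isomorphism `R^pol ≅ Γ(T, D_T)`, `ν_i ↦ - x_i ∂_i`, `σ_i^{±1} ↦ x_i^{±1}`. -/
def mellinTorus (n : ℕ) : Rpol n →ₐ[ℂ] TorusOp n :=
  mellinLift TorusOp.x TorusOp.pd TorusOp.x_one TorusOp.x_mul TorusOp.pd_comm TorusOp.pd_x

/-- The ring `R = K ⊗_{ℂ[ν]} R^pol`: the left `K`-vector space with basis `(σ^m)_{m ∈ ℤⁿ}`,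
with multiplication determined by `σ^m a(ν) = a(ν + m) σ^m`. -/
def RRing (n : ℕ) : Type := SkewMonoidAlgebra (ParamField n) (Lattice n)

instance (n : ℕ) : Ring (RRing n) :=
  inferInstanceAs (Ring (SkewMonoidAlgebra (ParamField n) (Lattice n)))

instance (n : ℕ) : Algebra ℂ (RRing n) :=
  inferInstanceAs (Algebra ℂ (SkewMonoidAlgebra (ParamField n) (Lattice n)))

/-- The element `a(ν) σ^m` of `R`. -/
def RRing.single {n : ℕ} (m : Lattice n) (a : ParamField n) : RRing n :=
  SkewMonoidAlgebra.single m a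

theorem RRing.single_mul_single {n : ℕ} (m l : Lattice n) (a b : ParamField n) :
    single m a * single l b = single (m * l) (a * shiftField n m b) :=
  SkewMonoidAlgebra.single_mul_single

theorem RRing.induction_on {n : ℕ} {motive : RRing n → Prop} (r : RRing n) (zero : motive 0)
    (single : ∀ m c, motive (single m c)) (add : ∀ x y, motive x → motive y → motive (x + y)) :
    motive r :=
  SkewMonoidAlgebra.induction_on r zero single add

/-- The algebra homomorphism out of `R` given on `K` and on the elements `σ^m`. -/
def RRing.lift {n : ℕ} {A : Type*} [Ring A] [Algebra ℂ A] (a : ParamField n →ₐ[ℂ] A)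
    (s : Lattice n →* A) (h : ∀ m c, s m * a c = a (shiftField n m c) * s m) : RRing n →ₐ[ℂ] A :=
  SkewMonoidAlgebra.liftNCAlgHom a s fun {c m} => (h m c).symm

theorem RRing.lift_single {n : ℕ} {A : Type*} [Ring A] [Algebra ℂ A] (a : ParamField n →ₐ[ℂ] A)
    (s : Lattice n →* A) (h) (m : Lattice n) (c : ParamField n) :
    lift a s h (single m c) = a c * s m :=
  SkewMonoidAlgebra.liftNC_single _ _ _ _

end Torus

/-! ### Modules over `D ⊗ R` -/

section Modules

variable (n : ℕ) (D : Type*) [Ring D] [Algebra ℂ D]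

/-- Commuting actions of `D` and `R` on a complex vector space, the latter given by `K` and the
operators `σ^m`, define an action of `D ⊗ R`. -/
def tensorAction {n : ℕ} {D : Type*} [Ring D] [Algebra ℂ D] {E : Type*} [Ring E] [Algebra ℂ E]
    (d : D →ₐ[ℂ] E) (a : ParamField n →ₐ[ℂ] E) (s : Lattice n →* E)
    (hsa : ∀ m c, s m * a c = a (shiftField n m c) * s m)
    (hda : ∀ p c, d p * a c = a c * d p) (hds : ∀ p m, d p * s m = s m * d p) :
    D ⊗[ℂ] RRing n →ₐ[ℂ] E :=
  Algebra.TensorProduct.lift d (RRing.lift a s hsa) fun p r => by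
    induction r using RRing.induction_on with
    | zero => rw [map_zero]; exact Commute.zero_right _
    | single m c =>
      rw [RRing.lift_single]
      exact Commute.mul_right (hda p c) (hds p m)
    | add r r' h h' => rw [map_add]; exact h.add_right h'

theorem tensorAction_tmul_single {n : ℕ} {D : Type*} [Ring D] [Algebra ℂ D] {E : Type*} [Ring E]
    [Algebra ℂ E] (d : D →ₐ[ℂ] E) (a : ParamField n →ₐ[ℂ] E) (s : Lattice n →* E)
    (hsa hda hds) (p : D) (m : Lattice n) (c : ParamField n) :
    tensorAction d a s hsa hda hds (p ⊗ₜ RRing.single m c) = d p * (a c * s m) := by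
  rw [tensorAction, Algebra.TensorProduct.lift_tmul, RRing.lift_single]

/-- `D ⊗ R` is spanned by the elements `p ⊗ a σ^m`. -/
theorem tensor_induction {n : ℕ} {D : Type*} [Ring D] [Algebra ℂ D]
    {motive : D ⊗[ℂ] RRing n → Prop} (r : D ⊗[ℂ] RRing n)
    (single : ∀ p m c, motive (p ⊗ₜ RRing.single m c)) (zero : motive 0)
    (add : ∀ x y, motive x → motive y → motive (x + y)) : motive r := by
  induction r with
  | zero => exact zero
  | add x y hx hy => exact add _ _ hx hy
  | tmul p r =>
    induction r using RRing.induction_on with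
    | zero => simpa using zero
    | single m c => exact single p m c
    | add r r' h h' => rw [TensorProduct.tmul_add]; exact add _ _ h h'

section Mellin

variable (N : Type*) [AddCommGroup N] [Module (D ⊗[ℂ] Rpol n) N]

/-- The `ℂ[ν]`-module structure of a `D ⊗ R^pol`-module. -/
abbrev nuModule : Module (ParamRing n) N :=
  Module.compHom N ((Algebra.TensorProduct.includeRight : Rpol n →ₐ[ℂ] D ⊗[ℂ] Rpol n).comp
    (Rpol.nu n)).toRingHom

/-- `K ⊗_{ℂ[ν]} N` for a `D ⊗ R^pol`-module `N`. -/
def MellinLoc : Type _ :=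
  @TensorProduct (ParamRing n) _ (ParamField n) N _ _ _ (nuModule n D N)

namespace MellinLoc

instance : AddCommGroup (MellinLoc n D N) :=
  @TensorProduct.addCommGroup (ParamRing n) _ (ParamField n) N _ _ _ (nuModule n D N)

instance : Module (ParamField n) (MellinLoc n D N) :=
  @TensorProduct.leftModule (ParamRing n) (ParamField n) _ _ (ParamField n) N _ _ _ _
    (nuModule n D N) _

instance : Module ℂ (MellinLoc n D N) := Module.compHom _ (algebraMap ℂ (ParamField n))

instance : IsScalarTower ℂ (ParamField n) (MellinLoc n D N) :=
  .of_algebraMap_smul fun _ _ => rfl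

variable {n N}

/-- The pure tensor `a ⊗ x`. -/
def tmul (a : ParamField n) (x : N) : MellinLoc n D N :=
  letI := nuModule n D N
  a ⊗ₜ[ParamRing n] x

variable {D}

theorem smul_tmul (a b : ParamField n) (x : N) : a • tmul D b x = tmul D (a * b) x := rfl

theorem tmul_add (a : ParamField n) (x y : N) : tmul D a (x + y) = tmul D a x + tmul D a y :=
  letI := nuModule n D N
  TensorProduct.tmul_add a x y

theorem add_tmul (a b : ParamField n) (x : N) : tmul D (a + b) x = tmul D a x + tmul D b x :=
  letI := nuModule n D N
  TensorProduct.add_tmul a b x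

theorem tmul_nu (a : ParamField n) (p : ParamRing n) (x : N) :
    tmul D a ((1 ⊗ₜ Rpol.nu n p : D ⊗[ℂ] Rpol n) • x) =
      tmul D (algebraMap _ (ParamField n) p * a) x := by
  let := nuModule n D N
  rw [← Algebra.smul_def]
  exact (TensorProduct.smul_tmul p a x).symm

theorem induction_on {motive : MellinLoc n D N → Prop} (x : MellinLoc n D N)
    (tmul : ∀ a x, motive (tmul D a x)) (add : ∀ x y, motive x → motive y → motive (x + y)) :
    motive x := by
  let := nuModule n D N
  exact TensorProduct.induction_on x
    (Eq.mp (congrArg motive (TensorProduct.zero_tmul (ParamField n) (0 : N))) (tmul 0 0)) tmul add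

/-- Additive maps out of `K ⊗_{ℂ[ν]} N`. -/
def lift {X : Type*} [AddCommGroup X] (f : ParamField n →+ N →+ X)
    (hf : ∀ (p : ParamRing n) a x, f (algebraMap _ (ParamField n) p * a) x =
      f a ((1 ⊗ₜ Rpol.nu n p : D ⊗[ℂ] Rpol n) • x)) : MellinLoc n D N →+ X :=
  letI := nuModule n D N
  TensorProduct.liftAddHom f fun p a x => by rw [Algebra.smul_def]; exact hf p a x

theorem lift_tmul {X : Type*} [AddCommGroup X] (f : ParamField n →+ N →+ X) (hf)
    (a : ParamField n) (x : N) : lift (D := D) f hf (tmul D a x) = f a x := rfl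

/-- The additive map `a ⊗ x ↦ f a ⊗ g x`. -/
def mapAdd {D' N' : Type*} [Ring D'] [Algebra ℂ D'] [AddCommGroup N']
    [Module (D' ⊗[ℂ] Rpol n) N'] (f : ParamField n →+ ParamField n) (g : N →+ N')
    (h : ∀ (p : ParamRing n) a x, tmul D' (f (algebraMap _ (ParamField n) p * a)) (g x) =
      tmul D' (f a) (g ((1 ⊗ₜ Rpol.nu n p : D ⊗[ℂ] Rpol n) • x))) :
    MellinLoc n D N →+ MellinLoc n D' N' :=
  lift (AddMonoidHom.mk' (fun a => AddMonoidHom.mk' (fun x => tmul D' (f a) (g x))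
    (fun x y => by rw [map_add, tmul_add]))
    (fun a b => by ext x; simp [add_tmul])) h

theorem mapAdd_tmul {D' N' : Type*} [Ring D'] [Algebra ℂ D'] [AddCommGroup N']
    [Module (D' ⊗[ℂ] Rpol n) N'] (f : ParamField n →+ ParamField n) (g : N →+ N') (h)
    (a : ParamField n) (x : N) :
    mapAdd (D := D) (D' := D') f g h (tmul D a x) = tmul D' (f a) (g x) := rfl

theorem complex_smul_tmul (c : ℂ) (a : ParamField n) (x : N) :
    c • tmul D a x = tmul D (c • a) x := by
  rw [← algebraMap_smul (ParamField n) c, smul_tmul, Algebra.smul_def]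

/-- An additive map on pure tensors is `ℂ`-linear if it is so on `K`. -/
def mapLin (f : ParamField n →ₗ[ℂ] ParamField n) (g : N →+ N)
    (h : ∀ (p : ParamRing n) a x, tmul D (f (algebraMap _ (ParamField n) p * a)) (g x) =
      tmul D (f a) (g ((1 ⊗ₜ Rpol.nu n p : D ⊗[ℂ] Rpol n) • x))) :
    Module.End ℂ (MellinLoc n D N) :=
  { toFun := mapAdd f.toAddMonoidHom g h
    map_add' := map_add _
    map_smul' := fun c x => by
      induction x using induction_on with
      | tmul a x =>
        rw [complex_smul_tmul]
        change tmul D (f (c • a)) (g x) = c • tmul D (f a) (g x)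
        rw [complex_smul_tmul, map_smul]
      | add x y hx hy => rw [smul_add, map_add, hx, hy, map_add, smul_add] }

theorem mapLin_tmul (f : ParamField n →ₗ[ℂ] ParamField n) (g : N →+ N) (h)
    (a : ParamField n) (x : N) : mapLin (D := D) f g h (tmul D a x) = tmul D (f a) (g x) := rfl

theorem end_ext {P Q : Module.End ℂ (MellinLoc n D N)}
    (h : ∀ a x, P (tmul D a x) = Q (tmul D a x)) : P = Q := by
  ext x
  induction x using induction_on with
  | tmul a x => exact h a x
  | add x y hx hy => rw [map_add, hx, hy, map_add]

variable (n N D)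

/-- `D` acts on `K ⊗_{ℂ[ν]} N` by `p (a ⊗ x) = a ⊗ p x`. -/
def dAct : D →ₐ[ℂ] Module.End ℂ (MellinLoc n D N) :=
  AlgHom.ofLinearMap
    { toFun := fun p => mapLin LinearMap.id
        (DistribSMul.toAddMonoidHom N (p ⊗ₜ 1 : D ⊗[ℂ] Rpol n))
        (fun q a x => by
          simp only [LinearMap.id_apply, DistribSMul.toAddMonoidHom_apply]
          rw [smul_smul, Algebra.TensorProduct.tmul_mul_tmul, one_mul, mul_one,
            ← tmul_nu, smul_smul, Algebra.TensorProduct.tmul_mul_tmul, one_mul, mul_one])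
      map_add' := fun p q => end_ext fun a x => by
        simp only [mapLin_tmul, LinearMap.add_apply, DistribSMul.toAddMonoidHom_apply]
        rw [TensorProduct.add_tmul, add_smul, tmul_add]
      map_smul' := fun c p => end_ext fun a x => by
        simp only [mapLin_tmul, LinearMap.smul_apply, DistribSMul.toAddMonoidHom_apply,
          RingHom.id_apply, LinearMap.id_apply]
        have h : ((c • p) ⊗ₜ[ℂ] (1 : Rpol n)) =
            (1 ⊗ₜ Rpol.nu n (algebraMap ℂ _ c) : D ⊗[ℂ] Rpol n) * (p ⊗ₜ 1) := by
          rw [Algebra.TensorProduct.tmul_mul_tmul, AlgHom.commutes, one_mul, mul_one,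
            TensorProduct.smul_tmul, Algebra.algebraMap_eq_smul_one]
        rw [h, mul_smul, tmul_nu, complex_smul_tmul, Algebra.smul_def,
          ← IsScalarTower.algebraMap_apply] }
    (end_ext fun a x => by
      change tmul D a ((1 ⊗ₜ 1 : D ⊗[ℂ] Rpol n) • x) = _
      rw [← Algebra.TensorProduct.one_def, one_smul]; rfl)
    (fun p q => end_ext fun a x => by
      change tmul D a _ = tmul D a ((p ⊗ₜ 1 : D ⊗[ℂ] Rpol n) • (q ⊗ₜ 1 : D ⊗[ℂ] Rpol n) • x)
      rw [smul_smul, Algebra.TensorProduct.tmul_mul_tmul, one_mul]; rfl)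

/-- `σ^m` acts on `K ⊗_{ℂ[ν]} N` by `σ^m (a(ν) ⊗ x) = a(ν + m) ⊗ σ^m x`. -/
def sAct : Lattice n →* Module.End ℂ (MellinLoc n D N) where
  toFun m := mapLin (shiftField n m).toLinearMap
    (DistribSMul.toAddMonoidHom N (1 ⊗ₜ (Rpol.sigma n m : Rpol n) : D ⊗[ℂ] Rpol n))
    (fun q a x => by
      simp only [DistribSMul.toAddMonoidHom_apply, AlgEquiv.toLinearMap_apply]
      rw [smul_smul, Algebra.TensorProduct.tmul_mul_tmul, one_mul, Rpol.sigma_mul_nu,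
        ← one_mul (1 : D), ← Algebra.TensorProduct.tmul_mul_tmul, mul_smul, tmul_nu, map_mul,
        shiftField_algebraMap, one_mul])
  map_one' := end_ext fun a x => by
    simp only [mapLin_tmul, DistribSMul.toAddMonoidHom_apply, map_one, Units.val_one]
    rw [← Algebra.TensorProduct.one_def, one_smul]; rfl
  map_mul' m l := end_ext fun a x => by
    simp only [mapLin_tmul, DistribSMul.toAddMonoidHom_apply, map_mul, Units.val_mul,
      Module.End.mul_apply]
    rw [smul_smul, Algebra.TensorProduct.tmul_mul_tmul, one_mul]; rfl

/-- The action of `D ⊗ R` on `K ⊗_{ℂ[ν]} N`. -/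
def action : D ⊗[ℂ] RRing n →ₐ[ℂ] Module.End ℂ (MellinLoc n D N) :=
  tensorAction (dAct n D N) (Algebra.lsmul ℂ ℂ (MellinLoc n D N)) (sAct n D N)
    (fun m c => end_ext fun a x => by
      change tmul D (shiftField n m (c * a)) _ = tmul D (shiftField n m c * shiftField n m a) _
      rw [map_mul])
    (fun p c => end_ext fun a x => rfl)
    (fun p m => end_ext fun a x => by
      change tmul D _ ((p ⊗ₜ 1 : D ⊗[ℂ] Rpol n) • (1 ⊗ₜ _ : D ⊗[ℂ] Rpol n) • x) =
        tmul D _ ((1 ⊗ₜ _ : D ⊗[ℂ] Rpol n) • (p ⊗ₜ 1 : D ⊗[ℂ] Rpol n) • x)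
      rw [smul_smul, smul_smul, Algebra.TensorProduct.tmul_mul_tmul,
        Algebra.TensorProduct.tmul_mul_tmul, one_mul, one_mul, mul_one, mul_one]
      rfl)

instance : Module (D ⊗[ℂ] RRing n) (MellinLoc n D N) :=
  Module.compHom _ (action n D N).toRingHom

variable {n N D}

/-- `(p ⊗ c(ν) σ^m) (a(ν) ⊗ x) = c(ν) a(ν + m) ⊗ (p ⊗ σ^m) x`. -/
theorem single_smul_tmul (p : D) (m : Lattice n) (c a : ParamField n) (x : N) :
    (p ⊗ₜ RRing.single m c : D ⊗[ℂ] RRing n) • tmul D a x =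
      tmul D (c * shiftField n m a) ((p ⊗ₜ (Rpol.sigma n m : Rpol n) : D ⊗[ℂ] Rpol n) • x) := by
  change action n D N _ _ = _
  rw [action, tensorAction_tmul_single]
  change tmul D _ ((p ⊗ₜ 1 : D ⊗[ℂ] Rpol n) • (1 ⊗ₜ _ : D ⊗[ℂ] Rpol n) • x) = _
  rw [smul_smul, Algebra.TensorProduct.tmul_mul_tmul, one_mul, mul_one]
  rfl

end MellinLoc

end Mellin

section DeRham

variable (N : Type*) [AddCommGroup N] [Module (D ⊗[ℂ] TorusOp n) N]

/-- The complex vector space underlying a `D ⊗ Γ(T, D_T)`-module. -/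
abbrev complexModule : Module ℂ N := Module.compHom N (algebraMap ℂ (D ⊗[ℂ] TorusOp n))

/-- `N_K = K ⊗_ℂ N` for a `D ⊗ Γ(T, D_T)`-module `N`. -/
def BaseChange : Type _ :=
  @TensorProduct ℂ _ (ParamField n) N _ _ _ (complexModule n D N)

namespace BaseChange

instance : AddCommGroup (BaseChange n D N) :=
  @TensorProduct.addCommGroup ℂ _ (ParamField n) N _ _ _ (complexModule n D N)

instance : Module (ParamField n) (BaseChange n D N) :=
  @TensorProduct.leftModule ℂ (ParamField n) _ _ (ParamField n) N _ _ _ _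
    (complexModule n D N) _

instance : Module ℂ (BaseChange n D N) := Module.compHom _ (algebraMap ℂ (ParamField n))

instance : IsScalarTower ℂ (ParamField n) (BaseChange n D N) :=
  .of_algebraMap_smul fun _ _ => rfl

variable {n N}

/-- The pure tensor `a ⊗ x`. -/
def tmul (a : ParamField n) (x : N) : BaseChange n D N :=
  letI := complexModule n D N
  a ⊗ₜ[ℂ] x

variable {D}

theorem smul_tmul (a b : ParamField n) (x : N) : a • tmul D b x = tmul D (a * b) x := rfl

theorem tmul_add (a : ParamField n) (x y : N) : tmul D a (x + y) = tmul D a x + tmul D a y :=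
  letI := complexModule n D N
  TensorProduct.tmul_add a x y

theorem add_tmul (a b : ParamField n) (x : N) : tmul D (a + b) x = tmul D a x + tmul D b x :=
  letI := complexModule n D N
  TensorProduct.add_tmul a b x

theorem complex_smul_tmul (c : ℂ) (a : ParamField n) (x : N) :
    c • tmul D a x = tmul D (c • a) x := by
  rw [← algebraMap_smul (ParamField n) c, smul_tmul, Algebra.smul_def]

theorem tmul_algebraMap (c : ℂ) (a : ParamField n) (x : N) :
    tmul D a (algebraMap ℂ (D ⊗[ℂ] TorusOp n) c • x) = tmul D (c • a) x := by
  let := complexModule n D N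
  exact (TensorProduct.smul_tmul c a x).symm

theorem induction_on {motive : BaseChange n D N → Prop} (x : BaseChange n D N)
    (tmul : ∀ a x, motive (tmul D a x)) (add : ∀ x y, motive x → motive y → motive (x + y)) :
    motive x := by
  let := complexModule n D N
  exact TensorProduct.induction_on x
    (Eq.mp (congrArg motive (TensorProduct.zero_tmul (ParamField n) (0 : N))) (tmul 0 0)) tmul add

/-- Additive maps out of `K ⊗_ℂ N`. -/
def lift {X : Type*} [AddCommGroup X] (f : ParamField n →+ N →+ X)
    (hf : ∀ (c : ℂ) a x, f (c • a) x = f a (algebraMap ℂ (D ⊗[ℂ] TorusOp n) c • x)) :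
    BaseChange n D N →+ X :=
  letI := complexModule n D N
  TensorProduct.liftAddHom f hf

theorem lift_tmul {X : Type*} [AddCommGroup X] (f : ParamField n →+ N →+ X) (hf)
    (a : ParamField n) (x : N) : lift (D := D) f hf (tmul D a x) = f a x := rfl

/-- The additive map `a ⊗ x ↦ f a ⊗ g x`. -/
def mapAdd {D' N' : Type*} [Ring D'] [Algebra ℂ D'] [AddCommGroup N']
    [Module (D' ⊗[ℂ] TorusOp n) N'] (f : ParamField n →ₗ[ℂ] ParamField n) (g : N →+ N')
    (h : ∀ (c : ℂ) x, g (algebraMap ℂ (D ⊗[ℂ] TorusOp n) c • x) =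
      algebraMap ℂ (D' ⊗[ℂ] TorusOp n) c • g x) :
    BaseChange n D N →+ BaseChange n D' N' :=
  lift (AddMonoidHom.mk' (fun a => AddMonoidHom.mk' (fun x => tmul D' (f a) (g x))
    (fun x y => by rw [map_add, tmul_add]))
    (fun a b => by ext x; simp [add_tmul]))
    (fun c a x => by
      change tmul D' (f (c • a)) (g x) = tmul D' (f a) (g _)
      rw [h, tmul_algebraMap, map_smul])

theorem mapAdd_tmul {D' N' : Type*} [Ring D'] [Algebra ℂ D'] [AddCommGroup N']
    [Module (D' ⊗[ℂ] TorusOp n) N'] (f : ParamField n →ₗ[ℂ] ParamField n) (g : N →+ N') (h)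
    (a : ParamField n) (x : N) :
    mapAdd (D := D) (D' := D') f g h (tmul D a x) = tmul D' (f a) (g x) := rfl

theorem end_ext {P Q : Module.End ℂ (BaseChange n D N)}
    (h : ∀ a x, P (tmul D a x) = Q (tmul D a x)) : P = Q := by
  ext x
  induction x using induction_on with
  | tmul a x => exact h a x
  | add x y hx hy => rw [map_add, hx, hy, map_add]

/-- The operator `a(ν) ⊗ x ↦ a(ν + m) ⊗ P x` on `K ⊗_ℂ N`, for `P ∈ D ⊗ Γ(T, D_T)`. -/
def opr (m : Lattice n) (P : D ⊗[ℂ] TorusOp n) : Module.End ℂ (BaseChange n D N) :=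
  { toFun := mapAdd (shiftField n m).toLinearMap (DistribSMul.toAddMonoidHom N P)
      (fun c x => by
        simp only [DistribSMul.toAddMonoidHom_apply]
        rw [smul_smul, smul_smul, Algebra.commutes])
    map_add' := map_add _
    map_smul' := fun c x => by
      induction x using induction_on with
      | tmul a x =>
        rw [complex_smul_tmul]
        change tmul D (shiftField n m (c • a)) (P • x) = c • tmul D (shiftField n m a) (P • x)
        rw [complex_smul_tmul]
        congr 1
        exact (shiftField n m).toLinearMap.map_smul c a
      | add x y hx hy => rw [smul_add, map_add, hx, hy, map_add, smul_add] }

theorem opr_tmul (m : Lattice n) (P : D ⊗[ℂ] TorusOp n) (a : ParamField n) (x : N) :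
    opr m P (tmul D a x) = tmul D (shiftField n m a) (P • x) := rfl

theorem opr_mul (m l : Lattice n) (P Q : D ⊗[ℂ] TorusOp n) :
    (opr (m * l) (P * Q) : Module.End ℂ (BaseChange n D N)) = opr m P * opr l Q :=
  end_ext fun a x => by
    simp only [Module.End.mul_apply, opr_tmul]
    rw [map_mul, mul_smul]; rfl

theorem opr_one : (opr (1 : Lattice n) (1 : D ⊗[ℂ] TorusOp n) : Module.End ℂ (BaseChange n D N)) = 1 :=
  end_ext fun a x => by rw [opr_tmul, map_one, one_smul]; rfl

variable (n N D)

/-- `D` acts on `K ⊗_ℂ N` by `p (a ⊗ x) = a ⊗ p x`. -/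
def dAct : D →ₐ[ℂ] Module.End ℂ (BaseChange n D N) :=
  AlgHom.ofLinearMap
    { toFun := fun p => opr 1 (p ⊗ₜ 1)
      map_add' := fun p q => end_ext fun a x => by
        simp only [opr_tmul, LinearMap.add_apply]
        rw [TensorProduct.add_tmul, add_smul, tmul_add]
      map_smul' := fun c p => end_ext fun a x => by
        simp only [opr_tmul, LinearMap.smul_apply, RingHom.id_apply]
        have h : ((c • p) ⊗ₜ[ℂ] (1 : TorusOp n)) =
            algebraMap ℂ (D ⊗[ℂ] TorusOp n) c * (p ⊗ₜ 1) := by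
          rw [Algebra.TensorProduct.algebraMap_apply, Algebra.TensorProduct.tmul_mul_tmul, one_mul,
            Algebra.smul_def]
        rw [h, mul_smul, tmul_algebraMap, complex_smul_tmul] }
    opr_one
    (fun p q => by
      change opr 1 _ = opr 1 _ * opr 1 _
      rw [← opr_mul, Algebra.TensorProduct.tmul_mul_tmul, one_mul, one_mul])

/-- `σ_i` acts on `K ⊗_ℂ N` by `ξ(ν) ↦ x_i ξ(ν + e_i)`. -/
def sAct : Lattice n →* Module.End ℂ (BaseChange n D N) where
  toFun m := opr m (1 ⊗ₜ TorusOp.x m)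
  map_one' := by rw [TorusOp.x_one, ← Algebra.TensorProduct.one_def, opr_one]
  map_mul' m l := by
    rw [← opr_mul, Algebra.TensorProduct.tmul_mul_tmul, one_mul, TorusOp.x_mul]

/-- The action of `D ⊗ R` on `K ⊗_ℂ N`. -/
def action : D ⊗[ℂ] RRing n →ₐ[ℂ] Module.End ℂ (BaseChange n D N) :=
  tensorAction (dAct n D N) (Algebra.lsmul ℂ ℂ (BaseChange n D N)) (sAct n D N)
    (fun m c => end_ext fun a x => by
      change tmul D (shiftField n m (c * a)) _ = tmul D (shiftField n m c * shiftField n m a) _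
      rw [map_mul])
    (fun p c => end_ext fun a x => by
      change tmul D (shiftField n 1 (c * a)) _ = tmul D (c * shiftField n 1 a) _
      rw [map_one]; rfl)
    (fun p m => by
      change opr 1 (p ⊗ₜ 1) * opr m (1 ⊗ₜ _) = opr m (1 ⊗ₜ _) * opr 1 (p ⊗ₜ 1)
      rw [← opr_mul, ← opr_mul, Algebra.TensorProduct.tmul_mul_tmul,
        Algebra.TensorProduct.tmul_mul_tmul, one_mul, one_mul, mul_one, mul_one, mul_one, one_mul])

instance : Module (D ⊗[ℂ] RRing n) (BaseChange n D N) :=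
  Module.compHom _ (action n D N).toRingHom

variable {n N D}

/-- `(p ⊗ c(ν) σ^m) (a(ν) ⊗ x) = c(ν) a(ν + m) ⊗ (p ⊗ x^m) x`. -/
theorem single_smul_tmul (p : D) (m : Lattice n) (c a : ParamField n) (x : N) :
    (p ⊗ₜ RRing.single m c : D ⊗[ℂ] RRing n) • tmul D a x =
      tmul D (c * shiftField n m a) ((p ⊗ₜ TorusOp.x m : D ⊗[ℂ] TorusOp n) • x) := by
  change action n D N _ _ = _
  rw [action, tensorAction_tmul_single]
  change tmul D (shiftField n 1 (c * shiftField n m a)) ((p ⊗ₜ 1 : D ⊗[ℂ] TorusOp n) •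
    (1 ⊗ₜ _ : D ⊗[ℂ] TorusOp n) • x) = _
  rw [smul_smul, Algebra.TensorProduct.tmul_mul_tmul, one_mul, mul_one, map_one]
  rfl

/-- The coefficient operator `∇_j = ∂/∂x_j + ν_j x_j⁻¹` on `K ⊗_ℂ N`. -/
def nabla (j : Fin n) : Module.End ℂ (BaseChange n D N) :=
  opr 1 (1 ⊗ₜ TorusOp.pd j) +
    Algebra.lsmul ℂ ℂ (BaseChange n D N) (algebraMap (ParamRing n) (ParamField n) (MvPolynomial.X j)) *
      opr 1 (1 ⊗ₜ TorusOp.x (unitVec j)⁻¹)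

theorem nabla_tmul (j : Fin n) (a : ParamField n) (x : N) :
    nabla j (tmul D a x) = tmul D a ((1 ⊗ₜ TorusOp.pd j : D ⊗[ℂ] TorusOp n) • x) +
      tmul D (algebraMap (ParamRing n) (ParamField n) (MvPolynomial.X j) * a)
        ((1 ⊗ₜ TorusOp.x (unitVec j)⁻¹ : D ⊗[ℂ] TorusOp n) • x) := by
  change tmul D (shiftField n 1 a) _ + tmul D (_ * shiftField n 1 a) _ = _
  rw [map_one]; rfl

end BaseChange

end DeRham

end Modules

/-! ### The twisted differential on Koszul cochains -/

section Cochain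

variable {n : ℕ} {X : Type*} [AddCommGroup X]

/-- The sign of `j` in `J`: `dx_j ∧ dx_{J \ j} = sgn J j • dx_J`. -/
def wedgeSign (J : Finset (Fin n)) (j : Fin n) : ℤ := (-1) ^ (J.filter (· < j)).card

theorem wedgeSign_erase (J : Finset (Fin n)) {i j : Fin n} (hi : i ∈ J) (h : i < j) :
    wedgeSign J j * wedgeSign (J.erase j) i = - (wedgeSign J i * wedgeSign (J.erase i) j) := by
  have h₁ : (J.erase j).filter (· < i) = J.filter (· < i) := by
    ext a; simp only [Finset.mem_filter, Finset.mem_erase]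
    constructor
    · rintro ⟨⟨_, h1⟩, h2⟩; exact ⟨h1, h2⟩
    · rintro ⟨h1, h2⟩; exact ⟨⟨(h2.trans h).ne, h1⟩, h2⟩
  have h₂ : (J.filter (· < j)).card = ((J.erase i).filter (· < j)).card + 1 := by
    have : (J.erase i).filter (· < j) = (J.filter (· < j)).erase i := by
      ext a; simp only [Finset.mem_filter, Finset.mem_erase]; tauto
    rw [this, Finset.card_erase_add_one]
    simp [hi, h]
  simp only [wedgeSign, h₁, h₂]
  ring

/-- The families of coefficients of `k`-forms `∑_{|I| = k} φ_I dx_I`. -/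
abbrev Forms (n k : ℕ) (X : Type*) : Type _ := {I : Finset (Fin n) // I.card = k} → X

/-- The twisted differential `∑_I φ_I dx_I ↦ ∑_I ∑_j ∇_j(φ_I) dx_j ∧ dx_I`. -/
def twistedD (D : Fin n → X →+ X) (k : ℕ) : Forms n k X →+ Forms n (k + 1) X where
  toFun φ J := ∑ j : J.1, wedgeSign J.1 j • D j (φ ⟨J.1.erase j, by
    rw [Finset.card_erase_of_mem j.2, J.2]; rfl⟩)
  map_zero' := by ext J; simp
  map_add' φ ψ := by ext J; simp [Finset.sum_add_distrib]

theorem twistedD_twistedD (D : Fin n → X →+ X) (hD : ∀ i j x, D i (D j x) = D j (D i x)) (k : ℕ)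
    (φ : Forms n k X) : twistedD D (k + 1) (twistedD D k φ) = 0 := by
  let e : Finset (Fin n) → X := fun I => if h : I.card = k then φ ⟨I, h⟩ else 0
  have he : ∀ J, (twistedD D (k + 1) (twistedD D k φ)) J = ∑ j ∈ J.1, ∑ i ∈ J.1.erase j,
      (wedgeSign J.1 j * wedgeSign (J.1.erase j) i) • D j (D i (e ((J.1.erase j).erase i))) := by
    intro J
    rw [← Finset.sum_coe_sort]
    refine Finset.sum_congr rfl fun j _ => ?_
    rw [← Finset.sum_coe_sort]
    change wedgeSign J.1 j • D j (∑ i : (J.1.erase j : Finset (Fin n)), _) = _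
    rw [map_sum, Finset.smul_sum]
    refine Finset.sum_congr rfl fun i _ => ?_
    rw [map_zsmul, mul_smul]
    congr 4
    have : ((J.1.erase (j : Fin n)).erase (i : Fin n)).card = k := by
      rw [Finset.card_erase_of_mem i.2, Finset.card_erase_of_mem j.2, J.2]; rfl
    simp [e, this]
  ext J
  rw [he, Finset.sum_sigma']
  refine Finset.sum_involution (fun p _ => ⟨p.2, p.1⟩) ?_ ?_ ?_ ?_
  · rintro ⟨j, i⟩ hp
    simp only [Finset.mem_sigma, Finset.mem_erase] at hp
    obtain ⟨hj, hij, hi⟩ := hp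
    simp only
    rw [hD i j, Finset.erase_right_comm (a := i), ← add_smul]
    rcases lt_or_gt_of_ne hij with h | h
    · rw [wedgeSign_erase J.1 hi h, neg_add_cancel, zero_smul]
    · rw [wedgeSign_erase J.1 hj h, add_neg_cancel, zero_smul]
  · rintro ⟨j, i⟩ hp _ h
    simp only [Finset.mem_sigma, Finset.mem_erase] at hp
    simp only [Sigma.mk.injEq] at h
    exact hp.2.1 h.1
  · rintro ⟨j, i⟩ hp
    simp only [Finset.mem_sigma, Finset.mem_erase] at hp ⊢
    exact ⟨hp.2.2, fun h => hp.2.1 h.symm, hp.1⟩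
  · rintro ⟨j, i⟩ _; rfl

theorem twistedD_map {X' : Type*} [AddCommGroup X'] (D : Fin n → X →+ X) (D' : Fin n → X' →+ X')
    (g : X →+ X') (h : ∀ j x, g (D j x) = D' j (g x)) (k : ℕ) (φ : Forms n k X)
    (J : {I : Finset (Fin n) // I.card = k + 1}) :
    g (twistedD D k φ J) = twistedD D' k (fun I => g (φ I)) J := by
  change g (∑ j : J.1, _) = ∑ j : J.1, _
  rw [map_sum]
  refine Finset.sum_congr rfl fun j _ => ?_
  rw [map_zsmul, h]

end Cochain

section Functoriality

variable {n : ℕ} {D : Type*} [Ring D] [Algebra ℂ D] {D' : Type*} [Ring D'] [Algebra ℂ D']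

/-- The map `D ⊗ R → D' ⊗ R` induced by `D → D'`. -/
abbrev baseMap (R : Type*) [Ring R] [Algebra ℂ R] (f : D →ₐ[ℂ] D') : D ⊗[ℂ] R →ₐ[ℂ] D' ⊗[ℂ] R :=
  Algebra.TensorProduct.map f (AlgHom.id ℂ R)

namespace MellinLoc

variable {N : Type*} [AddCommGroup N] [Module (D ⊗[ℂ] Rpol n) N] {N' : Type*} [AddCommGroup N']
  [Module (D' ⊗[ℂ] Rpol n) N']

/-- The map `K ⊗ N → K ⊗ N'` induced by a semilinear map `N → N'`. -/
def map (f : D →ₐ[ℂ] D') (g : N →+ N') (h : ∀ r x, g (r • x) = baseMap (Rpol n) f r • g x) :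
    MellinLoc n D N →+ MellinLoc n D' N' :=
  mapAdd (AddMonoidHom.id _) g fun p a x => by
    simp only [AddMonoidHom.id_apply]
    rw [h, ← tmul_nu, Algebra.TensorProduct.map_tmul, map_one]; rfl

theorem map_tmul (f : D →ₐ[ℂ] D') (g : N →+ N') (h) (a : ParamField n) (x : N) :
    map f g h (tmul D a x) = tmul D' a (g x) := rfl

theorem map_smul (f : D →ₐ[ℂ] D') (g : N →+ N') (h) (r : D ⊗[ℂ] RRing n) (x : MellinLoc n D N) :
    map f g h (r • x) = baseMap (RRing n) f r • map f g h x := by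
  induction r using tensor_induction with
  | zero => rw [map_zero, zero_smul, zero_smul, map_zero]
  | add r s hr hs => rw [map_add, add_smul, map_add, hr, hs, add_smul]
  | single p m c =>
    induction x using induction_on with
    | add x y hx hy => rw [map_add, smul_add, map_add, hx, hy, smul_add]
    | tmul a x =>
      rw [single_smul_tmul, map_tmul, map_tmul, h, Algebra.TensorProduct.map_tmul,
        Algebra.TensorProduct.map_tmul]
      exact (single_smul_tmul _ _ _ _ _).symm

theorem map_id' (f : D →ₐ[ℂ] D) (g : N →+ N) (h) (hg : ∀ x, g x = x) (x : MellinLoc n D N) :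
    map f g h x = x := by
  induction x using induction_on with
  | add x y hx hy => rw [map_add, hx, hy]
  | tmul a x => rw [map_tmul, hg]

theorem map_comp' {D'' : Type*} [Ring D''] [Algebra ℂ D''] {N'' : Type*} [AddCommGroup N'']
    [Module (D'' ⊗[ℂ] Rpol n) N''] (f : D →ₐ[ℂ] D') (g : N →+ N') (h) (f' : D' →ₐ[ℂ] D'')
    (g' : N' →+ N'') (h') (f'' : D →ₐ[ℂ] D'') (g'' : N →+ N'') (h'')
    (hg : ∀ x, g'' x = g' (g x)) (x : MellinLoc n D N) :
    map f'' g'' h'' x = map f' g' h' (map f g h x) := by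
  induction x using induction_on with
  | add x y hx hy => rw [map_add, hx, hy, map_add, map_add]
  | tmul a x => rw [map_tmul, map_tmul, map_tmul, hg]

end MellinLoc

namespace BaseChange

variable {N : Type*} [AddCommGroup N] [Module (D ⊗[ℂ] TorusOp n) N] {N' : Type*} [AddCommGroup N']
  [Module (D' ⊗[ℂ] TorusOp n) N']

/-- The map `K ⊗ N → K ⊗ N'` induced by a semilinear map `N → N'`. -/
def map (f : D →ₐ[ℂ] D') (g : N →+ N') (h : ∀ r x, g (r • x) = baseMap (TorusOp n) f r • g x) :
    BaseChange n D N →+ BaseChange n D' N' :=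
  mapAdd LinearMap.id g fun c x => by rw [h, AlgHom.commutes]

theorem map_tmul (f : D →ₐ[ℂ] D') (g : N →+ N') (h) (a : ParamField n) (x : N) :
    map f g h (tmul D a x) = tmul D' a (g x) := rfl

theorem map_smul (f : D →ₐ[ℂ] D') (g : N →+ N') (h) (r : D ⊗[ℂ] RRing n) (x : BaseChange n D N) :
    map f g h (r • x) = baseMap (RRing n) f r • map f g h x := by
  induction r using tensor_induction with
  | zero => rw [map_zero, zero_smul, zero_smul, map_zero]
  | add r s hr hs => rw [map_add, add_smul, map_add, hr, hs, add_smul]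
  | single p m c =>
    induction x using induction_on with
    | add x y hx hy => rw [map_add, smul_add, map_add, hx, hy, smul_add]
    | tmul a x =>
      rw [single_smul_tmul, map_tmul, map_tmul, h, Algebra.TensorProduct.map_tmul,
        Algebra.TensorProduct.map_tmul]
      exact (single_smul_tmul _ _ _ _ _).symm

theorem map_id' (f : D →ₐ[ℂ] D) (g : N →+ N) (h) (hg : ∀ x, g x = x) (x : BaseChange n D N) :
    map f g h x = x := by
  induction x using induction_on with
  | add x y hx hy => rw [map_add, hx, hy]
  | tmul a x => rw [map_tmul, hg]

theorem map_comp' {D'' : Type*} [Ring D''] [Algebra ℂ D''] {N'' : Type*} [AddCommGroup N'']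
    [Module (D'' ⊗[ℂ] TorusOp n) N''] (f : D →ₐ[ℂ] D') (g : N →+ N') (h) (f' : D' →ₐ[ℂ] D'')
    (g' : N' →+ N'') (h') (f'' : D →ₐ[ℂ] D'') (g'' : N →+ N'') (h'')
    (hg : ∀ x, g'' x = g' (g x)) (x : BaseChange n D N) :
    map f'' g'' h'' x = map f' g' h' (map f g h x) := by
  induction x using induction_on with
  | add x y hx hy => rw [map_add, hx, hy, map_add, map_add]
  | tmul a x => rw [map_tmul, map_tmul, map_tmul, hg]

theorem map_nabla (f : D →ₐ[ℂ] D') (g : N →+ N') (h) (j : Fin n) (x : BaseChange n D N) :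
    map f g h (nabla j x) = nabla j (map f g h x) := by
  induction x using induction_on with
  | add x y hx hy => rw [map_add, map_add, hx, hy, map_add, map_add]
  | tmul a x =>
    rw [nabla_tmul, map_add, map_tmul, map_tmul, map_tmul, nabla_tmul, h, h,
      Algebra.TensorProduct.map_tmul, Algebra.TensorProduct.map_tmul, map_one]
    rfl

theorem nabla_comm (i j : Fin n) (x : BaseChange n D N) :
    nabla i (nabla j x) = nabla j (nabla i x) := by
  by_cases hij : i = j
  · subst hij; rfl
  have key : ∀ i j : Fin n, i ≠ j → TorusOp.pd i * TorusOp.x (unitVec j)⁻¹ =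
      TorusOp.x (unitVec j)⁻¹ * TorusOp.pd i := fun i j hij => by
    have := TorusOp.pd_x i (unitVec j)⁻¹
    rw [Pi.inv_apply, toAdd_inv, unitVec_apply, if_neg (Ne.symm hij)] at this
    refine this.trans ?_
    rw [neg_zero, Int.cast_zero]
    exact (congrArg _ (zero_smul ℂ _)).trans (add_zero _)
  induction x using induction_on with
  | add x y hx hy => rw [map_add, map_add, hx, hy, map_add, map_add]
  | tmul a x =>
    simp only [nabla_tmul, map_add, smul_smul, Algebra.TensorProduct.tmul_mul_tmul, one_mul]
    rw [TorusOp.pd_comm i j, key i j hij, key j i (Ne.symm hij), ← TorusOp.x_mul, ← TorusOp.x_mul,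
      mul_comm (unitVec i)⁻¹, ← mul_assoc, ← mul_assoc,
      mul_comm (algebraMap (ParamRing n) (ParamField n) (MvPolynomial.X i))
        (algebraMap (ParamRing n) (ParamField n) (MvPolynomial.X j))]
    rw [add_add_add_comm]

theorem nabla_smul (j : Fin n) (r : D ⊗[ℂ] RRing n) (x : BaseChange n D N) :
    nabla j (r • x) = r • nabla j x := by
  induction r using tensor_induction with
  | zero => rw [zero_smul, zero_smul, map_zero]
  | add r s hr hs => rw [add_smul, map_add, hr, hs, add_smul]
  | single p m c =>
    induction x using induction_on with
    | add x y hx hy => rw [map_add, smul_add, map_add, hx, hy, smul_add]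
    | tmul a x =>
      rw [single_smul_tmul, nabla_tmul, nabla_tmul, smul_add, single_smul_tmul, single_smul_tmul,
        smul_smul, smul_smul, smul_smul, smul_smul]
      simp only [Algebra.TensorProduct.tmul_mul_tmul, one_mul, mul_one]
      rw [TorusOp.pd_x, ← TorusOp.x_mul, ← TorusOp.x_mul, TensorProduct.tmul_add, add_smul,
        tmul_add, mul_comm (unitVec j)⁻¹ m, add_assoc]
      refine congrArg (HAdd.hAdd _) ?_
      have h : (p ⊗ₜ (((m j).toAdd : ℂ) • TorusOp.x (m * (unitVec j)⁻¹)) : D ⊗[ℂ] TorusOp n) =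
          algebraMap ℂ (D ⊗[ℂ] TorusOp n) ((m j).toAdd : ℂ) *
            (p ⊗ₜ TorusOp.x (m * (unitVec j)⁻¹)) := by
        rw [Algebra.TensorProduct.algebraMap_apply, Algebra.TensorProduct.tmul_mul_tmul, one_mul,
          ← Algebra.smul_def, TensorProduct.smul_tmul]
      rw [h, mul_smul, tmul_algebraMap, ← add_tmul]
      refine congrArg (tmul D · _) ?_
      rw [map_mul, shiftField_algebraMap, shiftPoly_X, map_add, ← MvPolynomial.algebraMap_eq,
        ← IsScalarTower.algebraMap_apply, Algebra.smul_def]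
      ring

end BaseChange

end Functoriality

/-! ### The sheaf of differential operators of a complex scheme -/

/-- The scheme `Spec ℂ`. -/
abbrev SpecC : Scheme.{0} := Spec (CommRingCat.of ℂ)

theorem le_preimage_top {X S : Scheme.{0}} (f : X ⟶ S) (U : X.Opens) : U ≤ f ⁻¹ᵁ ⊤ := le_top

section DSheaf

variable (Y : Scheme.{0}) [Y.Over SpecC]

/-- The map `ℂ → Γ(Y, U)` given by the structure morphism of `Y`. -/
def scalarHom (U : Y.Opens) : CommRingCat.of ℂ ⟶ Γ(Y, U) :=
  (Scheme.ΓSpecIso (CommRingCat.of ℂ)).inv ≫ (Y ↘ SpecC).appLE ⊤ U (le_preimage_top _ U)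

theorem scalarHom_map {U V : Y.Opens} (i : V ⟶ U) :
    scalarHom Y U ≫ Y.presheaf.map i.op = scalarHom Y V := by
  rw [scalarHom, Category.assoc, Scheme.Hom.appLE_map]
  rfl

instance sectionAlgebra (U : Y.Opens) : Algebra ℂ Γ(Y, U) := (scalarHom Y U).hom.toAlgebra

instance stalkAlgebra (y : Y) : Algebra ℂ (Y.presheaf.stalk y) :=
  (scalarHom Y ⊤ ≫ Y.presheaf.germ ⊤ y trivial).hom.toAlgebra

variable {Y}

/-- Restriction of functions, as a homomorphism of `ℂ`-algebras. -/
def resHom {U V : Y.Opens} (h : V ≤ U) : Γ(Y, U) →ₐ[ℂ] Γ(Y, V) :=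
  { (Y.presheaf.map (homOfLE h).op).hom with
    commutes' := fun c => congrArg (fun f => f.hom c) (scalarHom_map Y (homOfLE h)) }

/-- The germ of a function at a point, as a homomorphism of `ℂ`-algebras. -/
def germHom {U : Y.Opens} {y : Y} (hy : y ∈ U) : Γ(Y, U) →ₐ[ℂ] Y.presheaf.stalk y :=
  { (Y.presheaf.germ U y hy).hom with
    commutes' := fun c => by
      change (scalarHom Y U ≫ Y.presheaf.germ U y hy).hom c =
        (scalarHom Y ⊤ ≫ Y.presheaf.germ ⊤ y trivial).hom c
      rw [← scalarHom_map Y (homOfLE le_top), Category.assoc, Y.presheaf.germ_res] }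

theorem germHom_resHom {U V : Y.Opens} (h : V ≤ U) {y : Y} (hy : y ∈ V) (f : Γ(Y, U)) :
    germHom hy (resHom h f) = germHom (h hy) f :=
  Y.presheaf.germ_res_apply (homOfLE h) y hy f

/-- The germ at `y` of the differential operator `P` on `V` is `Q`. -/
def IsGermOf {V : Y.Opens} (P : diffOp ℂ Γ(Y, V)) {y : Y} (hy : y ∈ V)
    (Q : diffOp ℂ (Y.presheaf.stalk y)) : Prop :=
  ∀ f : Γ(Y, V), Q.1 (germHom hy f) = germHom hy (P.1 f)

theorem isGermOf_unique {V : Y.Opens} (hV : IsAffineOpen V) {P : diffOp ℂ Γ(Y, V)} {y : Y}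
    {hy : y ∈ V} {Q Q' : diffOp ℂ (Y.presheaf.stalk y)} (h : IsGermOf P hy Q)
    (h' : IsGermOf P hy Q') : Q = Q' := by
  let := (germHom hy).toRingHom.toAlgebra
  have := hV.isLocalization_stalk ⟨y, hy⟩
  have : IsLocalization.AtPrime (Y.presheaf.stalk y) (hV.primeIdealOf ⟨y, hy⟩).asIdeal := this
  exact diffOp.localization_ext (hV.primeIdealOf ⟨y, hy⟩).asIdeal.primeCompl
    fun a => (h a).trans (h' a).symm

theorem exists_isGermOf {V : Y.Opens} (hV : IsAffineOpen V) (P : diffOp ℂ Γ(Y, V)) {y : Y}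
    (hy : y ∈ V) : ∃ Q, IsGermOf P hy Q := by
  let := (germHom hy).toRingHom.toAlgebra
  have := hV.isLocalization_stalk ⟨y, hy⟩
  have : IsLocalization.AtPrime (Y.presheaf.stalk y) (hV.primeIdealOf ⟨y, hy⟩).asIdeal := this
  have : IsScalarTower ℂ Γ(Y, V) (Y.presheaf.stalk y) :=
    .of_algebraMap_eq fun c => ((germHom hy).commutes c).symm
  exact ⟨diffOp.localize (hV.primeIdealOf ⟨y, hy⟩).asIdeal.primeCompl P,
    fun a => diffOp.localize_apply _ P a⟩

/-- A differential operator on an affine open set restricts to basic open sets. -/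
theorem exists_restrict {V : Y.Opens} (hV : IsAffineOpen V) (P : diffOp ℂ Γ(Y, V)) {V' : Y.Opens}
    (f : Γ(Y, V)) (hf : V' = Y.basicOpen f) (hV' : V' ≤ V) :
    ∃ P' : diffOp ℂ Γ(Y, V'), ∀ y' (hy' : y' ∈ V') Q, IsGermOf P (hV' hy') Q →
      IsGermOf P' hy' Q := by
  subst hf
  let := (resHom hV').toRingHom.toAlgebra
  have := hV.isLocalization_basicOpen f
  have : IsLocalization.Away f Γ(Y, Y.basicOpen f) := this
  have : IsScalarTower ℂ Γ(Y, V) Γ(Y, Y.basicOpen f) :=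
    .of_algebraMap_eq fun c => ((resHom hV').commutes c).symm
  have hP : ∀ a, (diffOp.localize (B := Γ(Y, Y.basicOpen f)) (Submonoid.powers f) P).1
      (resHom hV' a) = resHom hV' (P.1 a) :=
    fun a => diffOp.localize_apply (B := Γ(Y, Y.basicOpen f)) (Submonoid.powers f) P a
  refine ⟨diffOp.localize (Submonoid.powers f) P, fun y' hy' Q hQ => ?_⟩
  obtain ⟨Q', hQ'⟩ := exists_isGermOf (hV.basicOpen f)
    (diffOp.localize (Submonoid.powers f) P) hy'
  have : IsGermOf P (hV' hy') Q' := fun a => by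
    rw [← germHom_resHom hV' hy', hQ', hP, germHom_resHom]
  rwa [isGermOf_unique hV hQ this]

theorem IsGermOf.add {V : Y.Opens} {P P' : diffOp ℂ Γ(Y, V)} {y : Y} {hy : y ∈ V}
    {Q Q' : diffOp ℂ (Y.presheaf.stalk y)} (h : IsGermOf P hy Q) (h' : IsGermOf P' hy Q') :
    IsGermOf (P + P') hy (Q + Q') := fun f => by
  change Q.1 _ + Q'.1 _ = germHom hy (P.1 f + P'.1 f)
  rw [h, h', map_add]

theorem IsGermOf.mul {V : Y.Opens} {P P' : diffOp ℂ Γ(Y, V)} {y : Y} {hy : y ∈ V}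
    {Q Q' : diffOp ℂ (Y.presheaf.stalk y)} (h : IsGermOf P hy Q) (h' : IsGermOf P' hy Q') :
    IsGermOf (P * P') hy (Q * Q') := fun f => by
  change Q.1 (Q'.1 _) = germHom hy (P.1 (P'.1 f))
  rw [h', h]

theorem isGermOf_algebraMap {V : Y.Opens} (c : ℂ) {y : Y} (hy : y ∈ V) :
    IsGermOf (algebraMap ℂ (diffOp ℂ Γ(Y, V)) c) hy (algebraMap ℂ _ c) := fun f => by
  exact (map_smul (germHom hy) c f).symm

variable (Y) in
/-- The algebra of differential operators of the local ring `O_{Y,y}`. -/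
def StalkOp (y : Y) : Type := diffOp ℂ (Y.presheaf.stalk y)

instance (y : Y) : Ring (StalkOp Y y) := inferInstanceAs (Ring (diffOp ℂ (Y.presheaf.stalk y)))

instance (y : Y) : Algebra ℂ (StalkOp Y y) :=
  inferInstanceAs (Algebra ℂ (diffOp ℂ (Y.presheaf.stalk y)))

/-- A family of differential operators on the stalks is induced by differential operators on
affine open sets. -/
def IsLocallyOp (U : Y.Opens) (s : ∀ y : U, StalkOp Y y.1) : Prop :=
  ∀ y : U, ∃ V : Y.Opens, IsAffineOpen V ∧ y.1 ∈ V ∧ ∃ hV : V ≤ U, ∃ P : diffOp ℂ Γ(Y, V),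
    ∀ y' (hy' : y' ∈ V), IsGermOf P hy' (s ⟨y', hV hy'⟩)

theorem IsLocallyOp.exists₂ {U : Y.Opens} {s t : ∀ y : U, StalkOp Y y.1}
    (hs : IsLocallyOp U s) (ht : IsLocallyOp U t) (y : U) :
    ∃ V : Y.Opens, IsAffineOpen V ∧ y.1 ∈ V ∧ ∃ hV : V ≤ U, ∃ P P' : diffOp ℂ Γ(Y, V),
      ∀ y' (hy' : y' ∈ V), IsGermOf P hy' (s ⟨y', hV hy'⟩) ∧ IsGermOf P' hy' (t ⟨y', hV hy'⟩) := by
  obtain ⟨V, hV, hyV, hVU, P, hP⟩ := hs y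
  obtain ⟨W, hW, hyW, hWU, P', hP'⟩ := ht y
  obtain ⟨f, g, hfg, hyf⟩ := exists_basicOpen_le_affine_inter hV hW y.1 ⟨hyV, hyW⟩
  have hfW : Y.basicOpen f ≤ W := hfg.trans_le (Y.basicOpen_le g)
  obtain ⟨P₁, hP₁⟩ := exists_restrict hV P f rfl (Y.basicOpen_le f)
  obtain ⟨P₂, hP₂⟩ := exists_restrict hW P' g hfg hfW
  exact ⟨Y.basicOpen f, hV.basicOpen f, hyf, (Y.basicOpen_le f).trans hVU, P₁, P₂, fun y' hy' =>
    ⟨hP₁ y' hy' _ (hP y' _), hP₂ y' hy' _ (hP' y' _)⟩⟩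

theorem IsLocallyOp.add {U : Y.Opens} {s t : ∀ y : U, StalkOp Y y.1} (hs : IsLocallyOp U s)
    (ht : IsLocallyOp U t) : IsLocallyOp U fun y => s y + t y := fun y => by
  obtain ⟨V, hV, hyV, hVU, P, P', h⟩ := hs.exists₂ ht y
  exact ⟨V, hV, hyV, hVU, P + P', fun y' hy' => (h y' hy').1.add (h y' hy').2⟩

theorem IsLocallyOp.scalar (U : Y.Opens) (c : ℂ) :
    IsLocallyOp U fun y => algebraMap ℂ (StalkOp Y y.1) c := fun y => by
  obtain ⟨V, hV, hyV, hVU⟩ := exists_isAffineOpen_mem_and_subset y.2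
  exact ⟨V, hV, hyV, hVU, algebraMap ℂ _ c, fun y' hy' => isGermOf_algebraMap c hy'⟩

theorem IsLocallyOp.zero (U : Y.Opens) : IsLocallyOp U fun y => (0 : StalkOp Y y.1) := by
  simpa using IsLocallyOp.scalar U 0

variable (Y) in
/-- The algebra `Γ(U, D_Y)` of differential operators on `U`, realized as the algebra of those
families of differential operators of the local rings `O_{Y,y}`, `y ∈ U`, which are locally induced
by differential operators on affine open sets. -/
def diffOpSections (U : Y.Opens) : Subalgebra ℂ (∀ y : U, StalkOp Y y.1) where
  carrier := {s | IsLocallyOp U s}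
  mul_mem' := fun {s t} hs ht y => by
    obtain ⟨V, hV, hyV, hVU, P, P', h⟩ := hs.exists₂ ht y
    exact ⟨V, hV, hyV, hVU, P * P', fun y' hy' => (h y' hy').1.mul (h y' hy').2⟩
  add_mem' := fun hs ht => hs.add ht
  algebraMap_mem' := fun c => IsLocallyOp.scalar U c

theorem IsLocallyOp.restrict {U U' : Y.Opens} (h : U' ≤ U)
    {s : ∀ y : U, StalkOp Y y.1} (hs : IsLocallyOp U s) :
    IsLocallyOp U' fun y => s ⟨y.1, h y.2⟩ := fun y => by
  obtain ⟨V, hV, hyV, hVU, P, hP⟩ := hs ⟨y.1, h y.2⟩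
  obtain ⟨f, hf, hyf⟩ := hV.exists_basicOpen_le (V := U') y hyV
  obtain ⟨P₁, hP₁⟩ := exists_restrict hV P f rfl (Y.basicOpen_le f)
  exact ⟨Y.basicOpen f, hV.basicOpen f, hyf, hf, P₁, fun y' hy' => hP₁ y' hy' _ (hP y' _)⟩

/-- The sections of the sheaf `D_Y` over `U`. -/
def DSec (Y : Scheme.{0}) [Y.Over SpecC] (U : Y.Opens) : Type := diffOpSections Y U

instance (U : Y.Opens) : Ring (DSec Y U) := inferInstanceAs (Ring (diffOpSections Y U))

instance (U : Y.Opens) : Algebra ℂ (DSec Y U) := inferInstanceAs (Algebra ℂ (diffOpSections Y U))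

/-- The germ of a differential operator. -/
def DSec.germ {U : Y.Opens} (y : U) : DSec Y U →ₐ[ℂ] StalkOp Y y.1 :=
  (Pi.evalAlgHom ℂ _ y).comp (diffOpSections Y U).val

theorem DSec.ext {U : Y.Opens} {s t : DSec Y U} (h : ∀ y, germ y s = germ y t) : s = t :=
  Subtype.ext (funext h)

/-- Algebra homomorphisms to `Γ(U, D_Y)`, given germwise. -/
def DSec.lift {U : Y.Opens} {A : Type*} [Ring A] [Algebra ℂ A]
    (f : ∀ y : U, A →ₐ[ℂ] StalkOp Y y.1)
    (h : ∀ a, IsLocallyOp U fun y => f y a) : A →ₐ[ℂ] DSec Y U :=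
  AlgHom.codRestrict (AlgHom.pi f) (diffOpSections Y U) h

theorem DSec.germ_lift {U : Y.Opens} {A : Type*} [Ring A] [Algebra ℂ A]
    (f : ∀ y : U, A →ₐ[ℂ] StalkOp Y y.1) (h) (y : U) (a : A) :
    germ y (lift f h a) = f y a := rfl

/-- The restriction maps of `D_Y`. -/
def DSec.res {U U' : Y.Opens} (h : U' ≤ U) : DSec Y U →ₐ[ℂ] DSec Y U' :=
  lift (fun y => germ ⟨y.1, h y.2⟩) fun s => s.2.restrict h

theorem DSec.germ_res {U U' : Y.Opens} (h : U' ≤ U) (y : U') (s : DSec Y U) :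
    germ y (res h s) = germ ⟨y.1, h y.2⟩ s := rfl

variable (Y)

/-- The presheaf of rings underlying `D_Y`. -/
def DPresheaf : TopCat.Presheaf RingCat.{0} Y where
  obj U := RingCat.of (DSec Y (unop U))
  map i := RingCat.ofHom (DSec.res i.unop.le).toRingHom
  map_id _ := rfl
  map_comp _ _ := rfl

/-- The condition of being a section of `D_Y`, as a local predicate. -/
def diffOpPredicate : TopCat.LocalPredicate fun y : Y => StalkOp Y y where
  pred {U} s := IsLocallyOp (Y := Y) U s
  res i s hs := hs.restrict i.le
  locality {U} s hs y := by
    obtain ⟨W, hyW, i, h⟩ := hs y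
    obtain ⟨V, hV, hyV, hVW, P, hP⟩ := h ⟨y.1, hyW⟩
    exact ⟨V, hV, hyV, hVW.trans i.le, P, hP⟩

theorem DPresheaf_isSheaf : (DPresheaf Y).IsSheaf :=
  (TopCat.Presheaf.isSheaf_iff_isSheaf_comp (forget RingCat) _).mpr
    (TopCat.subpresheafToTypes.isSheaf (diffOpPredicate Y))

/-- The sheaf of rings `D_Y` of differential operators on the complex scheme `Y`. -/
def D : Sheaf (Opens.grothendieckTopology Y) RingCat.{0} := ⟨DPresheaf Y, DPresheaf_isSheaf Y⟩

end DSheaf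

/-! ### The product with the torus and external products of differential operators -/

section Box

/-- A criterion for a localization of `A ⊗ L` to be a localization of `A' ⊗ L`, where `A'` is a
localization of `A`. -/
theorem isLocalization_of_tensor {A A' L B B' : Type} [CommRing A] [CommRing A'] [CommRing L]
    [CommRing B] [CommRing B'] [Algebra ℂ A] [Algebra ℂ A'] [Algebra ℂ L] [Algebra ℂ B]
    [Algebra ℂ B'] (M : Submonoid A) (g : A →ₐ[ℂ] A')
    (hg : @IsLocalization _ _ M A' _ g.toRingHom.toAlgebra) (e : A ⊗[ℂ] L →ₐ[ℂ] B)
    (he : Function.Bijective e) (N : Submonoid B) (g' : B →ₐ[ℂ] B')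
    (hg' : @IsLocalization _ _ N B' _ g'.toRingHom.toAlgebra) (m : A' ⊗[ℂ] L →ₐ[ℂ] B')
    (hm : ∀ x, m (Algebra.TensorProduct.map g (AlgHom.id ℂ L) x) = g' (e x)) :
    @IsLocalization _ _ ((IsUnit.submonoid B').comap m) B' _ m.toRingHom.toAlgebra := by
  let := g.toRingHom.toAlgebra
  let := g'.toRingHom.toAlgebra
  let := m.toRingHom.toAlgebra
  let φ : A ⊗[ℂ] L →ₐ[ℂ] A' ⊗[ℂ] L := Algebra.TensorProduct.map g (AlgHom.id ℂ L)
  let := φ.toRingHom.toAlgebra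
  have : IsScalarTower ℂ A A' := .of_algebraMap_eq fun c => (g.commutes c).symm
  have : IsScalarTower A (A ⊗[ℂ] L) (A' ⊗[ℂ] L) := .of_algebraMap_eq fun a => by
    change g a ⊗ₜ[ℂ] (1 : L) = φ (a ⊗ₜ 1)
    simp [φ]
  have h₁ : IsLocalization (Algebra.algebraMapSubmonoid (A ⊗[ℂ] L) M) (A' ⊗[ℂ] L) :=
    IsLocalization.tensorProduct_tensorProduct ℂ L M A' (by
      ext l
      change φ (1 ⊗ₜ l) = 1 ⊗ₜ l
      simp [φ])
  let := (g'.comp e).toRingHom.toAlgebra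
  have h₂ : IsLocalization ((IsUnit.submonoid B').comap (g'.comp e)) B' := by
    have h := IsLocalization.isLocalization_of_base_ringEquiv N B'
      (RingEquiv.ofBijective e he).symm
    have h' : IsLocalization (N.map (RingEquiv.ofBijective e he).symm) B' := by
      convert h
      rfl
    refine IsLocalization.of_le (M := N.map (RingEquiv.ofBijective e he).symm) _ ?_ fun r hr => hr
    rintro _ ⟨b, hb, rfl⟩
    change IsUnit (g' (e _))
    have : e ((RingEquiv.ofBijective e he).symm b) = b :=
      (RingEquiv.ofBijective e he).apply_symm_apply b
    rw [show e _ = b from this]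
    exact IsLocalization.map_units B' (⟨b, hb⟩ : N)
  have : IsScalarTower (A ⊗[ℂ] L) (A' ⊗[ℂ] L) B' := .of_algebraMap_eq fun x => (hm x).symm
  have hle : Algebra.algebraMapSubmonoid (A ⊗[ℂ] L) M ≤
      (IsUnit.submonoid B').comap (g'.comp e) := by
    intro x hx
    change IsUnit (g' (e x))
    rw [← hm]
    exact (IsLocalization.map_units (A' ⊗[ℂ] L) (⟨x, hx⟩ :
      Algebra.algebraMapSubmonoid (A ⊗[ℂ] L) M)).map m
  have h₃ := IsLocalization.isLocalization_of_submonoid_le (A' ⊗[ℂ] L) B' _ _ hle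
  refine @IsLocalization.of_le _ _ _ _ _ _ h₃ _ ?_ fun r hr => hr
  rintro _ ⟨x, hx, rfl⟩
  change IsUnit (m (φ x))
  rw [hm]
  exact hx

variable (Z : Scheme.{0}) [Z.Over SpecC] (n : ℕ)

/-- The structure morphism of the torus `T = Spec ℂ[x_1^{±1}, …, x_n^{±1}]`. -/
def torusStructure : Spec (CommRingCat.of (Laurent n)) ⟶ SpecC :=
  Spec.map (CommRingCat.ofHom (algebraMap ℂ (Laurent n)))

/-- The product `Z × T` over `ℂ`. -/
def ProdTorus : Scheme.{0} := pullback (Z ↘ SpecC) (torusStructure n)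

/-- The projection `Z × T → Z`. -/
def projZ : ProdTorus Z n ⟶ Z := pullback.fst _ _

/-- The projection `Z × T → T`. -/
def projT : ProdTorus Z n ⟶ Spec (CommRingCat.of (Laurent n)) := pullback.snd _ _

instance : (ProdTorus Z n).Over SpecC := ⟨projZ Z n ≫ Z ↘ SpecC⟩

theorem prodTorus_isPullback :
    IsPullback (projZ Z n) (projT Z n) (Z ↘ SpecC) (torusStructure n) :=
  .of_hasPullback _ _

variable {Z n}

/-- Pulling back functions from `Z` to `Z × T`. -/
def pullZ {V : Z.Opens} {W : (ProdTorus Z n).Opens} (h : W ≤ projZ Z n ⁻¹ᵁ V) :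
    Γ(Z, V) →ₐ[ℂ] Γ(ProdTorus Z n, W) :=
  { ((projZ Z n).appLE V W h).hom with
    commutes' := fun c => by
      change ((scalarHom Z V) ≫ (projZ Z n).appLE V W h).hom c = (scalarHom _ W).hom c
      rw [scalarHom, Category.assoc, Scheme.Hom.appLE_comp_appLE]
      rfl }

theorem torus_appLE (W : (ProdTorus Z n).Opens) :
    (torusStructure n).appTop ≫ (projT Z n).appLE ⊤ W (le_preimage_top _ W) =
      (ProdTorus Z n ↘ SpecC).appLE ⊤ W (le_preimage_top _ W) := by
  refine (Scheme.Hom.comp_appLE (projT Z n) (torusStructure n) ⊤ W (le_preimage_top _ W)).symm.trans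
    ?_
  simp only [← (prodTorus_isPullback Z n).w]
  rfl

/-- Pulling back functions from `T` to `Z × T`. -/
def pullT (W : (ProdTorus Z n).Opens) : Laurent n →ₐ[ℂ] Γ(ProdTorus Z n, W) :=
  { ((Scheme.ΓSpecIso (CommRingCat.of (Laurent n))).inv ≫ (projT Z n).appLE ⊤ W (le_preimage_top _ W)).hom with
    commutes' := fun c => by
      change ((CommRingCat.ofHom (algebraMap ℂ (Laurent n))) ≫
        (Scheme.ΓSpecIso (CommRingCat.of (Laurent n))).inv ≫ (projT Z n).appLE ⊤ W (le_preimage_top _ W)).hom c =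
        (scalarHom _ W).hom c
      rw [Scheme.ΓSpecIso_inv_naturality_assoc]
      exact congrArg (fun f => ((Scheme.ΓSpecIso (CommRingCat.of ℂ)).inv ≫ f).hom c)
        (torus_appLE W) }

theorem resHom_pullZ {V : Z.Opens} {W W' : (ProdTorus Z n).Opens} (h : W ≤ projZ Z n ⁻¹ᵁ V)
    (hW : W' ≤ W) (f : Γ(Z, V)) : resHom hW (pullZ h f) = pullZ (hW.trans h) f :=
  congrArg (fun g => g.hom f) (Scheme.Hom.appLE_map (projZ Z n) h (homOfLE hW).op)

theorem resHom_pullT {W W' : (ProdTorus Z n).Opens} (hW : W' ≤ W) (l : Laurent n) :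
    resHom hW (pullT W l) = pullT W' l := by
  have := Scheme.Hom.appLE_map (projT Z n) (le_preimage_top _ W) (homOfLE hW).op
  exact congrArg (fun g => g.hom ((Scheme.ΓSpecIso (CommRingCat.of (Laurent n))).inv.hom l)) this

/-- Pulling back germs of functions from `Z` to `Z × T`. -/
def stalkPullZ (y : ProdTorus Z n) :
    Z.presheaf.stalk (projZ Z n y) →ₐ[ℂ] (ProdTorus Z n).presheaf.stalk y :=
  { ((projZ Z n).stalkMap y).hom with
    commutes' := fun c => by
      change ((projZ Z n).stalkMap y).hom (algebraMap ℂ _ c) = _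
      rw [← (germHom (U := ⊤) (y := projZ Z n y) trivial).commutes c,
        ← (germHom (U := projZ Z n ⁻¹ᵁ ⊤) (y := y) trivial).commutes c, ← (pullZ le_rfl).commutes]
      refine (Scheme.Hom.germ_stalkMap_apply (projZ Z n) ⊤ y trivial _).trans ?_
      have h : (projZ Z n).app ⊤ = (projZ Z n).appLE ⊤ (projZ Z n ⁻¹ᵁ ⊤) le_rfl :=
        Scheme.Hom.app_eq_appLE _
      exact congrArg (germHom _) (congrArg (fun f => f.hom (algebraMap ℂ Γ(Z, ⊤) c)) h) }

theorem stalkPullZ_germHom {V : Z.Opens} {W : (ProdTorus Z n).Opens} (h : W ≤ projZ Z n ⁻¹ᵁ V)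
    {y : ProdTorus Z n} (hy : y ∈ W) (f : Γ(Z, V)) :
    stalkPullZ y (germHom (U := V) (h hy) f) = germHom hy (pullZ h f) := by
  refine (Scheme.Hom.germ_stalkMap_apply (projZ Z n) V y (h hy) f).trans ?_
  exact (TopCat.Presheaf.germ_res_apply _ (homOfLE h) y hy _).symm

/-- Pulling back functions from `T` to germs on `Z × T`. -/
def stalkPullT (y : ProdTorus Z n) : Laurent n →ₐ[ℂ] (ProdTorus Z n).presheaf.stalk y :=
  (germHom (U := ⊤) trivial).comp (pullT ⊤)

theorem stalkPullT_eq {W : (ProdTorus Z n).Opens} {y : ProdTorus Z n} (hy : y ∈ W)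
    (l : Laurent n) : stalkPullT y l = germHom hy (pullT W l) := by
  rw [← resHom_pullT (le_top : W ≤ ⊤), germHom_resHom]
  rfl

/-- The map `Γ(V, O_Z) ⊗ Γ(T, O_T) → Γ(W, O_{Z × T})` for `W ⊆ V × T`. -/
def sectionMul {V : Z.Opens} {W : (ProdTorus Z n).Opens} (h : W ≤ projZ Z n ⁻¹ᵁ V) :
    Γ(Z, V) ⊗[ℂ] Laurent n →ₐ[ℂ] Γ(ProdTorus Z n, W) :=
  Algebra.TensorProduct.lift (pullZ h) (pullT W) fun _ _ => mul_comm _ _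

/-- The map `O_{Z,z} ⊗ Γ(T, O_T) → O_{Z × T, y}` for a point `y` over `z`. -/
def stalkMul (y : ProdTorus Z n) :
    Z.presheaf.stalk (projZ Z n y) ⊗[ℂ] Laurent n →ₐ[ℂ] (ProdTorus Z n).presheaf.stalk y :=
  Algebra.TensorProduct.lift (stalkPullZ y) (stalkPullT y) fun _ _ => mul_comm _ _

theorem sectionMul_tmul {V : Z.Opens} {W : (ProdTorus Z n).Opens} (h : W ≤ projZ Z n ⁻¹ᵁ V)
    (a : Γ(Z, V)) (l : Laurent n) : sectionMul h (a ⊗ₜ l) = pullZ h a * pullT W l :=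
  Algebra.TensorProduct.lift_tmul _ _ _ _ _

theorem stalkMul_tmul (y : ProdTorus Z n) (a : Z.presheaf.stalk (projZ Z n y)) (l : Laurent n) :
    stalkMul y (a ⊗ₜ l) = stalkPullZ y a * stalkPullT y l :=
  Algebra.TensorProduct.lift_tmul _ _ _ _ _

theorem stalkMul_map {V : Z.Opens} {W : (ProdTorus Z n).Opens} (h : W ≤ projZ Z n ⁻¹ᵁ V)
    {y : ProdTorus Z n} (hy : y ∈ W) (x : Γ(Z, V) ⊗[ℂ] Laurent n) :
    stalkMul y (Algebra.TensorProduct.map (germHom (U := V) (h hy)) (AlgHom.id ℂ (Laurent n)) x) =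
      germHom hy (sectionMul h x) := by
  induction x with
  | zero => simp
  | add a b ha hb => rw [map_add, map_add, ha, hb, map_add, map_add]
  | tmul a l =>
    rw [Algebra.TensorProduct.map_tmul, stalkMul_tmul, sectionMul_tmul, map_mul, stalkPullZ_germHom h hy, AlgHom.id_apply,
      stalkPullT_eq hy]

theorem projZ_preimage_isAffineOpen {V : Z.Opens} (hV : IsAffineOpen V) :
    IsAffineOpen (projZ Z n ⁻¹ᵁ V) := by
  have : IsAffineHom (torusStructure n) := by unfold torusStructure; infer_instance
  have : IsAffineHom (projZ Z n) := 
    MorphismProperty.of_isPullback (P := @IsAffineHom) (prodTorus_isPullback Z n).flip this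
  exact hV.preimage _

theorem sectionMul_bijective {V : Z.Opens} (hV : IsAffineOpen V) :
    Function.Bijective (sectionMul (n := n) (le_refl (projZ Z n ⁻¹ᵁ V))) := by
  have h₁ : IsIso _ := isIso_pushoutSection_of_isAffineOpen (prodTorus_isPullback Z n)
    (US := ⊤) (UT := ⊤) (UX := V) (UY := projZ Z n ⁻¹ᵁ V) le_top le_top
    (by rw [Scheme.Hom.preimage_top, inf_top_eq]) (isAffineOpen_top _) (isAffineOpen_top _) hV
  replace h₁ := (isIso_pushoutSection_iff ..).mp h₁
  have h₂ : IsPushout (CommRingCat.ofHom (algebraMap ℂ Γ(Z, V)))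
      (CommRingCat.ofHom (algebraMap ℂ (Laurent n)))
      (CommRingCat.ofHom (pullZ (n := n) (le_refl (projZ Z n ⁻¹ᵁ V))).toRingHom)
      (CommRingCat.ofHom (pullT (n := n) (projZ Z n ⁻¹ᵁ V)).toRingHom) := by
    refine h₁.of_iso (Scheme.ΓSpecIso (CommRingCat.of ℂ)) (Iso.refl _)
      (Scheme.ΓSpecIso (CommRingCat.of (Laurent n))) (Iso.refl _) ?_ ?_ ?_ ?_
    · exact (Category.comp_id _).trans (Iso.hom_inv_id_assoc _ _).symm
    · exact (congrArg (· ≫ _) (Scheme.Hom.appLE_eq_app (torusStructure n) (U := ⊤))).trans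
        (Scheme.ΓSpecIso_naturality _)
    · exact (Category.comp_id _).trans (Category.id_comp _).symm
    · exact (Category.comp_id _).trans (Iso.hom_inv_id_assoc _ _).symm
  let e := (CommRingCat.isPushout_tensorProduct ℂ Γ(Z, V) (Laurent n)).isoIsPushout _ _ h₂
  have he : ∀ x : Γ(Z, V) ⊗[ℂ] Laurent n, e.hom.hom x = sectionMul (n := n) (le_refl (projZ Z n ⁻¹ᵁ V)) x := by
    intro x
    have hl : ∀ a, e.hom.hom (a ⊗ₜ 1 : Γ(Z, V) ⊗[ℂ] Laurent n) = pullZ (le_refl (projZ Z n ⁻¹ᵁ V)) a := fun a =>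
      congrArg (fun f => CommRingCat.Hom.hom f a) (IsPushout.inl_isoIsPushout_hom _ _
        (CommRingCat.isPushout_tensorProduct ℂ Γ(Z, V) (Laurent n)) h₂)
    have hr : ∀ l, e.hom.hom (1 ⊗ₜ l : Γ(Z, V) ⊗[ℂ] Laurent n) = pullT (projZ Z n ⁻¹ᵁ V) l := fun l =>
      congrArg (fun f => CommRingCat.Hom.hom f l) (IsPushout.inr_isoIsPushout_hom _ _
        (CommRingCat.isPushout_tensorProduct ℂ Γ(Z, V) (Laurent n)) h₂)
    induction x with
    | zero => rw [map_zero, map_zero]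
    | add a b ha hb => rw [map_add, ha, hb, map_add]
    | tmul a l =>
      have : (a ⊗ₜ l : Γ(Z, V) ⊗[ℂ] Laurent n) = (a ⊗ₜ 1) * (1 ⊗ₜ l) := by
        rw [Algebra.TensorProduct.tmul_mul_tmul, one_mul, mul_one]
      rw [sectionMul_tmul, ← hl, ← hr, this]
      exact map_mul e.hom.hom _ _
  rw [← funext he]
  exact e.commRingCatIsoToRingEquiv.bijective

theorem stalkMul_isLocalization (y : ProdTorus Z n) :
    @IsLocalization _ _ ((IsUnit.submonoid ((ProdTorus Z n).presheaf.stalk y)).comap (stalkMul y))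
      ((ProdTorus Z n).presheaf.stalk y) _ (stalkMul y).toRingHom.toAlgebra := by
  obtain ⟨V, hV, hyV, -⟩ := exists_isAffineOpen_mem_and_subset
    (show projZ Z n y ∈ (⊤ : Z.Opens) from trivial)
  have hW := projZ_preimage_isAffineOpen (n := n) hV
  exact isLocalization_of_tensor _ (germHom hyV) (hV.isLocalization_stalk ⟨_, hyV⟩) _
    (sectionMul_bijective hV) _ (germHom (y := y) (U := projZ Z n ⁻¹ᵁ V) hyV)
    (hW.isLocalization_stalk ⟨y, hyV⟩) (stalkMul y) (stalkMul_map le_rfl hyV)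

/-- The external product of the germ at `z` of a differential operator on `Z` and a differential
operator on `T`, at a point `y` over `z`. -/
def stalkBox (y : ProdTorus Z n) :
    StalkOp Z (projZ Z n y) ⊗[ℂ] TorusOp n →ₐ[ℂ] StalkOp (ProdTorus Z n) y :=
  letI := (stalkMul y).toRingHom.toAlgebra
  haveI := stalkMul_isLocalization y
  haveI : IsScalarTower ℂ (Z.presheaf.stalk (projZ Z n y) ⊗[ℂ] Laurent n)
      ((ProdTorus Z n).presheaf.stalk y) := .of_algebraMap_eq fun c => ((stalkMul y).commutes c).symm
  (diffOp.localize ((IsUnit.submonoid ((ProdTorus Z n).presheaf.stalk y)).comap (stalkMul y))).comp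
    (diffOp.box ℂ (Z.presheaf.stalk (projZ Z n y)) (Laurent n))

theorem stalkBox_apply (y : ProdTorus Z n) (P : StalkOp Z (projZ Z n y)) (Q : TorusOp n)
    (a : Z.presheaf.stalk (projZ Z n y)) (l : Laurent n) :
    (stalkBox y (P ⊗ₜ Q)).1 (stalkPullZ y a * stalkPullT y l) =
      stalkPullZ y (P.1 a) * stalkPullT y (Q.1 l) := by
  let := (stalkMul y).toRingHom.toAlgebra
  have := stalkMul_isLocalization y
  have : IsScalarTower ℂ (Z.presheaf.stalk (projZ Z n y) ⊗[ℂ] Laurent n)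
      ((ProdTorus Z n).presheaf.stalk y) := .of_algebraMap_eq fun c => ((stalkMul y).commutes c).symm
  rw [← stalkMul_tmul, ← stalkMul_tmul]
  refine (diffOp.localize_apply (B := (ProdTorus Z n).presheaf.stalk y)
    ((IsUnit.submonoid ((ProdTorus Z n).presheaf.stalk y)).comap (stalkMul y))
    (diffOp.box ℂ (Z.presheaf.stalk (projZ Z n y)) (Laurent n) (P ⊗ₜ Q)) (a ⊗ₜ l)).trans ?_
  exact congrArg (stalkMul y) (diffOp.box_apply P Q a l)

theorem exists_sectionBox {V : Z.Opens} (hV : IsAffineOpen V) (P : diffOp ℂ Γ(Z, V))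
    (Q : TorusOp n) : ∃ R : diffOp ℂ Γ(ProdTorus Z n, projZ Z n ⁻¹ᵁ V), ∀ a l,
      R.1 (pullZ le_rfl a * pullT _ l) = pullZ le_rfl (P.1 a) * pullT _ (Q.1 l) := by
  let := (sectionMul (n := n) (le_refl (projZ Z n ⁻¹ᵁ V))).toRingHom.toAlgebra
  have : IsScalarTower ℂ (Γ(Z, V) ⊗[ℂ] Laurent n) Γ(ProdTorus Z n, projZ Z n ⁻¹ᵁ V) :=
    .of_algebraMap_eq fun c => ((sectionMul (le_refl (projZ Z n ⁻¹ᵁ V))).commutes c).symm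
  have : IsLocalization (⊥ : Submonoid (Γ(Z, V) ⊗[ℂ] Laurent n))
      Γ(ProdTorus Z n, projZ Z n ⁻¹ᵁ V) :=
    IsLocalization.of_le_isUnit_of_bijective (by
      rintro _ ⟨x, rfl, rfl⟩
      change IsUnit (sectionMul (le_refl (projZ Z n ⁻¹ᵁ V)) 1)
      rw [map_one]
      exact isUnit_one) (sectionMul_bijective hV)
  refine ⟨diffOp.localize ⊥ (diffOp.box ℂ Γ(Z, V) (Laurent n) (P ⊗ₜ Q)), fun a l => ?_⟩
  rw [← sectionMul_tmul, ← sectionMul_tmul]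
  refine (diffOp.localize_apply (B := Γ(ProdTorus Z n, projZ Z n ⁻¹ᵁ V)) ⊥
    (diffOp.box ℂ Γ(Z, V) (Laurent n) (P ⊗ₜ Q)) (a ⊗ₜ l)).trans ?_
  exact congrArg (sectionMul le_rfl) (diffOp.box_apply P Q a l)

theorem stalkBox_isLocallyOp {U : Z.Opens} (s : DSec Z U) (Q : TorusOp n) :
    IsLocallyOp (projZ Z n ⁻¹ᵁ U) fun y => stalkBox y.1 (s.1 ⟨projZ Z n y.1, y.2⟩ ⊗ₜ Q) := by
  intro y
  obtain ⟨V, hV, hyV, hVU, P, hP⟩ := s.2 ⟨projZ Z n y.1, y.2⟩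
  obtain ⟨R, hR⟩ := exists_sectionBox hV P Q
  refine ⟨projZ Z n ⁻¹ᵁ V, projZ_preimage_isAffineOpen hV, hyV, fun y hy => hVU hy, R,
    fun y' hy' f => ?_⟩
  obtain ⟨x, rfl⟩ := (sectionMul_bijective hV).2 f
  induction x with
  | zero => simp only [map_zero]
  | add a b ha hb => simp only [map_add, ha, hb]
  | tmul a l =>
    rw [sectionMul_tmul, hR, map_mul (germHom hy'), map_mul (germHom hy'), ← stalkPullZ_germHom le_rfl hy',
      ← stalkPullZ_germHom le_rfl hy', ← stalkPullT_eq hy', ← stalkPullT_eq hy', stalkBox_apply]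
    exact congrArg (fun b => stalkPullZ y' b * _) (hP _ hy' a)

/-- The external product `Γ(U, D_Z) ⊗ Γ(T, D_T) → Γ(U × T, D_{Z × T})`. -/
def box (Z : Scheme.{0}) [Z.Over SpecC] (n : ℕ) (U : Z.Opens) :
    DSec Z U ⊗[ℂ] TorusOp n →ₐ[ℂ] DSec (ProdTorus Z n) (projZ Z n ⁻¹ᵁ U) :=
  DSec.lift (fun y => (stalkBox y.1).comp (Algebra.TensorProduct.map
    (DSec.germ ⟨projZ Z n y.1, y.2⟩) (AlgHom.id ℂ (TorusOp n)))) (fun x => by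
      induction x with
      | zero => simp only [map_zero]; exact IsLocallyOp.zero _
      | add a b ha hb => simp only [map_add]; exact IsLocallyOp.add ha hb
      | tmul s Q => exact stalkBox_isLocallyOp s Q)

theorem box_res {U U' : Z.Opens} (h : U' ≤ U) (h' : projZ Z n ⁻¹ᵁ U' ≤ projZ Z n ⁻¹ᵁ U)
    (x : DSec Z U ⊗[ℂ] TorusOp n) :
    box Z n U' (baseMap (TorusOp n) (DSec.res h) x) = DSec.res h' (box Z n U x) := by
  induction x with
  | zero => simp only [map_zero]
  | add a b ha hb => simp only [map_add, ha, hb]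
  | tmul s Q => rfl

end Box

/-! ### The partial Mellin transform and the relative twisted de Rham complex -/

section Main

variable (Z : Scheme.{0}) [Z.Over SpecC] (n : ℕ)

/-- The presheaf of rings `U ↦ Γ(U, D_Z) ⊗_ℂ R`. -/
def tensorPresheaf (R : Type) [Ring R] [Algebra ℂ R] : (Opens Z)ᵒᵖ ⥤ RingCat.{0} where
  obj U := RingCat.of (DSec Z (unop U) ⊗[ℂ] R)
  map i := RingCat.ofHom (baseMap R (DSec.res i.unop.le)).toRingHom
  map_id U := by
    refine RingCat.hom_ext (RingHom.ext fun (x : DSec Z (unop U) ⊗[ℂ] R) => ?_)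
    change baseMap R _ x = x
    induction x with
    | zero => simp only [map_zero]
    | add a b ha hb => simp only [map_add, ha, hb]
    | tmul s r => rfl
  map_comp {U V W} i j := by
    refine RingCat.hom_ext (RingHom.ext fun (x : DSec Z (unop U) ⊗[ℂ] R) => ?_)
    change baseMap R _ x = baseMap R _ (baseMap R _ x)
    induction x with
    | zero => simp only [map_zero]
    | add a b ha hb => simp only [map_add, ha, hb]
    | tmul s r => rfl

/-- The sheaf of rings `DD = D_Z ⊠ R`: the sheaf associated with `U ↦ Γ(U, D_Z) ⊗_ℂ R`. -/
def DD : Sheaf (Opens.grothendieckTopology Z) RingCat.{0} :=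
  (presheafToSheaf (Opens.grothendieckTopology Z) RingCat.{0}).obj (tensorPresheaf Z (RRing n))

/-- The canonical map from `U ↦ Γ(U, D_Z) ⊗_ℂ R` to its associated sheaf `DD`. -/
def toDD : tensorPresheaf Z (RRing n) ⟶ (DD Z n).obj :=
  toSheafify (Opens.grothendieckTopology Z) (tensorPresheaf Z (RRing n))

instance : Presheaf.IsLocallyInjective (Opens.grothendieckTopology Z) (toDD Z n) :=
  inferInstanceAs (Presheaf.IsLocallyInjective (Opens.grothendieckTopology Z)
    (toSheafify (Opens.grothendieckTopology Z) (tensorPresheaf Z (RRing n))))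

instance : Presheaf.IsLocallySurjective (Opens.grothendieckTopology Z) (toDD Z n) :=
  inferInstanceAs (Presheaf.IsLocallySurjective (Opens.grothendieckTopology Z)
    (toSheafify (Opens.grothendieckTopology Z) (tensorPresheaf Z (RRing n))))

variable {Z n} (M : SheafOfModules.{0} (D (ProdTorus Z n)))

/-- The sections `Γ(U × T, M)` of `π_{Z*} M` over `U`. -/
def Push (U : Opens Z) : Type := M.val.obj (op (projZ Z n ⁻¹ᵁ U))

instance (U : Opens Z) : AddCommGroup (Push M U) :=
  inferInstanceAs (AddCommGroup (M.val.obj (op (projZ Z n ⁻¹ᵁ U))))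

instance (U : Opens Z) : Module (DSec (ProdTorus Z n) (projZ Z n ⁻¹ᵁ U)) (Push M U) :=
  (M.val.obj (op (projZ Z n ⁻¹ᵁ U))).isModule

/-- `Γ(U × T, M)` as a module over `Γ(U, D_Z) ⊗ Γ(T, D_T)`. -/
instance (U : Opens Z) : Module (DSec Z U ⊗[ℂ] TorusOp n) (Push M U) :=
  Module.compHom _ (box Z n U).toRingHom

/-- The restriction maps of `π_{Z*} M`. -/
def Push.res {U U' : Opens Z} (h : U' ≤ U) : Push M U →+ Push M U' :=
  (M.val.restrictₛₗ (homOfLE (show projZ Z n ⁻¹ᵁ U' ≤ projZ Z n ⁻¹ᵁ U from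
    fun _ hy => h hy)).op).toAddMonoidHom

theorem Push.res_smul {U U' : Opens Z} (h : U' ≤ U) (r : DSec Z U ⊗[ℂ] TorusOp n) (x : Push M U) :
    res M h (r • x) = baseMap (TorusOp n) (DSec.res h) r • res M h x := by
  refine (M.val.map_smul _ (box Z n U r) x).trans ?_
  change _ = box Z n U' _ • res M h x
  rw [box_res h (fun _ hy => h hy)]
  rfl

theorem Push.res_refl {U : Opens Z} (h : U ≤ U) (x : Push M U) : res M h x = x :=
  congrArg (fun f : M.val.presheaf.obj _ ⟶ M.val.presheaf.obj _ => f x)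
    (M.val.presheaf.map_id (op (projZ Z n ⁻¹ᵁ U)))

theorem Push.res_res {U U' U'' : Opens Z} (h : U' ≤ U) (h' : U'' ≤ U') (h'' : U'' ≤ U)
    (x : Push M U) : res M h'' x = res M h' (res M h x) :=
  M.val.map_comp_apply (homOfLE (show projZ Z n ⁻¹ᵁ U' ≤ projZ Z n ⁻¹ᵁ U from
    fun _ hy => h hy)).op (homOfLE (show projZ Z n ⁻¹ᵁ U'' ≤ projZ Z n ⁻¹ᵁ U' from
    fun _ hy => h' hy)).op x

/-- The sections over `U` of `𝔐^pol(M)`: the group `Γ(U × T, M)`, on which `D_Z ⊠ R^pol` acts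
through the ring isomorphism `𝔐`. -/
def MellinPol (U : Opens Z) : Type := Push M U

instance (U : Opens Z) : AddCommGroup (MellinPol M U) := inferInstanceAs (AddCommGroup (Push M U))

instance (U : Opens Z) : Module (DSec Z U ⊗[ℂ] Rpol n) (MellinPol M U) :=
  Module.compHom (Push M U) (Algebra.TensorProduct.map (AlgHom.id ℂ (DSec Z U))
    (mellinTorus n)).toRingHom

/-- The restriction maps of `𝔐^pol(M)`. -/
def MellinPol.res {U U' : Opens Z} (h : U' ≤ U) : MellinPol M U →+ MellinPol M U' := Push.res M h

theorem MellinPol.res_smul {U U' : Opens Z} (h : U' ≤ U) (r : DSec Z U ⊗[ℂ] Rpol n)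
    (x : MellinPol M U) : res M h (r • x) = baseMap (Rpol n) (DSec.res h) r • res M h x := by
  refine (Push.res_smul M h _ x).trans ?_
  have : baseMap (TorusOp n) (DSec.res h) (Algebra.TensorProduct.map (AlgHom.id ℂ (DSec Z U))
      (mellinTorus n) r) = Algebra.TensorProduct.map (AlgHom.id ℂ (DSec Z U')) (mellinTorus n)
        (baseMap (Rpol n) (DSec.res h) r) := by
    induction r with
    | zero => simp only [map_zero]
    | add a b ha hb => simp only [map_add, ha, hb]
    | tmul s r => rfl
  exact congrArg (· • (Push.res M h x)) this

theorem MellinPol.res_refl {U : Opens Z} (h : U ≤ U) (x : MellinPol M U) : res M h x = x :=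
  Push.res_refl M h x

theorem MellinPol.res_res {U U' U'' : Opens Z} (h : U' ≤ U) (h' : U'' ≤ U') (h'' : U'' ≤ U)
    (x : MellinPol M U) : res M h'' x = res M h' (res M h x) :=
  Push.res_res M h h' h'' x

/-- The presheaf of abelian groups `U ↦ K ⊗_{ℂ[ν]} Γ(U, 𝔐^pol(M))`. -/
def mellinAb : (Opens Z)ᵒᵖ ⥤ Ab.{0} where
  obj U := AddCommGrpCat.of (MellinLoc n (DSec Z (unop U)) (MellinPol M (unop U)))
  map i := AddCommGrpCat.ofHom (MellinLoc.map (DSec.res i.unop.le) (MellinPol.res M i.unop.le)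
    (MellinPol.res_smul M i.unop.le))
  map_id U := AddCommGrpCat.hom_ext (AddMonoidHom.ext fun x =>
    MellinLoc.map_id' (DSec.res (𝟙 U : U ⟶ U).unop.le) _ (MellinPol.res_smul M _)
      (MellinPol.res_refl M _) x)
  map_comp {U V W} i j := AddCommGrpCat.hom_ext (AddMonoidHom.ext fun x =>
    MellinLoc.map_comp' (DSec.res i.unop.le) _ (MellinPol.res_smul M _) (DSec.res j.unop.le) _
      (MellinPol.res_smul M _) (DSec.res (i ≫ j).unop.le) _ (MellinPol.res_smul M _)
      (MellinPol.res_res M _ _ _) x)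

instance (U : (Opens Z)ᵒᵖ) : Module ((tensorPresheaf Z (RRing n)).obj U) ((mellinAb M).obj U) :=
  inferInstanceAs (Module (DSec Z (unop U) ⊗[ℂ] RRing n)
    (MellinLoc n (DSec Z (unop U)) (MellinPol M (unop U))))

/-- The presheaf of modules `U ↦ K ⊗_{ℂ[ν]} Γ(U, 𝔐^pol(M))`. -/
def mellinPre : PresheafOfModules.{0} (tensorPresheaf Z (RRing n)) :=
  PresheafOfModules.ofPresheaf (mellinAb M) fun _ _ i r x =>
    MellinLoc.map_smul _ _ (MellinPol.res_smul M i.unop.le) r x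

/-- The partial Mellin transform `𝔐(M) = K ⊗_{ℂ[ν]} 𝔐^pol(M)`, a module over `DD`. -/
def mellin : SheafOfModules.{0} (DD Z n) :=
  (PresheafOfModules.sheafification (toDD Z n)).obj (mellinPre M)

/-- The presheaf `U ↦ ⊕_{|I| = k} (K ⊗_ℂ Γ(U × T, M)) dx_I` of relative `k`-forms. -/
def omegaAb (k : ℕ) : (Opens Z)ᵒᵖ ⥤ Ab.{0} where
  obj U := AddCommGrpCat.of (Forms n k (BaseChange n (DSec Z (unop U)) (Push M (unop U))))
  map i := AddCommGrpCat.ofHom (AddMonoidHom.mk' (fun φ I =>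
    BaseChange.map (DSec.res i.unop.le) (Push.res M i.unop.le) (Push.res_smul M i.unop.le) (φ I))
    (fun φ ψ => funext fun I => map_add _ _ _))
  map_id U := AddCommGrpCat.hom_ext (AddMonoidHom.ext fun φ => funext fun I =>
    BaseChange.map_id' (DSec.res (𝟙 U : U ⟶ U).unop.le) _ (Push.res_smul M _)
      (Push.res_refl M _) (φ I))
  map_comp {U V W} i j := AddCommGrpCat.hom_ext (AddMonoidHom.ext fun φ => funext fun I =>
    BaseChange.map_comp' (DSec.res i.unop.le) _ (Push.res_smul M _) (DSec.res j.unop.le) _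
      (Push.res_smul M _) (DSec.res (i ≫ j).unop.le) _ (Push.res_smul M _)
      (Push.res_res M _ _ _) (φ I))

instance (k : ℕ) (U : (Opens Z)ᵒᵖ) :
    Module ((tensorPresheaf Z (RRing n)).obj U) ((omegaAb M k).obj U) :=
  inferInstanceAs (Module (DSec Z (unop U) ⊗[ℂ] RRing n)
    (Forms n k (BaseChange n (DSec Z (unop U)) (Push M (unop U)))))

/-- The presheaf of relative `k`-forms, as a presheaf of modules; `D_Z` acts on the coefficients and
`σ_i` acts by `ξ(ν) ↦ x_i ξ(ν + e_i)`. -/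
def omegaPre (k : ℕ) : PresheafOfModules.{0} (tensorPresheaf Z (RRing n)) :=
  PresheafOfModules.ofPresheaf (omegaAb M k) fun _ _ i r φ => funext fun I =>
    BaseChange.map_smul _ _ (Push.res_smul M i.unop.le) r (φ I)

/-- The relative twisted differential `∇_ω = d_x + ω ∧`, where `ω = ∑ ν_j dx_j / x_j`, on sections. -/
def nablaSec (k : ℕ) (U : Opens Z) :
    Forms n k (BaseChange n (DSec Z U) (Push M U)) →+
      Forms n (k + 1) (BaseChange n (DSec Z U) (Push M U)) :=
  twistedD (fun j => (BaseChange.nabla j :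
    Module.End ℂ (BaseChange n (DSec Z U) (Push M U))).toAddMonoidHom) k

theorem nablaSec_smul (k : ℕ) (U : Opens Z) (r : DSec Z U ⊗[ℂ] RRing n)
    (φ : Forms n k (BaseChange n (DSec Z U) (Push M U))) :
    nablaSec M k U (r • φ) = r • nablaSec M k U φ := by
  funext J
  exact (twistedD_map _ _ (DistribSMul.toAddMonoidHom (BaseChange n (DSec Z U) (Push M U)) r)
    (fun j x => (BaseChange.nabla_smul j r x).symm) k φ J).symm

theorem nablaSec_res (k : ℕ) {U U' : Opens Z} (h : U' ≤ U)
    (φ : Forms n k (BaseChange n (DSec Z U) (Push M U))) (J : {I : Finset (Fin n) // I.card = k + 1}) :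
    BaseChange.map (DSec.res h) (Push.res M h) (Push.res_smul M h) (nablaSec M k U φ J) =
      nablaSec M k U' (fun I => BaseChange.map (DSec.res h) (Push.res M h) (Push.res_smul M h) (φ I))
        J :=
  twistedD_map _ _ (BaseChange.map (DSec.res h) (Push.res M h) (Push.res_smul M h))
    (fun j x => BaseChange.map_nabla (DSec.res h) (Push.res M h) (Push.res_smul M h) j x) k φ J

/-- The relative twisted differential as a map of presheaves of modules. -/
def nablaPre (k : ℕ) : omegaPre M k ⟶ omegaPre M (k + 1) :=
  PresheafOfModules.homMk
    { app := fun U => AddCommGrpCat.ofHom (nablaSec M k (unop U))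
      naturality := fun U V i => AddCommGrpCat.hom_ext (AddMonoidHom.ext fun φ => funext fun J =>
        (nablaSec_res M k i.unop.le φ J).symm) }
    (fun U r φ => nablaSec_smul M k (unop U) r φ)

theorem nablaPre_comp (k : ℕ) : nablaPre M k ≫ nablaPre M (k + 1) = 0 := by
  refine PresheafOfModules.hom_ext fun U => ModuleCat.hom_ext (LinearMap.ext fun φ => ?_)
  exact twistedD_twistedD (fun j => (BaseChange.nabla j : Module.End ℂ (BaseChange n
    (DSec Z (unop U)) (Push M (unop U)))).toAddMonoidHom)
    (fun i j x => BaseChange.nabla_comm i j x) k φ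

/-- The complex of presheaves of relative twisted forms. -/
def relDRPre : CochainComplex (PresheafOfModules.{0} (tensorPresheaf Z (RRing n))) ℕ :=
  CochainComplex.of (omegaPre M) (nablaPre M) (nablaPre_comp M)

instance : (PresheafOfModules.sheafification.{0} (toDD Z n)).Additive :=
  (PresheafOfModules.sheafificationAdjunction (toDD Z n)).left_adjoint_additive

/-- The relative twisted de Rham complex `(Ω^•(M), ∇_ω)`, a complex of modules over `DD`. -/
def relDR : CochainComplex (SheafOfModules.{0} (DD Z n)) ℕ :=
  ((PresheafOfModules.sheafification (toDD Z n)).mapHomologicalComplex _).obj (relDRPre M)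

end Main

end PartialMellin

end

noncomputable section

open CategoryTheory AlgebraicGeometry Opposite TopologicalSpace Limits
open scoped TensorProduct

namespace PartialMellin

/-! ### Exactness of the Koszul complex of commuting operators -/

section Koszul

variable {n : ℕ} {X : Type*} [AddCommGroup X]

/-! Fix an open set $U\subseteq Z$ and put $N=\Gamma(U\times T,M)$. Over $U$, the twisted forms are
the Koszul cochain complex of the commuting operators $\nabla_j=\partial_j+\nu_jx_j^{-1}$ on
$K\otimes_{\mathbb C}N$. The monomial $x_j/(x_1\cdots x_n)$ does not involve $x_j$, so $\partial_j$
commutes with it, and therefore $\nabla_j\circ\frac{x_j}{x_1\cdots x_n}=\frac{1}{x_1\cdots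
x_n}\circ(\nu_j+x_j\partial_j)$ (`nabla_mulX`). The generator $\nu_j$ of $R^{\mathrm{pol}}$ acts on
$N$ as $-x_j\partial_j$. Up to invertible factors, $\nabla_j$ is thus the operator
$\delta_j=\nu_j\otimes1-1\otimes\nu_j$ on $K\otimes_{\mathbb C}N$: the complex resolves the
restriction to the diagonal.

Two facts about the $\delta_j$ carry the theorem. Their images together span the kernel of
$K\otimes_{\mathbb C}N\to K\otimes_{\mathbb C[\nu]}N$ (`exists_eq_sum_diagOp`). They also form a
weakly regular sequence in any order: $\delta_a$ is injective modulo $\sum_{j\in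
S}\operatorname{im}\delta_j$ whenever $a\notin S$ (`diagOp_regular`). Over $\mathbb C[\nu]\otimes N$
the second fact is division with remainder. Since $s-t$ is monic in $s=\nu_a\otimes1$, taking the
quotient by $s-t$ is a left inverse of $\delta_a$, and it commutes with the other $\delta_j$
(`divDiag_diagOp_self`, `divDiag_diagOp`). Clearing denominators gives the statement over $K$.

Both facts transfer to the $\nabla_j$ (`nabla_regular`, `exists_eq_sum_nabla`). Regularity makes the
Koszul complex exact outside the top degree (`koszul_exact`). In degree $n$ the cohomology is the
cokernel $K\otimes_{\mathbb C}N/\sum_j\operatorname{im}\nabla_j$, which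
$\varphi\,dx_1\wedge\dots\wedge dx_n\mapsto x_1\cdots x_n\varphi$ (`topMap`) identifies with the
sections of the presheaf Mellin transform, linearly over $\Gamma(U,D_Z)\otimes R$ and compatibly
with restriction. Sheafification is an exact functor, so both conclusions pass from presheaves to
the associated sheaves. -/

/-- The Koszul differential of commuting operators, on cochains of all degrees at once. -/
def koszulD (D : Fin n → X →+ X) (e : Finset (Fin n) → X) (J : Finset (Fin n)) : X :=
  ∑ j ∈ J, wedgeSign J j • D j (e (J.erase j))

/-- Cochains on all subsets at once need no proofs about cardinalities, so the induction runs with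
`koszulD`; this identity carries the outcome back to forms of a fixed degree. -/
theorem koszulD_eq_twistedD (D : Fin n → X →+ X) {k : ℕ} (e : Finset (Fin n) → X)
    (J : {I : Finset (Fin n) // I.card = k + 1}) :
    koszulD D e J.1 = twistedD D k (fun I => e I.1) J := by
  rw [koszulD, ← Finset.sum_coe_sort]
  rfl

theorem koszulD_koszulD (D : Fin n → X →+ X) (hD : ∀ i j x, D i (D j x) = D j (D i x))
    (e : Finset (Fin n) → X) (J : Finset (Fin n)) : koszulD D (koszulD D e) J = 0 := by
  obtain h | h | ⟨k, h⟩ : J.card = 0 ∨ J.card = 1 ∨ ∃ k, J.card = k + 2 := by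
    rcases J.card with _ | _ | k
    · simp
    · simp
    · exact .inr (.inr ⟨k, rfl⟩)
  · rw [Finset.card_eq_zero] at h; subst h; rfl
  · obtain ⟨a, rfl⟩ := Finset.card_eq_one.mp h
    simp [koszulD]
  · rw [koszulD_eq_twistedD D _ ⟨J, h⟩]
    have : (fun I : {I : Finset (Fin n) // I.card = k + 1} => koszulD D e I.1) =
        twistedD D k (fun I => e I.1) := funext fun I => koszulD_eq_twistedD D e I
    rw [this, twistedD_twistedD D hD]; rfl

theorem koszulD_add (D : Fin n → X →+ X) (e f : Finset (Fin n) → X) (J : Finset (Fin n)) :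
    koszulD D (fun I => e I + f I) J = koszulD D e J + koszulD D f J := by
  simp [koszulD, Finset.sum_add_distrib]

theorem koszulD_sub (D : Fin n → X →+ X) (e f : Finset (Fin n) → X) (J : Finset (Fin n)) :
    koszulD D (fun I => e I - f I) J = koszulD D e J - koszulD D f J := by
  simp [koszulD, smul_sub]

theorem koszulD_congr (D : Fin n → X →+ X) {e f : Finset (Fin n) → X} {J : Finset (Fin n)}
    (h : ∀ j ∈ J, e (J.erase j) = f (J.erase j)) : koszulD D e J = koszulD D f J :=
  Finset.sum_congr rfl fun j hj => by rw [h j hj]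

/-- Because `a` exceeds every element of `J`, adding it changes no sign `wedgeSign J j` with `j ∈
J`. The complex on `insert a S` is thereby a mapping cone of `D a` on the complex on `S`. -/
theorem koszulD_insert (D : Fin n → X →+ X) (e : Finset (Fin n) → X) {J : Finset (Fin n)}
    {a : Fin n} (h : ∀ b ∈ J, b < a) : koszulD D e (insert a J) =
      wedgeSign (insert a J) a • D a (e J) + koszulD D (fun I => e (insert a I)) J := by
  have ha : a ∉ J := fun h' => lt_irrefl _ (h a h')
  rw [koszulD, Finset.sum_insert ha, Finset.erase_insert ha]
  congr 1
  refine Finset.sum_congr rfl fun j hj => ?_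
  have h1 : wedgeSign (insert a J) j = wedgeSign J j := by
    rw [wedgeSign, Finset.filter_insert, if_neg (h j hj).not_gt, wedgeSign]
  rw [h1, Finset.erase_insert_of_ne (h j hj).ne']

theorem wedgeSign_smul_smul (J : Finset (Fin n)) (j : Fin n) (x : X) :
    wedgeSign J j • wedgeSign J j • x = x := by
  rw [smul_smul, wedgeSign, ← mul_pow]; simp

/-- This describes the image of the last Koszul differential: the sets `S.erase j` are distinct for
distinct `j`, so the coefficients on them can be prescribed independently, with the signs absorbed.
-/
theorem exists_koszulD_eq_sum (D : Fin n → X →+ X) (S : Finset (Fin n)) (g : Fin n → X) :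
    ∃ ψ, koszulD D ψ S = ∑ j ∈ S, D j (g j) := by
  refine ⟨fun J => ∑ j ∈ S, if J = S.erase j then wedgeSign S j • g j else 0, ?_⟩
  refine Finset.sum_congr rfl fun j hj => ?_
  beta_reduce
  rw [Finset.sum_eq_single_of_mem j hj, if_pos rfl, map_zsmul, wedgeSign_smul_smul]
  intro i hi hij
  rw [if_neg]
  exact fun h => hij (Finset.erase_injOn S hj hi h).symm

/-- The Koszul cochain complex of a weakly regular sequence of commuting operators is exact
outside the top degree. -/
theorem koszul_exact (D : Fin n → X →+ X) (hD : ∀ i j x, D i (D j x) = D j (D i x))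
    (reg : ∀ (S : Finset (Fin n)) (a : Fin n), a ∉ S → ∀ (x : X) (f : Fin n → X),
      D a x = ∑ j ∈ S, D j (f j) → ∃ g : Fin n → X, x = ∑ j ∈ S, D j (g j))
    (S : Finset (Fin n)) : ∀ k < S.card, ∀ e : Finset (Fin n) → X,
      (∀ J ⊆ S, J.card = k + 1 → koszulD D e J = 0) →
        ∃ ψ, ∀ J ⊆ S, J.card = k → koszulD D ψ J = e J := by
  induction S using Finset.induction_on_max with
  | empty => intro k hk; simp at hk
  | insert a S ha ih =>
    intro k hk e he
    have haS : a ∉ S := fun h' => lt_irrefl _ (ha a h')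
    rw [Finset.card_insert_of_notMem haS] at hk
    -- A cocycle on `insert a S` is first corrected on the subsets that avoid `a`. Below the top
    -- degree of `S` this is induction; regularity enters only in the degree `k = S.card`.
    obtain ⟨ψ₁, hψ₁⟩ : ∃ ψ, ∀ J ⊆ S, J.card = k → koszulD D ψ J = e J := by
      rcases (Nat.lt_succ_iff.mp hk).lt_or_eq with hk | hk
      · exact ih k hk e fun J hJ hc => he J (hJ.trans (Finset.subset_insert a S)) hc
      -- The cocycle condition at `insert a S` says that `D a (e S)` lies in the sum of the images
      -- of the `D j`, `j ∈ S`. Regularity then puts `e S` itself there, and `S` is the only subset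
      -- of this degree to be treated.
      · have h := he _ subset_rfl (by rw [Finset.card_insert_of_notMem haS, hk])
        rw [koszulD_insert D e ha] at h
        have h' := congrArg (wedgeSign (insert a S) a • ·) h
        simp only [smul_add, wedgeSign_smul_smul, smul_zero] at h'
        obtain ⟨g, hg⟩ := reg S a haS (e S)
          (fun j => - (wedgeSign (insert a S) a • wedgeSign S j • e (insert a (S.erase j)))) (by
            rw [eq_neg_of_add_eq_zero_left h', koszulD, Finset.smul_sum, ← Finset.sum_neg_distrib]
            simp only [map_neg, map_zsmul])
        obtain ⟨ψ, hψ⟩ := exists_koszulD_eq_sum D S g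
        refine ⟨ψ, fun J hJ hc => ?_⟩
        obtain rfl := Finset.eq_of_subset_of_card_le hJ (by omega)
        rw [hψ, ← hg]
    rcases k with _ | k
    -- In degree `0` only the empty set occurs, and it avoids `a`.
    · refine ⟨ψ₁, fun J hJ hc => hψ₁ J ?_ hc⟩
      rw [Finset.card_eq_zero] at hc; subst hc; exact Finset.empty_subset _
    -- The corrected cochain lives only on sets containing `a`. Stripped of `a`, it is a cocycle on
    -- `S` of one degree less, so the induction hypothesis supplies a primitive `η`.
    let e' : Finset (Fin n) → X := fun I => e I - koszulD D ψ₁ I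
    have e'_zero : ∀ J ⊆ S, J.card = k + 1 → e' J = 0 := fun J hJ hc =>
      sub_eq_zero.mpr (hψ₁ J hJ hc).symm
    obtain ⟨η, hη⟩ := ih k (by omega) (fun I => e' (insert a I)) fun J hJ hc => by
      have h := koszulD_insert D e' fun b hb => ha b (hJ hb)
      rw [e'_zero J hJ hc, map_zero, smul_zero, zero_add] at h
      rw [← h, koszulD_sub D e, koszulD_koszulD D hD, sub_zero]
      exact he _ (Finset.insert_subset_insert a hJ) (by
        rw [Finset.card_insert_of_notMem fun h' => haS (hJ h'), hc])
    refine ⟨fun I => ψ₁ I + if a ∈ I then η (I.erase a) else 0, fun J hJ hc => ?_⟩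
    rw [koszulD_add]
    by_cases haJ : a ∈ J
    · obtain ⟨J, haJ', rfl⟩ : ∃ J', a ∉ J' ∧ insert a J' = J :=
        ⟨J.erase a, Finset.notMem_erase a J, Finset.insert_erase haJ⟩
      have hJS : J ⊆ S := (Finset.insert_subset_insert_iff haJ').mp hJ
      rw [Finset.card_insert_of_notMem haJ'] at hc
      rw [koszulD_insert D (fun I => if a ∈ I then η (I.erase a) else 0) fun b hb => ha b (hJS hb)]
      have h := hη J hJS (by omega)
      rw [if_neg haJ', map_zero, smul_zero, zero_add,
        koszulD_congr D (e := fun I => if a ∈ insert a I then η ((insert a I).erase a) else 0)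
          (f := η) (fun j hj => by
          have : a ∉ J.erase j := fun h' => haJ' (Finset.mem_of_mem_erase h')
          rw [if_pos (Finset.mem_insert_self _ _), Finset.erase_insert this]), h]
      simp [e']
    · have hJS : J ⊆ S := (Finset.subset_insert_iff_of_notMem haJ).mp hJ
      rw [koszulD_congr D (e := fun I => if a ∈ I then η (I.erase a) else 0) (f := fun _ => 0)
        (fun j hj => if_neg fun h' => haJ (Finset.mem_of_mem_erase h')), hψ₁ J hJS hc]
      simp [koszulD]

/-- Exactness of the complex of `Forms` outside the top degree, for a weakly regular sequence of
commuting operators. -/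
theorem exists_forms_primitive (D : Fin n → X →+ X) (hD : ∀ i j x, D i (D j x) = D j (D i x))
    (reg : ∀ (S : Finset (Fin n)) (a : Fin n), a ∉ S → ∀ (x : X) (f : Fin n → X),
      D a x = ∑ j ∈ S, D j (f j) → ∃ g : Fin n → X, x = ∑ j ∈ S, D j (g j))
    {k : ℕ} (hk : k < n) (φ : Forms n k X) (hφ : twistedD D k φ = 0) :
    ∃ ψ, ∀ J : {I : Finset (Fin n) // I.card = k}, koszulD D ψ J.1 = φ J := by
  let e : Finset (Fin n) → X := fun I => if h : I.card = k then φ ⟨I, h⟩ else 0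
  have he : (fun I : {I : Finset (Fin n) // I.card = k} => e I.1) = φ :=
    funext fun I => dif_pos I.2
  obtain ⟨ψ, hψ⟩ := koszul_exact D hD reg Finset.univ k (by simpa using hk) e fun J _ hJ => by
    rw [koszulD_eq_twistedD D e ⟨J, hJ⟩, he, hφ]; rfl
  exact ⟨ψ, fun J => (hψ J.1 (Finset.subset_univ _) J.2).trans (dif_pos J.2)⟩

theorem forms_exact (D : Fin n → X →+ X) (hD : ∀ i j x, D i (D j x) = D j (D i x))
    (reg : ∀ (S : Finset (Fin n)) (a : Fin n), a ∉ S → ∀ (x : X) (f : Fin n → X),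
      D a x = ∑ j ∈ S, D j (f j) → ∃ g : Fin n → X, x = ∑ j ∈ S, D j (g j))
    {k : ℕ} (hk : k + 1 < n) (φ : Forms n (k + 1) X) (hφ : twistedD D (k + 1) φ = 0) :
    ∃ ψ, twistedD D k ψ = φ := by
  obtain ⟨ψ, hψ⟩ := exists_forms_primitive D hD reg hk φ hφ
  exact ⟨fun I => ψ I.1, funext fun J => (koszulD_eq_twistedD D ψ J).symm.trans (hψ J)⟩

/-- At the empty set the Koszul differential is an empty sum, so having a primitive in degree `0`
means vanishing. This is exactness at the start of the complex, and it needs degree `0` not to be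
the top degree. -/
theorem forms_zero_injective (D : Fin n → X →+ X) (hD : ∀ i j x, D i (D j x) = D j (D i x))
    (reg : ∀ (S : Finset (Fin n)) (a : Fin n), a ∉ S → ∀ (x : X) (f : Fin n → X),
      D a x = ∑ j ∈ S, D j (f j) → ∃ g : Fin n → X, x = ∑ j ∈ S, D j (g j))
    (hn : 0 < n) (φ : Forms n 0 X) (hφ : twistedD D 0 φ = 0) : φ = 0 := by
  obtain ⟨ψ, hψ⟩ := exists_forms_primitive D hD reg hn φ hφ
  refine funext fun J => ?_
  obtain ⟨J, hJ⟩ := J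
  obtain rfl := Finset.card_eq_zero.mp hJ
  exact (hψ ⟨∅, hJ⟩).symm

end Koszul

/-! ### The operators `ν_j ⊗ 1 - 1 ⊗ ν_j` -/

section Diagonal

variable {n : ℕ} {N : Type*} [AddCommGroup N] [Module ℂ N]

theorem tensor_hom_ext {X : Type*} [AddCommGroup X] [Module ℂ X]
    {f g : ParamRing n ⊗[ℂ] N →ₗ[ℂ] X}
    (h : ∀ (m : Fin n →₀ ℕ) (x : N), f (MvPolynomial.monomial m 1 ⊗ₜ x) =
      g (MvPolynomial.monomial m 1 ⊗ₜ x)) : f = g := by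
  refine TensorProduct.ext ((MvPolynomial.basisMonomials (Fin n) ℂ).ext fun m => ?_)
  exact LinearMap.ext fun x => by simpa using h m x

variable (N) in
/-- The map `ℂ[ν] ⊗_ℂ N → K ⊗_ℂ N`. -/
def toFieldTensor : ParamRing n ⊗[ℂ] N →ₗ[ParamRing n] ParamField n ⊗[ℂ] N :=
  TensorProduct.AlgebraTensorModule.map (Algebra.linearMap (ParamRing n) (ParamField n))
    LinearMap.id

theorem toFieldTensor_tmul (p : ParamRing n) (x : N) :
    toFieldTensor N (p ⊗ₜ x) = algebraMap _ (ParamField n) p ⊗ₜ x := rfl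

/-- The module `N` is flat over the field `ℂ`, so the inclusion of `ℂ[ν]` in `K` stays injective
after tensoring. -/
theorem toFieldTensor_injective : Function.Injective (toFieldTensor (n := n) N) := by
  have : Function.Injective (LinearMap.rTensor N
      ((Algebra.linearMap (ParamRing n) (ParamField n)).restrictScalars ℂ)) :=
    Module.Flat.rTensor_preserves_injective_linearMap _
      (IsFractionRing.injective (ParamRing n) (ParamField n))
  exact this

theorem exists_smul_eq_toFieldTensor (z : ParamField n ⊗[ℂ] N) :
    ∃ s : ParamRing n, s ≠ 0 ∧ ∃ z₀, s • z = toFieldTensor N z₀ := by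
  induction z with
  | zero => exact ⟨1, one_ne_zero, 0, by simp⟩
  | add x y hx hy =>
    obtain ⟨s, hs, x₀, hx⟩ := hx
    obtain ⟨t, ht, y₀, hy⟩ := hy
    refine ⟨s * t, mul_ne_zero hs ht, t • x₀ + s • y₀, ?_⟩
    rw [map_add, map_smul, map_smul, ← hx, ← hy, smul_add, smul_smul, smul_smul, mul_comm t s]
  | tmul a x =>
    obtain ⟨⟨p, s⟩, h⟩ := IsLocalization.surj (nonZeroDivisors (ParamRing n)) a
    refine ⟨s, nonZeroDivisors.ne_zero s.2, p ⊗ₜ x, ?_⟩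
    rw [toFieldTensor_tmul, TensorProduct.smul_tmul', Algebra.smul_def, mul_comm]
    exact congrArg (· ⊗ₜ x) h

/-- The common denominator is the product of the individual ones; each numerator is multiplied by
the remaining denominators. -/
theorem exists_smul_eq_toFieldTensor_finset (S : Finset (Fin n))
    (f : Fin n → ParamField n ⊗[ℂ] N) : ∃ s : ParamRing n, s ≠ 0 ∧
      ∃ f₀ : Fin n → ParamRing n ⊗[ℂ] N, ∀ j ∈ S, s • f j = toFieldTensor N (f₀ j) := by
  choose s hs f₀ hf using fun j => exists_smul_eq_toFieldTensor (f j)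
  refine ⟨∏ j ∈ S, s j, Finset.prod_ne_zero_iff.mpr fun j _ => hs j,
    fun j => (∏ i ∈ S.erase j, s i) • f₀ j, fun j hj => ?_⟩
  rw [map_smul, ← hf, smul_smul, Finset.prod_erase_mul _ _ hj]

variable (A : Type*) [CommRing A] [Algebra ℂ A] [Algebra (ParamRing n) A]
  [Module (ParamRing n) N] [IsScalarTower ℂ (ParamRing n) N]

/-- The operator `ν_j ⊗ 1 - 1 ⊗ ν_j` on `A ⊗_ℂ N`. -/
def diagOp (j : Fin n) : A ⊗[ℂ] N →ₗ[A] A ⊗[ℂ] N :=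
  algebraMap (ParamRing n) A (MvPolynomial.X j) • LinearMap.id -
    (Algebra.lsmul ℂ ℂ N (MvPolynomial.X j : ParamRing n)).baseChange A

variable {A}

theorem diagOp_tmul (j : Fin n) (a : A) (x : N) : diagOp A j (a ⊗ₜ[ℂ] x) =
    (algebraMap (ParamRing n) A (MvPolynomial.X j) * a) ⊗ₜ x -
      a ⊗ₜ ((MvPolynomial.X j : ParamRing n) • x) := rfl

variable (N) in
/-- Division of `p ⊗ x` by `ν_a ⊗ 1 - 1 ⊗ ν_a`. -/
def divDiag (a : Fin n) : ParamRing n ⊗[ℂ] N →ₗ[ℂ] ParamRing n ⊗[ℂ] N :=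
  TensorProduct.lift ((MvPolynomial.basisMonomials (Fin n) ℂ).constr ℂ fun m =>
    ∑ b ∈ Finset.range (m a),
      TensorProduct.mk ℂ (ParamRing n) N
        (MvPolynomial.monomial (m - Finsupp.single a (b + 1)) 1) ∘ₗ
          Algebra.lsmul ℂ ℂ N ((MvPolynomial.X a : ParamRing n) ^ b))

theorem divDiag_tmul (a : Fin n) (m : Fin n →₀ ℕ) (x : N) :
    divDiag N a (MvPolynomial.monomial m 1 ⊗ₜ x) = ∑ b ∈ Finset.range (m a),
      MvPolynomial.monomial (m - Finsupp.single a (b + 1)) 1 ⊗ₜ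
        ((MvPolynomial.X a : ParamRing n) ^ b • x) := by
  have h := (MvPolynomial.basisMonomials (Fin n) ℂ).constr_basis ℂ (fun m =>
    ∑ b ∈ Finset.range (m a),
      TensorProduct.mk ℂ (ParamRing n) N
        (MvPolynomial.monomial (m - Finsupp.single a (b + 1)) 1) ∘ₗ
          Algebra.lsmul ℂ ℂ N ((MvPolynomial.X a : ParamRing n) ^ b)) m
  rw [MvPolynomial.coe_basisMonomials] at h
  rw [divDiag, TensorProduct.lift.tmul, h, LinearMap.sum_apply]
  rfl

theorem X_mul_monomial (j : Fin n) (m : Fin n →₀ ℕ) :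
    (MvPolynomial.X j : ParamRing n) * MvPolynomial.monomial m 1 =
      MvPolynomial.monomial (m + Finsupp.single j 1) 1 := by
  rw [MvPolynomial.X, MvPolynomial.monomial_mul, one_mul, add_comm]

/-- With $s=\nu_a\otimes1$ and $t=1\otimes\nu_a$, division sends $s^Mu$, for $u$ free of $s$, to
$\sum_{b<M}s^{M-1-b}t^bu$. Applied to $(s-t)s^Mu$ this gives $\sum_{b\le
M}s^{M-b}t^bu-\sum_{b<M}s^{M-1-b}t^{b+1}u$, which telescopes to $s^Mu$. -/
theorem divDiag_diagOp_self (a : Fin n) (z : ParamRing n ⊗[ℂ] N) :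
    divDiag N a (diagOp (ParamRing n) a z) = z := by
  suffices h : divDiag N a ∘ₗ (diagOp (ParamRing n) a).restrictScalars ℂ = LinearMap.id from
    LinearMap.congr_fun h z
  refine tensor_hom_ext fun m x => ?_
  simp only [LinearMap.comp_apply, LinearMap.restrictScalars_apply, diagOp_tmul, map_sub,
    LinearMap.id_apply, Algebra.algebraMap_self, RingHom.id_apply]
  -- Splitting off the term `b = 0` of the longer sum isolates the monomial itself; the other terms
  -- cancel in pairs after the shift of `b`.
  rw [X_mul_monomial, divDiag_tmul, divDiag_tmul, Finsupp.add_apply, Finsupp.single_eq_same,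
    Finset.sum_range_succ', pow_zero, one_smul, zero_add, add_tsub_cancel_right, add_comm,
    add_sub_assoc, ← Finset.sum_sub_distrib, Finset.sum_eq_zero, add_zero]
  intro b _
  rw [pow_succ, mul_smul, sub_eq_zero]
  rw [Finsupp.single_add, add_tsub_add_eq_tsub_right]

/-- Division by $\nu_a\otimes1-1\otimes\nu_a$ changes only the exponent of $\nu_a$ on the left and
multiplies by powers of $\nu_a$ on the right. Both operations commute with $\nu_j$ for $j\ne a$. -/
theorem divDiag_diagOp {a j : Fin n} (h : j ≠ a) (z : ParamRing n ⊗[ℂ] N) :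
    divDiag N a (diagOp (ParamRing n) j z) = diagOp (ParamRing n) j (divDiag N a z) := by
  suffices h' : divDiag N a ∘ₗ (diagOp (ParamRing n) j).restrictScalars ℂ =
    (diagOp (ParamRing n) j).restrictScalars ℂ ∘ₗ divDiag N a from LinearMap.congr_fun h' z
  refine tensor_hom_ext fun m x => ?_
  simp only [LinearMap.comp_apply, LinearMap.restrictScalars_apply, diagOp_tmul, map_sub,
    Algebra.algebraMap_self, RingHom.id_apply]
  rw [X_mul_monomial, divDiag_tmul, divDiag_tmul, divDiag_tmul, map_sum, Finsupp.add_apply,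
    Finsupp.single_eq_of_ne h.symm, add_zero, ← Finset.sum_sub_distrib]
  refine Finset.sum_congr rfl fun b _ => ?_
  rw [diagOp_tmul, Algebra.algebraMap_self, RingHom.id_apply, X_mul_monomial, smul_smul, smul_smul,
    mul_comm (MvPolynomial.X j)]
  -- The subtraction of exponents is truncated, so this exchange uses that `j` and `a` are different
  -- coordinates.
  have e : m + Finsupp.single j 1 - Finsupp.single a (b + 1) =
      m - Finsupp.single a (b + 1) + Finsupp.single j 1 := by
    ext i
    simp only [Finsupp.tsub_apply, Finsupp.add_apply, Finsupp.single_apply]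
    split_ifs with h1 h2
    · exact absurd (h1.trans h2.symm) h
    all_goals omega
  rw [e]

/-- The operators `ν_j ⊗ 1 - 1 ⊗ ν_j` form a weakly regular sequence on `ℂ[ν] ⊗_ℂ N`. -/
theorem diagOp_regular_polynomial {S : Finset (Fin n)} {a : Fin n} (ha : a ∉ S)
    (x : ParamRing n ⊗[ℂ] N) (f : Fin n → ParamRing n ⊗[ℂ] N)
    (h : diagOp (ParamRing n) a x = ∑ j ∈ S, diagOp (ParamRing n) j (f j)) :
    x = ∑ j ∈ S, diagOp (ParamRing n) j (divDiag N a (f j)) := by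
  -- Dividing the relation by the `a`-th operator leaves `x` on the left and passes through the
  -- other operators on the right.
  rw [← divDiag_diagOp_self a x, h, map_sum]
  exact Finset.sum_congr rfl fun j hj => divDiag_diagOp (ne_of_mem_of_not_mem hj ha) _

theorem diagOp_toFieldTensor (j : Fin n) (z : ParamRing n ⊗[ℂ] N) :
    diagOp (ParamField n) j (toFieldTensor N z) = toFieldTensor N (diagOp (ParamRing n) j z) := by
  induction z with
  | zero => simp only [map_zero]
  | add x y hx hy => simp only [map_add, hx, hy]
  | tmul p x =>
    rw [diagOp_tmul, map_sub, toFieldTensor_tmul, toFieldTensor_tmul, toFieldTensor_tmul,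
      diagOp_tmul, Algebra.algebraMap_self, RingHom.id_apply, map_mul]

theorem diagOp_smul (j : Fin n) (p : ParamRing n) (z : ParamField n ⊗[ℂ] N) :
    diagOp (ParamField n) j (p • z) = p • diagOp (ParamField n) j z :=
  ((diagOp (N := N) (ParamField n) j).restrictScalars (ParamRing n)).map_smul p z

/-- The operators `ν_j ⊗ 1 - 1 ⊗ ν_j` form a weakly regular sequence on `K ⊗_ℂ N`. -/
theorem diagOp_regular {S : Finset (Fin n)} {a : Fin n} (ha : a ∉ S)
    (x : ParamField n ⊗[ℂ] N) (f : Fin n → ParamField n ⊗[ℂ] N)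
    (h : diagOp (ParamField n) a x = ∑ j ∈ S, diagOp (ParamField n) j (f j)) :
    ∃ g : Fin n → ParamField n ⊗[ℂ] N, x = ∑ j ∈ S, diagOp (ParamField n) j (g j) := by
  obtain ⟨s, hs, x₀, hx⟩ := exists_smul_eq_toFieldTensor x
  obtain ⟨t, ht, f₀, hf⟩ := exists_smul_eq_toFieldTensor_finset S f
  -- After multiplication by `t * s`, every term comes from `ℂ[ν] ⊗ N`. By injectivity the relation
  -- already holds there, where division applies.
  have key := diagOp_regular_polynomial ha (t • x₀) (fun j => s • f₀ j) <| by
    apply toFieldTensor_injective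
    rw [← diagOp_toFieldTensor, map_smul, ← hx, smul_smul, diagOp_smul, h, map_sum,
      Finset.smul_sum]
    refine Finset.sum_congr rfl fun j hj => ?_
    rw [← diagOp_toFieldTensor, map_smul, ← hf j hj, smul_smul, diagOp_smul, mul_comm]
  have hts : algebraMap (ParamRing n) (ParamField n) (t * s) ≠ 0 :=
    fun h0 => mul_ne_zero ht hs
      ((IsFractionRing.injective (ParamRing n) (ParamField n)) (h0.trans (map_zero _).symm))
  -- The operators are `K`-linear, so the denominator `t * s` can be divided out again.
  refine ⟨fun j => (algebraMap (ParamRing n) (ParamField n) (t * s))⁻¹ •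
    toFieldTensor N (divDiag N a (s • f₀ j)), ?_⟩
  have key' := congrArg (toFieldTensor N) key
  rw [map_smul, ← hx, smul_smul, ← algebraMap_smul (ParamField n)] at key'
  simp only [map_smul (diagOp (N := N) (ParamField n) _), ← Finset.smul_sum, diagOp_toFieldTensor,
    ← map_sum]
  rw [← key', inv_smul_smul₀ hts]

/-- The kernel of `A ⊗_ℂ N → A ⊗_{ℂ[ν]} N` is generated by the images of the operators
`ν_j ⊗ 1 - 1 ⊗ ν_j`. -/
theorem exists_eq_sum_diagOp [IsScalarTower ℂ (ParamRing n) A]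
    (q : A ⊗[ℂ] N →+ A ⊗[ParamRing n] N) (hq : ∀ a x, q (a ⊗ₜ[ℂ] x) = a ⊗ₜ[ParamRing n] x)
    (z : A ⊗[ℂ] N) (hz : q z = 0) : ∃ f : Fin n → A ⊗[ℂ] N, z = ∑ j, diagOp A j (f j) := by
  let W : Submodule A (A ⊗[ℂ] N) :=
    LinearMap.range (∑ j : Fin n, diagOp (N := N) A j ∘ₗ LinearMap.proj (R := A) (φ := fun _ => A ⊗[ℂ] N) j)
  have hW : ∀ j w, diagOp A j w ∈ W := fun j w => ⟨Pi.single j w, by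
    rw [LinearMap.sum_apply, Finset.sum_eq_single_of_mem j (Finset.mem_univ j)]
    · simp
    · intro i _ hij; simp [Pi.single_eq_of_ne hij]⟩
  -- Modulo `W` each variable may be moved across the tensor sign, since the difference is a value
  -- of `diagOp`. Induction on the polynomial extends this to all of `ℂ[ν]`.
  have bal : ∀ (p : ParamRing n) (a : A) (x : N),
      W.mkQ ((p • a) ⊗ₜ x) = W.mkQ (a ⊗ₜ (p • x)) := by
    intro p
    induction p using MvPolynomial.induction_on with
    | C c =>
      intro a x
      rw [← MvPolynomial.algebraMap_eq, algebraMap_smul, algebraMap_smul, TensorProduct.smul_tmul]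
    | add p q hp hq =>
      intro a x
      rw [add_smul, add_smul, TensorProduct.add_tmul, TensorProduct.tmul_add, map_add, map_add, hp,
        hq]
    | mul_X p j hp =>
      intro a x
      have h : (p * MvPolynomial.X j : ParamRing n) • x =
          (MvPolynomial.X j : ParamRing n) • p • x := by rw [smul_smul, mul_comm]
      rw [mul_smul, hp, h, ← sub_eq_zero, ← map_sub, Submodule.mkQ_apply,
        Submodule.Quotient.mk_eq_zero, Algebra.smul_def, ← diagOp_tmul]
      exact hW j _
  -- Balancedness lets the quotient map by `W` factor through `q`, so the kernel of `q` is contained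
  -- in `W`.
  let θ : A ⊗[ParamRing n] N →+ (A ⊗[ℂ] N) ⧸ W :=
    TensorProduct.liftAddHom (AddMonoidHom.mk' (fun a => AddMonoidHom.mk'
      (fun x => W.mkQ (a ⊗ₜ x)) fun x y => by rw [TensorProduct.tmul_add, map_add])
      fun a b => AddMonoidHom.ext fun x => by simp [TensorProduct.add_tmul]) bal
  have hθ : ∀ w, θ (q w) = W.mkQ w := fun w => by
    induction w with
    | zero => simp only [map_zero]
    | add x y hx hy => simp only [map_add, hx, hy]
    | tmul a x => rw [hq]; rfl
  have := hθ z
  rw [hz, map_zero, eq_comm, Submodule.mkQ_apply, Submodule.Quotient.mk_eq_zero] at this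
  obtain ⟨f, hf⟩ := this
  exact ⟨f, by rw [← hf, LinearMap.sum_apply]; rfl⟩

theorem tensor_diagOp_eq_zero (q : A ⊗[ℂ] N →+ A ⊗[ParamRing n] N)
    (hq : ∀ a x, q (a ⊗ₜ[ℂ] x) = a ⊗ₜ[ParamRing n] x) (j : Fin n) (z : A ⊗[ℂ] N) :
    q (diagOp A j z) = 0 := by
  induction z with
  | zero => simp only [map_zero]
  | add x y hx hy => rw [map_add, map_add, hx, hy, add_zero]
  | tmul a x => rw [diagOp_tmul, map_sub, hq, hq, ← Algebra.smul_def, TensorProduct.smul_tmul,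
      sub_self]

end Diagonal

/-! ### The isomorphism `𝔐` on generators -/

theorem mellinTorus_gen {n : ℕ} (g : RGen n) :
    mellinTorus n (Rpol.gen g) = mellinGen TorusOp.x TorusOp.pd g := by
  rw [mellinTorus, mellinLift, Rpol.lift_gen]

theorem mellinTorus_nu {n : ℕ} (j : Fin n) : mellinTorus n (Rpol.nu n (MvPolynomial.X j)) =
    - (TorusOp.x (unitVec j) * TorusOp.pd j) := by
  rw [Rpol.nu_X, mellinTorus_gen]; rfl

/-- The locus where two homomorphisms out of a group agree is a subgroup, and the unit vectors
generate `ℤⁿ`. -/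
theorem lattice_hom_ext {n : ℕ} {A : Type*} [Monoid A] {f g : Lattice n →* A}
    (h : ∀ i, f (unitVec i) = g (unitVec i)) : f = g := by
  suffices h' : ∀ m, m ∈ f.eqLocus g from MonoidHom.ext h'
  intro m
  rw [← Finset.univ_prod_mulSingle m]
  refine Subgroup.prod_mem _ fun i _ => ?_
  have : Pi.mulSingle i (m i) = (unitVec i : Lattice n) ^ (m i).toAdd := by
    rw [unitVec, ← Pi.mulSingle_zpow, ← ofAdd_zsmul]; simp
  rw [this]
  exact Subgroup.zpow_mem _ (h i) _

/-- The action of $\sigma^m$ is defined through `Rpol.sigma` on the Mellin side and through the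
monomial $x^m$ on the de Rham side; this identifies the two. -/
theorem mellinTorus_sigma {n : ℕ} (m : Lattice n) :
    mellinTorus n (Rpol.sigma n m : Rpol n) = TorusOp.x m := by
  let f : Lattice n →* TorusOp n :=
    ((mellinTorus n : Rpol n →* TorusOp n).comp (Units.coeHom (Rpol n))).comp (Rpol.sigma n)
  let g : Lattice n →* TorusOp n := ⟨⟨TorusOp.x, TorusOp.x_one⟩, TorusOp.x_mul⟩
  have : f = g := lattice_hom_ext fun i => by
    change mellinTorus n (Rpol.sigma n (unitVec i) : Rpol n) = TorusOp.x (unitVec i)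
    rw [Rpol.sigma_unitVec]
    exact mellinTorus_gen (.sig i)
  exact DFunLike.congr_fun this m

/-- Exponents are written multiplicatively, so `m j = 1` means that $x_j$ does not occur in $x^m$,
and $\partial_jx^m=0$. -/
theorem TorusOp.pd_x_of_eq_one {n : ℕ} {j : Fin n} {m : Lattice n} (h : m j = 1) :
    TorusOp.pd j * TorusOp.x m = TorusOp.x m * TorusOp.pd j := by
  have := TorusOp.pd_x j m
  rw [h, toAdd_one, Int.cast_zero] at this
  exact this.trans ((congrArg _ (zero_smul ℂ _)).trans (add_zero _))

/-- The exponent of the monomial `x_1 ⋯ x_n`. -/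
def oneVec (n : ℕ) : Lattice n := fun _ => Multiplicative.ofAdd 1

/-- The monomial $x_j/(x_1\cdots x_n)$ is free of $x_j$. It is the factor that turns $\nabla_j$ into
$\nu_j\otimes1-1\otimes\nu_j$. -/
theorem unitVec_mul_oneVec_inv {n : ℕ} (j : Fin n) : (unitVec j * (oneVec n)⁻¹) j = 1 := by
  simp [unitVec, oneVec]

section Compatible

variable {n : ℕ} {D : Type*} [Ring D] [Algebra ℂ D] {N : Type*} [AddCommGroup N]
  [Module (D ⊗[ℂ] TorusOp n) N] [Module (D ⊗[ℂ] Rpol n) N]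

variable (n D N) in
/-- The action of `R^pol` on `N` is induced by the action of `Γ(T, D_T)` through `𝔐`. -/
def MellinCompatible : Prop := ∀ (r : D ⊗[ℂ] Rpol n) (x : N),
  r • x = Algebra.TensorProduct.map (AlgHom.id ℂ D) (mellinTorus n) r • x

/-- Complex scalars reach `N` both through $\Gamma(T,D_T)$ and through $\mathbb C[\nu]\subset
R^{\mathrm{pol}}$. Their agreement is what makes $K\otimes_{\mathbb C[\nu]}N$ a quotient of
$K\otimes_{\mathbb C}N$. -/
theorem algebraMap_smul_eq_nu_smul (hN : MellinCompatible n D N) (c : ℂ)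
    (x : N) : algebraMap ℂ (D ⊗[ℂ] TorusOp n) c • x =
      (1 ⊗ₜ[ℂ] Rpol.nu n (algebraMap ℂ _ c) : D ⊗[ℂ] Rpol n) • x := by
  rw [hN, Algebra.TensorProduct.map_tmul, map_one, AlgHom.commutes, AlgHom.commutes]
  exact congrArg (· • x)
    ((Algebra.TensorProduct.includeRight : TorusOp n →ₐ[ℂ] D ⊗[ℂ] TorusOp n).commutes c).symm

theorem nuModule_isScalarTower (hN : MellinCompatible n D N) :
    letI := complexModule n D N
    letI := nuModule n D N
    IsScalarTower ℂ (ParamRing n) N :=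
  letI := complexModule n D N
  letI := nuModule n D N
  .of_algebraMap_smul fun c x => (algebraMap_smul_eq_nu_smul hN c x).symm

end Compatible

/-! ### The operators $\nabla_j$ on $K\otimes_{\mathbb C}N$: regularity and cokernel -/

namespace BaseChange

variable {n : ℕ} {D : Type*} [Ring D] [Algebra ℂ D] {N : Type*} [AddCommGroup N]
  [Module (D ⊗[ℂ] TorusOp n) N]

variable (D N) in
/-- Multiplication by `x^m` on `K ⊗_ℂ N`, without shift of the parameters. -/
def mulX (m : Lattice n) : BaseChange n D N →+ BaseChange n D N :=
  (opr 1 (1 ⊗ₜ TorusOp.x m) : Module.End ℂ (BaseChange n D N)).toAddMonoidHom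

theorem mulX_tmul (m : Lattice n) (a : ParamField n) (x : N) :
    mulX D N m (tmul D a x) = tmul D a ((1 ⊗ₜ TorusOp.x m : D ⊗[ℂ] TorusOp n) • x) := by
  change tmul D (shiftField n 1 a) _ = _
  rw [map_one]; rfl

theorem mulX_mulX (m l : Lattice n) (z : BaseChange n D N) :
    mulX D N m (mulX D N l z) = mulX D N (m * l) z := by
  refine (LinearMap.congr_fun (opr_mul (N := N) 1 1 (1 ⊗ₜ[ℂ] TorusOp.x m : D ⊗[ℂ] TorusOp n)
    (1 ⊗ₜ TorusOp.x l)) z).symm.trans ?_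
  rw [Algebra.TensorProduct.tmul_mul_tmul, ← TorusOp.x_mul, one_mul, one_mul]; rfl

theorem mulX_one (z : BaseChange n D N) : mulX D N 1 z = z := by
  change opr 1 (1 ⊗ₜ TorusOp.x 1) z = z
  rw [TorusOp.x_one, ← Algebra.TensorProduct.one_def, opr_one]; rfl

/-- Monomials free of $x_j$ commute with $\partial_j$, and all monomials commute with
$\nu_jx_j^{-1}$ because `mulX` does not shift the parameters. -/
theorem mulX_nabla {m : Lattice n} {j : Fin n} (h : m j = 1) (z : BaseChange n D N) :
    mulX D N m (nabla j z) = nabla j (mulX D N m z) := by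
  induction z using induction_on with
  | add x y hx hy => rw [map_add, map_add, hx, hy, map_add, map_add]
  | tmul a x =>
    simp only [nabla_tmul, mulX_tmul, map_add, smul_smul, Algebra.TensorProduct.tmul_mul_tmul,
      one_mul]
    rw [TorusOp.pd_x_of_eq_one h, ← TorusOp.x_mul, ← TorusOp.x_mul, mul_comm m]

theorem tmul_neg (a : ParamField n) (x : N) : tmul D a (-x) = -tmul D a x :=
  map_neg (AddMonoidHom.mk' (tmul D a) (tmul_add a)) x

theorem exists_mulX (m : Lattice n) (z : BaseChange n D N) : ∃ w, mulX D N m w = z :=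
  ⟨mulX D N m⁻¹ z, by rw [mulX_mulX, mul_inv_cancel, mulX_one]⟩

theorem mulX_injective (m : Lattice n) : Function.Injective (mulX D N m) := fun z w h => by
  rw [← mulX_one z, ← mulX_one w, ← inv_mul_cancel m, ← mulX_mulX, h, mulX_mulX]

variable [Module (D ⊗[ℂ] Rpol n) N]

variable (hN : MellinCompatible n D N)

/-- The operator `ν_j ⊗ 1 - 1 ⊗ ν_j` on `K ⊗_ℂ N`. -/
def diag (j : Fin n) : BaseChange n D N →+ BaseChange n D N :=
  letI := complexModule n D N
  letI := nuModule n D N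
  haveI := nuModule_isScalarTower hN
  (diagOp (N := N) (ParamField n) j).toAddMonoidHom

theorem diag_tmul (j : Fin n) (a : ParamField n) (x : N) : diag hN j (tmul D a x) =
    tmul D (algebraMap (ParamRing n) (ParamField n) (MvPolynomial.X j) * a) x -
      tmul D a ((1 ⊗ₜ Rpol.nu n (MvPolynomial.X j) : D ⊗[ℂ] Rpol n) • x) := rfl

theorem diag_regular (S : Finset (Fin n)) (a : Fin n) (ha : a ∉ S) (x : BaseChange n D N)
    (f : Fin n → BaseChange n D N) (h : diag hN a x = ∑ j ∈ S, diag hN j (f j)) :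
    ∃ g : Fin n → BaseChange n D N, x = ∑ j ∈ S, diag hN j (g j) :=
  letI := complexModule n D N
  letI := nuModule n D N
  haveI := nuModule_isScalarTower hN
  diagOp_regular (N := N) ha x f h

/-- The canonical map `K ⊗_ℂ N → K ⊗_{ℂ[ν]} N`. -/
def proj : BaseChange n D N →+ MellinLoc n D N :=
  lift (AddMonoidHom.mk' (fun a => AddMonoidHom.mk' (fun x => MellinLoc.tmul D a x)
    (fun x y => MellinLoc.tmul_add a x y))
    (fun a b => AddMonoidHom.ext fun x => MellinLoc.add_tmul a b x))
    (fun c a x => by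
      change MellinLoc.tmul D (c • a) x = MellinLoc.tmul D a _
      rw [algebraMap_smul_eq_nu_smul hN, MellinLoc.tmul_nu, ← IsScalarTower.algebraMap_apply,
        Algebra.smul_def])

theorem proj_tmul (a : ParamField n) (x : N) : proj hN (tmul D a x) = MellinLoc.tmul D a x := rfl

theorem proj_diag (j : Fin n) (z : BaseChange n D N) : proj hN (diag hN j z) = 0 :=
  letI := complexModule n D N
  letI := nuModule n D N
  haveI := nuModule_isScalarTower hN
  tensor_diagOp_eq_zero (N := N) (A := ParamField n) (proj hN) (fun _ _ => rfl) j z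

theorem exists_eq_sum_diag (z : BaseChange n D N) (hz : proj hN z = 0) :
    ∃ f : Fin n → BaseChange n D N, z = ∑ j, diag hN j (f j) :=
  letI := complexModule n D N
  letI := nuModule n D N
  haveI := nuModule_isScalarTower hN
  exists_eq_sum_diagOp (N := N) (A := ParamField n) (proj hN) (fun _ _ => rfl) z hz

/-- Conjugation of `∇_j` with `ν_j ⊗ 1 - 1 ⊗ ν_j`. -/
theorem nabla_mulX (j : Fin n) (z : BaseChange n D N) :
    nabla j (mulX D N (unitVec j * (oneVec n)⁻¹) z) = mulX D N (oneVec n)⁻¹ (diag hN j z) := by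
  induction z using induction_on with
  | add x y hx hy => simp only [map_add, hx, hy]
  | tmul a x =>
    simp only [nabla_tmul, mulX_tmul, diag_tmul, map_sub, smul_smul,
      Algebra.TensorProduct.tmul_mul_tmul, one_mul]
    -- The derivative passes through $x_j/(x_1\cdots x_n)$, leaving $x_j\partial_j$, and
    -- $-x_j\partial_j$ is the action of $\nu_j$ on `N`.
    rw [TorusOp.pd_x_of_eq_one (unitVec_mul_oneVec_inv j), ← TorusOp.x_mul, inv_mul_cancel_left,
      hN, Algebra.TensorProduct.map_tmul, mellinTorus_nu, smul_smul,
      Algebra.TensorProduct.tmul_mul_tmul, map_one, one_mul, mul_neg, ← mul_assoc, ← TorusOp.x_mul,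
      mul_comm (oneVec n)⁻¹, TensorProduct.tmul_neg, neg_smul, tmul_neg, sub_neg_eq_add, add_comm]

/-- The operators `∇_j` form a weakly regular sequence on `K ⊗_ℂ N`. -/
theorem nabla_regular (hN : MellinCompatible n D N) (S : Finset (Fin n)) (a : Fin n) (ha : a ∉ S) (x : BaseChange n D N)
    (f : Fin n → BaseChange n D N) (h : nabla a x = ∑ j ∈ S, nabla j (f j)) :
    ∃ g : Fin n → BaseChange n D N, x = ∑ j ∈ S, nabla j (g j) := by
  -- Each argument of some $\nabla_j$ is written as $x_j/(x_1\cdots x_n)$ times an element. The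
  -- relation then acquires the common factor $(x_1\cdots x_n)^{-1}$, and cancelling it leaves a
  -- relation between the diagonal operators.
  obtain ⟨x, rfl⟩ := exists_mulX (unitVec a * (oneVec n)⁻¹) x
  choose f' hf using fun j => exists_mulX (unitVec j * (oneVec n)⁻¹) (f j)
  obtain rfl : (fun j => mulX D N _ (f' j)) = f := funext hf
  simp only [nabla_mulX hN, ← map_sum] at h
  obtain ⟨g, rfl⟩ := diag_regular hN S a ha x f' (mulX_injective _ h)
  -- The original element is $x_a$ times a sum of values of the $\nabla_j$, $j\in S$. The factor
  -- $x_a$ moves inside each $\nabla_j$ because $j\ne a$.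
  refine ⟨fun j => mulX D N (unitVec a) (mulX D N (unitVec j * (oneVec n)⁻¹) (g j)), ?_⟩
  rw [← mulX_mulX, map_sum, map_sum]
  refine Finset.sum_congr rfl fun j hj => ?_
  rw [← nabla_mulX hN, mulX_nabla]
  exact Pi.mulSingle_eq_of_ne (ne_of_mem_of_not_mem hj ha) _

/-- The map `K ⊗_ℂ N → K ⊗_{ℂ[ν]} N`, `a ⊗ y ↦ a ⊗ x_1 ⋯ x_n y`. -/
def topMap : BaseChange n D N →+ MellinLoc n D N := (proj hN).comp (mulX D N (oneVec n))

theorem topMap_apply (z : BaseChange n D N) :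
    topMap hN z = proj hN (mulX D N (oneVec n) z) := rfl

theorem topMap_tmul (a : ParamField n) (x : N) : topMap hN (tmul D a x) =
    MellinLoc.tmul D a ((1 ⊗ₜ TorusOp.x (oneVec n) : D ⊗[ℂ] TorusOp n) • x) := by
  rw [topMap_apply, mulX_tmul, proj_tmul]

/-- The factor $x_1\cdots x_n$ commutes with $D$, with `K` and with the monomials. On both sides
$\sigma^m$ shifts the parameters by $m$ and multiplies by $x^m$. -/
theorem topMap_smul (r : D ⊗[ℂ] RRing n) (z : BaseChange n D N) :
    topMap hN (r • z) = r • topMap hN z := by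
  induction r using tensor_induction with
  | zero => rw [zero_smul, zero_smul, map_zero]
  | add r s hr hs => rw [add_smul, map_add, hr, hs, add_smul]
  | single p m c =>
    induction z using induction_on with
    | add x y hx hy => rw [map_add, smul_add, map_add, hx, hy, smul_add]
    | tmul a x =>
      rw [single_smul_tmul, topMap_tmul, topMap_tmul, MellinLoc.single_smul_tmul, hN,
        Algebra.TensorProduct.map_tmul, mellinTorus_sigma, smul_smul, smul_smul,
        Algebra.TensorProduct.tmul_mul_tmul, Algebra.TensorProduct.tmul_mul_tmul, one_mul,
        AlgHom.id_apply, mul_one, ← TorusOp.x_mul, ← TorusOp.x_mul, mul_comm m]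

theorem topMap_surjective : Function.Surjective (topMap hN) := fun z => by
  induction z using MellinLoc.induction_on with
  | add x y hx hy =>
    obtain ⟨x, rfl⟩ := hx
    obtain ⟨y, rfl⟩ := hy
    exact ⟨x + y, map_add _ _ _⟩
  | tmul a x =>
    refine ⟨mulX D N (oneVec n)⁻¹ (tmul D a x), ?_⟩
    rw [topMap_apply, mulX_mulX, mul_inv_cancel, mulX_one, proj_tmul]

/-- Multiplication by $x_1\cdots x_n$ turns the image of $\nabla_j$ into that of
$\nu_j\otimes1-1\otimes\nu_j$, which vanishes over $\mathbb C[\nu]$. -/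
theorem topMap_nabla (j : Fin n) (z : BaseChange n D N) : topMap hN (nabla j z) = 0 := by
  obtain ⟨z, rfl⟩ := exists_mulX (unitVec j * (oneVec n)⁻¹) z
  rw [topMap_apply, nabla_mulX hN, mulX_mulX, mul_inv_cancel, mulX_one, proj_diag]

/-- Together with `topMap_nabla` and `topMap_surjective`, this makes $K\otimes_{\mathbb C[\nu]}N$
the quotient of $K\otimes_{\mathbb C}N$ by the images of the $\nabla_j$. It is the description of
the kernel by diagonal operators, transported by `nabla_mulX`. -/
theorem exists_eq_sum_nabla (z : BaseChange n D N) (hz : topMap hN z = 0) :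
    ∃ f : Fin n → BaseChange n D N, z = ∑ j, nabla j (f j) := by
  obtain ⟨f, hf⟩ := exists_eq_sum_diag hN (mulX D N (oneVec n) z) hz
  refine ⟨fun j => mulX D N (unitVec j * (oneVec n)⁻¹) (f j), ?_⟩
  simp only [nabla_mulX hN, ← map_sum]
  rw [← hf, mulX_mulX, inv_mul_cancel, mulX_one]

theorem topMap_map {D' : Type*} [Ring D'] [Algebra ℂ D'] {N' : Type*} [AddCommGroup N']
    [Module (D' ⊗[ℂ] TorusOp n) N'] [Module (D' ⊗[ℂ] Rpol n) N'] (hN' : MellinCompatible n D' N')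
    (f : D →ₐ[ℂ] D') (g : N →+ N') (h : ∀ r x, g (r • x) = baseMap (TorusOp n) f r • g x)
    (h' : ∀ r x, g (r • x) = baseMap (Rpol n) f r • g x) (z : BaseChange n D N) :
    topMap hN' (map f g h z) = MellinLoc.map f g h' (topMap hN z) := by
  induction z using induction_on with
  | add x y hx hy => simp only [map_add, hx, hy]
  | tmul a x =>
    rw [map_tmul, topMap_tmul, topMap_tmul, MellinLoc.map_tmul, h, Algebra.TensorProduct.map_tmul,
      map_one]
    rfl

end BaseChange

/-! ### Exactness for presheaves of modules -/

/-- Exactness of a short complex of presheaves of modules can be checked on sections. -/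
theorem presheafOfModules_exact {C : Type*} [Category C] {R : Cᵒᵖ ⥤ RingCat.{0}}
    (S : ShortComplex (PresheafOfModules.{0} R))
    (h : ∀ (U : Cᵒᵖ) (x : S.X₂.obj U), S.g.app U x = 0 → ∃ y, S.f.app U y = x) : S.Exact := by
  rw [ShortComplex.exact_iff_isZero_homology, IsZero.iff_id_eq_zero]
  refine PresheafOfModules.hom_ext fun U => ?_
  -- Evaluation at `U` commutes with homology, so the homology presheaf has zero sections over every
  -- `U`.
  have h' : (S.map (PresheafOfModules.evaluation.{0} R U)).Exact := by
    rw [ShortComplex.moduleCat_exact_iff]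
    exact h U
  rw [ShortComplex.exact_iff_isZero_homology] at h'
  exact (h'.of_iso (S.mapHomologyIso (PresheafOfModules.evaluation.{0} R U)).symm).eq_of_src _ _

/-! ### The presheaf complex: exactness outside degree $n$ and cokernel in degree $n$ -/

section Main

variable {Z : Scheme.{0}} [Z.Over SpecC] {n : ℕ} (M : SheafOfModules.{0} (D (ProdTorus Z n)))

/-- The two sides of the comparison use the same group of sections under two names; with both
actions on one type, the algebra above applies. -/
instance (U : Opens Z) : Module (DSec Z U ⊗[ℂ] Rpol n) (Push M U) :=
  inferInstanceAs (Module (DSec Z U ⊗[ℂ] Rpol n) (MellinPol M U))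

theorem push_compatible (U : Opens Z) : MellinCompatible n (DSec Z U) (Push M U) := fun _ _ => rfl

theorem nablaSec_exact (U : Opens Z) {k : ℕ} (hk : k + 1 < n)
    (φ : Forms n (k + 1) (BaseChange n (DSec Z U) (Push M U))) (hφ : nablaSec M (k + 1) U φ = 0) :
    ∃ ψ, nablaSec M k U ψ = φ :=
  forms_exact _ (fun i j x => BaseChange.nabla_comm i j x)
    (fun S a ha x f h => BaseChange.nabla_regular (push_compatible M U) S a ha x f h) hk φ hφ

theorem nablaSec_zero_injective (U : Opens Z) (hn : 0 < n)
    (φ : Forms n 0 (BaseChange n (DSec Z U) (Push M U))) (hφ : nablaSec M 0 U φ = 0) : φ = 0 :=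
  forms_zero_injective _ (fun i j x => BaseChange.nabla_comm i j x)
    (fun S a ha x f h => BaseChange.nabla_regular (push_compatible M U) S a ha x f h) hn φ hφ

/-- The set of all indices, as an index of a top form. -/
def topIndex (n : ℕ) : {I : Finset (Fin n) // I.card = n} := ⟨Finset.univ, Finset.card_fin n⟩

theorem eq_topIndex (I : {I : Finset (Fin n) // I.card = n}) : I = topIndex n :=
  Subtype.ext ((Finset.card_eq_iff_eq_univ I.1).mp (by rw [I.2, Fintype.card_fin]))

theorem isEmpty_index {k : ℕ} (hk : n < k) : IsEmpty {I : Finset (Fin n) // I.card = k} :=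
  ⟨fun I => by have := Finset.card_le_univ I.1; rw [I.2, Fintype.card_fin] at this; omega⟩

/-- The map `φ dx_1 ∧ ⋯ ∧ dx_n ↦ x_1 ⋯ x_n φ` from top forms to the partial Mellin transform. -/
def topSec (U : Opens Z) : Forms n n (BaseChange n (DSec Z U) (Push M U)) →+
    MellinLoc n (DSec Z U) (Push M U) :=
  (BaseChange.topMap (push_compatible M U)).comp (Pi.evalAddMonoidHom _ (topIndex n))

theorem topSec_surjective (U : Opens Z) : Function.Surjective (topSec M U) := fun z => by
  obtain ⟨x, hx⟩ := BaseChange.topMap_surjective (push_compatible M U) z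
  exact ⟨fun _ => x, hx⟩

/-- The conclusion uses `koszulD` in order to include `n = 0`, where no forms of degree `n - 1`
exist. The sum is then empty and says that the top coefficient is zero. -/
theorem topSec_eq_zero (U : Opens Z) (φ : Forms n n (BaseChange n (DSec Z U) (Push M U)))
    (hφ : topSec M U φ = 0) : ∃ e : Finset (Fin n) → BaseChange n (DSec Z U) (Push M U),
      koszulD (fun j => (BaseChange.nabla j :
        Module.End ℂ (BaseChange n (DSec Z U) (Push M U))).toAddMonoidHom) e Finset.univ =
          φ (topIndex n) := by
  obtain ⟨f, hf⟩ := BaseChange.exists_eq_sum_nabla (push_compatible M U) _ hφ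
  obtain ⟨e, he⟩ := exists_koszulD_eq_sum (fun j => (BaseChange.nabla j :
        Module.End ℂ (BaseChange n (DSec Z U) (Push M U))).toAddMonoidHom) Finset.univ f
  exact ⟨e, he.trans hf.symm⟩

theorem topMap_nablaSec (k : ℕ) (U : Opens Z)
    (φ : Forms n k (BaseChange n (DSec Z U) (Push M U))) (J) :
    BaseChange.topMap (push_compatible M U) (nablaSec M k U φ J) = 0 := by
  change BaseChange.topMap (push_compatible M U) (∑ j : J.1, _) = 0
  rw [map_sum]
  refine Finset.sum_eq_zero fun j _ => ?_
  rw [map_zsmul]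
  exact (congrArg _ (BaseChange.topMap_nabla (push_compatible M U) _ _)).trans (smul_zero _)

/-- The map from top forms to the partial Mellin transform, as a map of presheaves of modules. -/
def topPre : (relDRPre M).X n ⟶ mellinPre M :=
  PresheafOfModules.homMk (M₁ := omegaPre M n)
    { app := fun U => AddCommGrpCat.ofHom (topSec M (unop U))
      naturality := fun U V i => AddCommGrpCat.hom_ext (AddMonoidHom.ext fun φ =>
        BaseChange.topMap_map (push_compatible M U.unop) (push_compatible M V.unop)
          (DSec.res i.unop.le) (Push.res M i.unop.le) (Push.res_smul M i.unop.le)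
          (MellinPol.res_smul M i.unop.le) (φ (topIndex n))) }
    (fun U r φ => BaseChange.topMap_smul (push_compatible M U.unop) r (φ (topIndex n)))

instance : Epi (topPre M) :=
  PresheafOfModules.epi_of_surjective fun U => topSec_surjective M (unop U)

theorem relDRPre_d (k : ℕ) : (relDRPre M).d k (k + 1) = nablaPre M k :=
  CochainComplex.of_d _ _ _

theorem relDRPre_d_topPre (i : ℕ) : (relDRPre M).d i n ≫ topPre M = 0 := by
  by_cases h : i + 1 = n
  · subst h
    rw [relDRPre_d]
    refine PresheafOfModules.hom_ext fun U => ModuleCat.hom_ext (LinearMap.ext fun φ => ?_)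
    exact topMap_nablaSec M i (unop U) φ (topIndex (i + 1))
  · rw [(relDRPre M).shape i n h, zero_comp]

/-- Together with surjectivity, this presents the presheaf Mellin transform as the cokernel of the
differential into degree `n`. The source is indexed by `prev n`, the form in which it enters the
homology in degree `n`. -/
theorem topPre_exact : (ShortComplex.mk ((relDRPre M).d ((ComplexShape.up ℕ).prev n) n) (topPre M)
    (relDRPre_d_topPre M _)).Exact := by
  refine presheafOfModules_exact _ fun U φ hφ => ?_
  obtain ⟨e, he⟩ := topSec_eq_zero M (unop U) φ hφ
  -- Replacing `prev n` by a variable allows the case distinction on `n`. For `n = 0` the incoming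
  -- differential is zero, and exactness means injectivity of the map to the Mellin transform.
  have key : ∀ i, (ComplexShape.up ℕ).prev n = i → ∃ y, ((relDRPre M).d i n).app U y = φ := by
    intro i hi
    rcases n with _ | k
    · refine ⟨0, (map_zero _).trans (funext fun J => ?_)⟩
      rw [eq_topIndex J]
      exact he
    · obtain rfl : k = i := by rw [← hi, CochainComplex.prev_nat_succ]
      rw [relDRPre_d]
      refine ⟨fun I => e I.1, funext fun J => ?_⟩
      rw [eq_topIndex J, ← he]
      exact (koszulD_eq_twistedD (fun j => (BaseChange.nabla j : Module.End ℂ (BaseChange (k + 1)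
        (DSec Z (unop U)) (Push M (unop U)))).toAddMonoidHom) e (topIndex (k + 1))).symm
  exact key _ rfl

/-- No subset of `Fin n` has `n + 1` elements, so degree `n` is the top degree and its cohomology is
a cokernel. -/
theorem relDRPre_d_eq_zero (j : ℕ) : (relDRPre M).d n j = 0 := by
  by_cases h : n + 1 = j
  · subst h
    have := isEmpty_index (Nat.lt_succ_self n)
    exact PresheafOfModules.hom_ext fun U => ModuleCat.hom_ext (LinearMap.ext fun φ =>
      funext fun J => this.elim J)
  · exact (relDRPre M).shape n j h

theorem relDRPre_exactAt {j : ℕ} (hj : j ≠ n) : (relDRPre M).ExactAt j := by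
  rw [(relDRPre M).exactAt_iff' _ j (j + 1) rfl (CochainComplex.next ℕ j)]
  refine presheafOfModules_exact _ fun U φ hφ => ?_
  rcases hj.lt_or_gt with hj | hj
  · change ((relDRPre M).d j (j + 1)).app U φ = 0 at hφ
    rw [relDRPre_d] at hφ
    have key : ∀ i, (ComplexShape.up ℕ).prev j = i → ∃ y, ((relDRPre M).d i j).app U y = φ := by
      intro i hi
      rcases j with _ | k
      -- At degree `0` the incoming differential is zero, so exactness is injectivity of
      -- $\nabla_\omega$ on functions; `hj` now reads `0 < n`.
      · exact ⟨0, (map_zero _).trans (nablaSec_zero_injective M (unop U) hj φ hφ).symm⟩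
      · obtain rfl : k = i := by rw [← hi, CochainComplex.prev_nat_succ]
        rw [relDRPre_d]
        exact nablaSec_exact M (unop U) hj φ hφ
    exact key _ rfl
  -- Above degree `n` there are no index sets, hence no nonzero forms.
  · have := isEmpty_index hj
    exact ⟨0, funext fun J => this.elim J⟩

end Main

end PartialMellin

end

/-! ### Passage to the associated sheaves -/

theorem mainTheorem12
    (Z : AlgebraicGeometry.Scheme.{0}) [Z.Over PartialMellin.SpecC]
    [AlgebraicGeometry.Smooth (Z ↘ PartialMellin.SpecC)]
    [AlgebraicGeometry.IsSeparated (Z ↘ PartialMellin.SpecC)]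
    [AlgebraicGeometry.QuasiCompact (Z ↘ PartialMellin.SpecC)]
    [IrreducibleSpace Z]
    (n : ℕ) (M : SheafOfModules.{0} (PartialMellin.D (PartialMellin.ProdTorus Z n))) :
    Nonempty (PartialMellin.mellin M ≅ (PartialMellin.relDR M).homology n) ∧
      ∀ j : ℕ, j ≠ n → CategoryTheory.Limits.IsZero ((PartialMellin.relDR M).homology j) := by
  let F := PresheafOfModules.sheafification.{0} (PartialMellin.toDD Z n)
  refine ⟨?_, fun j hj => ?_⟩
  -- With zero outgoing differential, the homology in degree `n` is the cokernel of the incoming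
  -- one.
  · have hd : ((PartialMellin.relDR M).sc n).g = 0 :=
      (congrArg F.map (PartialMellin.relDRPre_d_eq_zero M _)).trans (F.map_zero _ _)
    have : Epi (ShortComplex.mk _ _ (PartialMellin.relDRPre_d_topPre M
        ((ComplexShape.up ℕ).prev n))).g := inferInstanceAs (Epi (PartialMellin.topPre M))
    -- Sheafification preserves cokernels, so the presheaf presentation of the Mellin transform
    -- becomes one over `DD`.
    have h := CokernelCofork.mapIsColimit _ (PartialMellin.topPre_exact M).gIsCokernel F
    exact ⟨(ShortComplex.HomologyData.ofIsColimitCokernelCofork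
      ((PartialMellin.relDR M).sc n) hd _ h).left.homologyIso.symm⟩
  -- Exactness outside degree `n` survives because sheafification is an exact functor.
  · have h := (PartialMellin.relDRPre_exactAt M hj).map F
    exact HomologicalComplex.ExactAt.isZero_homology h
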